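/- **Problem and assumptions.** Let $f_1,g_1:\mathbb R^n\to\mathbb R$ be convex and $C^1$ with $L_{f_1}$- and $L_{g_1}$-Lipschitz gradients, and let $f_2,g_2:\mathbb R^n\to(-\infty,+\infty]$ be proper, lower semicontinuous and convex, $f_2$ being $l_{f_2}$-Lipschitz on its domain. Put $f=f_1+f_2$, $g=g_1+g_2$, $X=\operatorname{dom} f\cap\operatorname{dom} g$, $f^*=\inf_X f$, $g^*=\inf_X g$ (both assumed finite), $X_g^*=\operatorname{argmin}_{\mathbb R^n} g$. The simple bilevel problem is $\min\{f(x):x\in X_g^*\}$, with optimal value $p^*$; assume that it is feasible ($X\cap X_g^*\ne\emptyset$), that $X_g^*$ has more than one point, and that $p^*-f^*\ge\Delta$ for some $\Delta>0$. For $t>0$, the minimizers $\operatorname{prox}_{t\psi}(y)=\operatorname{argmin}_{x\in X}\psi(x)+\frac1{2t}\|x-y\|^2$ are assumed to exist for $\psi=f_2$ and for $\psi=g_2+\gamma f_2$, $\gamma\ge0$. Every proximal mapping below is taken over $X$, and $\partial\varphi$ denotes the convex subdifferential of the function that equals $\varphi$ on $X$ and $+\infty$ elsewhere. A point $x\in X$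 is $(\epsilon_f,\epsilon_g)$-optimal if $f(x)-p^*\le\epsilon_f$ and $g(x)-g^*\le\epsilon_g$. **Subroutines.** Write $T_L(y)=\operatorname{prox}_{\varphi_2/L}(y-\frac1L\nabla\varphi_1(y))$ and call $L$ *accepted* at $y$ if $x=T_L(y)$ satisfies $\varphi_1(x)\le\varphi_1(y)+\langle\nabla\varphi_1(y),x-y\rangle+\frac L2\|x-y\|^2$. * ${\rm APG}_0(\varphi_1,\varphi_2,L_0,\eta,x_0,\epsilon)$: put $y_1=x_0$, $t_1=1$. For $k=1,2,\dots$ let $L_k$ be the first accepted value at $y_k$ among $L_{k-1},\eta L_{k-1},\eta^2L_{k-1},\dots$; let $x_k=T_{L_k}(y_k)$, $t_{k+1}=\frac{1+\sqrt{1+4t_k^2}}2$, $y_{k+1}=x_k+\frac{t_k-1}{t_{k+1}}(x_k-x_{k-1})$; return $x_k$ as soon as $2\eta L_{\varphi_1}R^2/(k+1)^2\le\epsilon$. * ${\rm APG}_\mu(\varphi_1,\varphi_2,L_{\min},\mu,\gamma_1,\gamma_2,y_0,\epsilon)$: let $\tilde L$ be the first accepted value at $y_0$ among $\gamma_1^iL_{\min}$,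 $i\ge0$; put $x_{-1}=x_0=T_{\tilde L}(y_0)$, $L_0=\max\{L_{\min},\tilde L/\gamma_2\}$, $\alpha_{-1}=1$. For $k=0,1,\dots$: let $\tilde L$ be the first of $\gamma_1^iL_k$, $i\ge0$, that is accepted at $\tilde y=x_k+\frac{\alpha_k(1-\alpha_{k-1})}{\alpha_{k-1}(1+\alpha_k)}(x_k-x_{k-1})$, where $\alpha_k=\sqrt{\mu/\tilde L}$; put $x_{k+1}=T_{\tilde L}(\tilde y)$; let $\hat L$ be the first of $\gamma_1^i\tilde L$, $i\ge0$, accepted at $x_{k+1}$ and $\hat x=T_{\hat L}(x_{k+1})$; put $L_{k+1}=\max\{L_{\min},\tilde L/\gamma_2\}$; return $\hat x$ as soon as ${\rm dist}(0,\partial(\varphi_1+\varphi_2)(\hat x))\le\epsilon$. **Parameters.** $\eta>1$, $0<L_0\le\eta\min\{L_{f_1},L_{g_1}\}$, $L_{\min}>0$, $\gamma_1>1$, $\gamma_2\ge1$, $\Delta_1>0$, initial points $x_0^f,x_0^g$, and radii $R_f,R_g$ such that some minimizer of $f$ (of $g$) over $X$ lies within $R_f$ of $x_0^f$ (within $R_g$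 of $x_0^g$). For $\epsilon>0$ let $\epsilon_f=4\epsilon$, $\epsilon_g=3\epsilon$, $\tilde x_f={\rm APG}_0(f_1,f_2,L_0,\eta,x_0^f,\epsilon_f/4)$ with $R=R_f$ and $\tilde x_g={\rm APG}_0(g_1,g_2,L_0,\eta,x_0^g,\epsilon_g/3)$ with $R=R_g$; put $x^0=\tilde x_f$, $l_0=f(\tilde x_f)-\epsilon$, $u_0=f(\tilde x_g)$, $$D_z=\frac{g(x^0)-g(\tilde x_g)+1}{\Delta_1},\quad L_\varphi=L_{g_1}+2D_zL_{f_1}+1,\quad D_0=g(x^0)+\max\{0,-2D_zf^*\}+2D_z|u_0|.$$ Let $R_1$ be the diameter of $\{g\le D_0\}$, $D_{\mathcal L}=D_0+\gamma_1L_\varphi R_1^2$, $D_g$ the diameter of $\{g\le D_{\mathcal L}\}$, $B_f=\sup_{\{g\le D_{\mathcal L}\}}\|\nabla f_1\|+l_{f_2}$, $D=(1+D_g(1+D_g))\max\{B_f,\,2D_zB_f+2D_zB_f^2\}$, and $\epsilon_1=\epsilon_4=\epsilon^2/D$, $\epsilon_2=B_f\epsilon/D$, $\epsilon_3=(2D_zB_f+2D_zB_f^2)\epsilon/D$.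 For $z\ge0$, let $A_z(y)={\rm APG}_\mu(g_1+\frac\epsilon2\|\cdot-x^0\|^2+zf_1,\;g_2+zf_2,\;L_{\min},\epsilon,\gamma_1,\gamma_2,y,\epsilon_1)$, and let $f_c=f-c$. * ${\rm IntV}(c,x)$: put $\hat x=A_0(x)$; if $[f_c(\hat x)]_+\le\epsilon_2$ return $Z=\{0\}$. Otherwise put $a=0$, $b=1$, $\hat x\leftarrow A_1(\hat x)$; while $[f_c(\hat x)]_+>\epsilon_2$ and $b\le D_z$, put $a=b$, $b\leftarrow2b$, $\hat x\leftarrow A_b(\hat x)$. Return $Z=\{b\}$ if $|bf_c(\hat x)|\le\epsilon_3$ and $Z=[a,b]$ otherwise. The current point becomes the last $\hat x$, which is also stored as the point for $\max Z$. * ${\rm Bisec}(c,Z,x)$, $Z=[a,b]$: put $\hat x=x$; while $b-a>\epsilon_4$, put $e=\frac{a+b}2$, $\hat x\leftarrow A_e(\hat x)$; if $[f_c(\hat x)]_+>\epsilon_2$ put $a=e$; else if $|ef_c(\hat x)|\le\epsilon_3$ return $\hat x$; else put $b=e$ and store $\hat x$ as the point for $b$. At the end of the loop return the point stored for $b$.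 **BiVFA.** Compute $\tilde x_f$ and $\tilde x_g$, put $l=l_0$, $u=u_0$, $x_u=\tilde x_g$, $\hat x=\tilde x_f$ and $Z={\rm IntV}(\frac{l+u}2,\hat x)$. While $u-l>\frac34\epsilon_f$: put $c=\frac{l+u}2$; if $c-l_0<\Delta_1$ return $x_u$; put $\hat x\leftarrow{\rm Bisec}(c,Z,\hat x)$; if $g(\hat x)>g(\tilde x_g)+\epsilon_g/3$, put $l=c$ and $Z=[0,\max Z]$ (keeping the point stored for $\max Z$); otherwise put $u=f(\hat x)$, $x_u=\hat x$ and $Z={\rm IntV}(\frac{l+u}2,\hat x)$. At the end of the loop return $x_u$. One oracle query is one evaluation of $\varphi_1,\varphi_2,\nabla\varphi_1$ and of the proximal mapping. Each trial value in a line search is charged two queries, and each stopping test and each evaluation of the objectives in the outer procedures one more. **Theorem.** Fix the data and the parameters, and a number $M$. There are $C>0$ and $\bar\epsilon>0$, depending only on these, such that the following holds for every $\epsilon\in(0,\bar\epsilon)$ that satisfies * (regularity) $f_c(x^0)<-\Delta_1$ for every $c$ processed in the while loop of BiVFA; * (bounded level sets) $\{g\le D_0\}$ and $\{g\le D_{\mathcal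 L}\}$ are bounded; * $1\le2D_z$, $D_z\le M$ and $D_g\le M$. BiVFA terminates, its output is a $(4\epsilon,3\epsilon)$-optimal solution of the simple bilevel problem, and the total number of oracle queries is at most $$C\sqrt{\frac{L_{g_1}+2D_zL_{f_1}+1}{\epsilon}}\;|\log\epsilon|^3 .$$ -/

import Mathlib

open scoped NNReal ENNReal RealInnerProductSpace

namespace SimpleBilevel

/-! ### Computations with a count of oracle queries -/

/-- A value together with the number of oracle queries spent on computing it; the number is `⊤`
when the computation does not terminate. -/
structure Timed (α : Type) where
  val : α
  cost : ℕ∞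

open Classical in
/-- `while cond do body`: iterate `body` until `cond` fails for the first time, adding up the
queries. If `cond` never fails the loop diverges and the count is `⊤`. -/
noncomputable def whileLoop {σ : Type} (cond : σ → Prop) (body : σ → Timed σ) (s : σ) : Timed σ :=
  if h : ∃ k : ℕ, ¬ cond ((fun t => (body t).val)^[k] s) then
    ⟨(fun t => (body t).val)^[Nat.find h] s,
      ∑ i ∈ Finset.range (Nat.find h), (body ((fun t => (body t).val)^[i] s)).cost⟩
  else ⟨s, ⊤⟩

/-- `repeat body until halt`. -/
noncomputable def repeatUntil {σ : Type} (halt : σ → Prop) (body : σ → Timed σ) (s : σ) : Timed σ :=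
  ⟨(whileLoop (fun t => ¬ halt t) body (body s).val).val,
    (body s).cost + (whileLoop (fun t => ¬ halt t) body (body s).val).cost⟩

open Classical in
/-- Backtracking: try `L, γ L, γ² L, …` and return the first value which is accepted.
Every trial is charged two queries: one at the base point, one at the trial point. -/
noncomputable def backtrack (γ L : ℝ) (accept : ℝ → Prop) : Timed ℝ :=
  if h : ∃ i : ℕ, accept (γ ^ i * L) then
    ⟨γ ^ Nat.find h * L, 2 * ((Nat.find h : ℕ) + 1 : ℕ∞)⟩
  else ⟨L, ⊤⟩

/-! ### Composite convex minimization over a set -/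

section Composite

variable {n : ℕ}

/-- `x` minimizes `ψ + ‖· - y‖² / (2 t)` over `X`. -/
def IsProx (X : Set (EuclideanSpace ℝ (Fin n))) (ψ : EuclideanSpace ℝ (Fin n) → ℝ) (t : ℝ)
    (y x : EuclideanSpace ℝ (Fin n)) : Prop :=
  x ∈ X ∧ ∀ w ∈ X, ψ x + 1 / (2 * t) * ‖x - y‖ ^ 2 ≤ ψ w + 1 / (2 * t) * ‖w - y‖ ^ 2

/-- The proximal mapping of `t ψ`, with the minimum taken over `X`. -/
noncomputable def prox (X : Set (EuclideanSpace ℝ (Fin n))) (ψ : EuclideanSpace ℝ (Fin n) → ℝ)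
    (t : ℝ) (y : EuclideanSpace ℝ (Fin n)) : EuclideanSpace ℝ (Fin n) :=
  Classical.epsilon (IsProx X ψ t y)

/-- The proximal gradient step with step size `1 / L`. -/
noncomputable def proxGrad (X : Set (EuclideanSpace ℝ (Fin n)))
    (φ₁ φ₂ : EuclideanSpace ℝ (Fin n) → ℝ) (L : ℝ) (y : EuclideanSpace ℝ (Fin n)) :
    EuclideanSpace ℝ (Fin n) :=
  prox X φ₂ (1 / L) (y - (1 / L) • gradient φ₁ y)

/-- The quadratic upper model of `φ₁` at `y` with constant `L` is valid at `x`. -/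
def Descent (φ₁ : EuclideanSpace ℝ (Fin n) → ℝ) (L : ℝ) (y x : EuclideanSpace ℝ (Fin n)) : Prop :=
  φ₁ x ≤ φ₁ y + ⟪gradient φ₁ y, x - y⟫ + L / 2 * ‖x - y‖ ^ 2

/-- The convex subdifferential at `x` of the function equal to `φ` on `X` and `+∞` elsewhere. -/
def subdiff (X : Set (EuclideanSpace ℝ (Fin n))) (φ : EuclideanSpace ℝ (Fin n) → ℝ)
    (x : EuclideanSpace ℝ (Fin n)) : Set (EuclideanSpace ℝ (Fin n)) :=
  {v | x ∈ X ∧ ∀ w ∈ X, φ x + ⟪v, w - x⟫ ≤ φ w}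

/-- `dist(0, ∂φ(x)) ≤ ε`; the distance to an empty subdifferential is infinite. -/
def NearStationary (X : Set (EuclideanSpace ℝ (Fin n))) (φ : EuclideanSpace ℝ (Fin n) → ℝ)
    (ε : ℝ) (x : EuclideanSpace ℝ (Fin n)) : Prop :=
  Metric.infEDist 0 (subdiff X φ x) ≤ ENNReal.ofReal ε

/-! ### Accelerated proximal gradient method, strongly convex case -/

/-- The state `(x_{k-1}, x_k, α_{k-1}, L_k, x̂_k)`. -/
structure ApgState (n : ℕ) where
  xprev : EuclideanSpace ℝ (Fin n)
  x : EuclideanSpace ℝ (Fin n)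
  α : ℝ
  L : ℝ
  xhat : EuclideanSpace ℝ (Fin n)

/-- The extrapolated point for the trial constant `L`, where `α_k = √(μ / L)`. -/
noncomputable def apgExtrapolate (μ : ℝ) (s : ApgState n) (L : ℝ) : EuclideanSpace ℝ (Fin n) :=
  s.x + (√(μ / L) * (1 - s.α) / (s.α * (1 + √(μ / L)))) • (s.x - s.xprev)

/-- One iteration: an accelerated step with line search, then a plain proximal gradient step with
line search which produces `x̂`. The last query pays for the stopping test at `x̂`. -/
noncomputable def apgBody (X : Set (EuclideanSpace ℝ (Fin n)))
    (φ₁ φ₂ : EuclideanSpace ℝ (Fin n) → ℝ) (Lmin μ γ₁ γ₂ : ℝ) (s : ApgState n) :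
    Timed (ApgState n) :=
  let search := backtrack γ₁ s.L fun L =>
    Descent φ₁ L (apgExtrapolate μ s L) (proxGrad X φ₁ φ₂ L (apgExtrapolate μ s L))
  let Lt := search.val
  let xt := proxGrad X φ₁ φ₂ Lt (apgExtrapolate μ s Lt)
  let search2 := backtrack γ₁ Lt fun L => Descent φ₁ L xt (proxGrad X φ₁ φ₂ L xt)
  ⟨{ xprev := s.x
     x := xt
     α := √(μ / Lt)
     L := max Lmin (Lt / γ₂)
     xhat := proxGrad X φ₁ φ₂ search2.val xt },
    search.cost + search2.cost + 1⟩

/-- `APG_μ(φ₁, φ₂, L_min, μ, γ₁, γ₂, y₀, ε)`. -/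
noncomputable def apgMu (X : Set (EuclideanSpace ℝ (Fin n)))
    (φ₁ φ₂ : EuclideanSpace ℝ (Fin n) → ℝ) (Lmin μ γ₁ γ₂ : ℝ) (y₀ : EuclideanSpace ℝ (Fin n))
    (ε : ℝ) : Timed (EuclideanSpace ℝ (Fin n)) :=
  let search := backtrack γ₁ Lmin fun L => Descent φ₁ L y₀ (proxGrad X φ₁ φ₂ L y₀)
  let x₀ := proxGrad X φ₁ φ₂ search.val y₀
  let run := repeatUntil (fun s => NearStationary X (fun x => φ₁ x + φ₂ x) ε s.xhat)
    (apgBody X φ₁ φ₂ Lmin μ γ₁ γ₂)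
    { xprev := x₀, x := x₀, α := 1, L := max Lmin (search.val / γ₂), xhat := x₀ }
  ⟨run.val.xhat, search.cost + run.cost⟩

/-! ### Accelerated proximal gradient method, convex case (FISTA with backtracking) -/

/-- The state after `k` iterations: `(k, x_k, y_{k+1}, t_{k+1}, L_k)`. -/
structure FistaState (n : ℕ) where
  k : ℕ
  x : EuclideanSpace ℝ (Fin n)
  y : EuclideanSpace ℝ (Fin n)
  t : ℝ
  L : ℝ

/-- One iteration. The acceptance test `φ(p) ≤ Q_L(p, y)` at `p = p_L(y)` is `Descent`, since the
nonsmooth term occurs with the same value on both sides. -/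
noncomputable def fistaBody (X : Set (EuclideanSpace ℝ (Fin n)))
    (φ₁ φ₂ : EuclideanSpace ℝ (Fin n) → ℝ) (η : ℝ) (s : FistaState n) : Timed (FistaState n) :=
  let search := backtrack η s.L fun L => Descent φ₁ L s.y (proxGrad X φ₁ φ₂ L s.y)
  let xnew := proxGrad X φ₁ φ₂ search.val s.y
  let tnew := (1 + √(1 + 4 * s.t ^ 2)) / 2
  ⟨{ k := s.k + 1
     x := xnew
     y := xnew + ((s.t - 1) / tnew) • (xnew - s.x)
     t := tnew
     L := search.val },
    search.cost⟩

/-- `APG₀(φ₁, φ₂, L₀, η, x₀, ε)`, stopped as soon as `2 η L R² / (k + 1)² ≤ ε`, where `L` is the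
Lipschitz constant of the gradient of `φ₁`. -/
noncomputable def fista (X : Set (EuclideanSpace ℝ (Fin n)))
    (φ₁ φ₂ : EuclideanSpace ℝ (Fin n) → ℝ) (L₀ η : ℝ) (x₀ : EuclideanSpace ℝ (Fin n))
    (L R ε : ℝ) : Timed (EuclideanSpace ℝ (Fin n)) :=
  let run := repeatUntil
    (fun s : FistaState n => 2 * η * L / ((s.k : ℝ) + 1) ^ 2 * R ^ 2 ≤ ε)
    (fistaBody X φ₁ φ₂ η) { k := 0, x := x₀, y := x₀, t := 1, L := L₀ }
  ⟨run.val.x, run.cost⟩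

end Composite

/-! ### The simple bilevel problem -/

/-- The data of the problem: minimize `f₁ + f₂` over the minimizers of `g₁ + g₂` on `ℝⁿ`. -/
structure Problem (n : ℕ) where
  f₁ : EuclideanSpace ℝ (Fin n) → ℝ
  g₁ : EuclideanSpace ℝ (Fin n) → ℝ
  f₂ : EuclideanSpace ℝ (Fin n) → EReal
  g₂ : EuclideanSpace ℝ (Fin n) → EReal

/-- A proper, lower semicontinuous, convex function with values in `(-∞, +∞]`. -/
structure ProperLscConvex {n : ℕ} (h : EuclideanSpace ℝ (Fin n) → EReal) : Prop where
  ne_bot : ∀ x, h x ≠ ⊥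
  exists_ne_top : ∃ x, h x ≠ ⊤
  lsc : LowerSemicontinuous h
  convex_epigraph : Convex ℝ {p : EuclideanSpace ℝ (Fin n) × ℝ | h p.1 ≤ (p.2 : EReal)}

namespace Problem

variable {n : ℕ} (P : Problem n)

/-- `X = dom f ∩ dom g`. -/
def X : Set (EuclideanSpace ℝ (Fin n)) := {x | P.f₂ x ≠ ⊤ ∧ P.g₂ x ≠ ⊤}

/-- The finite values of `f₂`. -/
noncomputable def rf₂ (x : EuclideanSpace ℝ (Fin n)) : ℝ := (P.f₂ x).toReal

/-- The finite values of `g₂`. -/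
noncomputable def rg₂ (x : EuclideanSpace ℝ (Fin n)) : ℝ := (P.g₂ x).toReal

/-- The upper-level objective; only its values on `dom f` are meaningful. -/
noncomputable def f (x : EuclideanSpace ℝ (Fin n)) : ℝ := P.f₁ x + P.rf₂ x

/-- The lower-level objective; only its values on `dom g` are meaningful. -/
noncomputable def g (x : EuclideanSpace ℝ (Fin n)) : ℝ := P.g₁ x + P.rg₂ x

/-- The lower-level objective with values in `(-∞, +∞]`. -/
noncomputable def gExt (x : EuclideanSpace ℝ (Fin n)) : EReal := (P.g₁ x : EReal) + P.g₂ x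

/-- The solution set of the lower-level problem. -/
def lowerSolutions : Set (EuclideanSpace ℝ (Fin n)) := {x | ∀ y, P.gExt x ≤ P.gExt y}

/-- The level set `{z : g(z) ≤ D}`. -/
def levG (D : ℝ) : Set (EuclideanSpace ℝ (Fin n)) := {x | P.gExt x ≤ (D : EReal)}

/-- `f^*`, the infimum of `f` over `X`. -/
noncomputable def fStar : ℝ := sInf (P.f '' P.X)

/-- `g^*`, the infimum of `g` over `X`. -/
noncomputable def gStar : ℝ := sInf (P.g '' P.X)

/-- `p^*`, the optimal value of the bilevel problem. -/
noncomputable def pStar : ℝ := sInf (P.f '' (P.X ∩ P.lowerSolutions))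

/-- `(ε_f, ε_g)`-optimal solutions of the bilevel problem. -/
def IsOptimal (εf εg : ℝ) (x : EuclideanSpace ℝ (Fin n)) : Prop :=
  x ∈ P.X ∧ P.f x - P.pStar ≤ εf ∧ P.g x - P.gStar ≤ εg

/-- The basic assumption on the data, together with the standing assumptions that the bilevel
problem is feasible and that the lower-level problem has more than one solution. -/
structure Basic (Lf Lg lf₂ : ℝ≥0) : Prop where
  convex_f₁ : ConvexOn ℝ Set.univ P.f₁
  convex_g₁ : ConvexOn ℝ Set.univ P.g₁
  smooth_f₁ : ContDiff ℝ 1 P.f₁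
  smooth_g₁ : ContDiff ℝ 1 P.g₁
  lipschitz_grad_f₁ : LipschitzWith Lf (gradient P.f₁)
  lipschitz_grad_g₁ : LipschitzWith Lg (gradient P.g₁)
  f₂_proper : ProperLscConvex P.f₂
  g₂_proper : ProperLscConvex P.g₂
  lipschitz_f₂ : LipschitzOnWith lf₂ P.rf₂ {x | P.f₂ x ≠ ⊤}
  prox_f₂ : ∀ t : ℝ, 0 < t → ∀ y, ∃ x, IsProx P.X P.rf₂ t y x
  prox_g₂ : ∀ γ : ℝ, 0 ≤ γ → ∀ t : ℝ, 0 < t → ∀ y,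
    ∃ x, IsProx P.X (fun w => P.rg₂ w + γ * P.rf₂ w) t y x
  bddBelow_f : BddBelow (P.f '' P.X)
  bddBelow_g : BddBelow (P.g '' P.X)
  solutions_nontrivial : P.lowerSolutions.Nontrivial
  feasible : (P.X ∩ P.lowerSolutions).Nonempty
  gap : ∃ Δ : ℝ, 0 < Δ ∧ Δ ≤ P.pStar - P.fStar

end Problem

/-! ### The algorithm BiVFA -/

/-- The parameters of the algorithm: the constants `L_{f₁}`, `L_{g₁}`, `l_{f₂}`; the initial
constant `L₀`, the increase rate `η`, the initial points and the radii in the stopping rule of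
`APG₀`; `L_min`, `γ₁`, `γ₂` for `APG_μ`; and `Δ₁`. -/
structure Params (n : ℕ) where
  Lf : ℝ≥0
  Lg : ℝ≥0
  lf₂ : ℝ≥0
  L₀ : ℝ
  η : ℝ
  x₀f : EuclideanSpace ℝ (Fin n)
  x₀g : EuclideanSpace ℝ (Fin n)
  Rf : ℝ
  Rg : ℝ
  Lmin : ℝ
  γ₁ : ℝ
  γ₂ : ℝ
  Δ₁ : ℝ

/-- Admissible parameters. The radii bound the distance of the initial points to some minimizer of
`f`, respectively `g`, on `X`. -/
structure Params.Admissible {n : ℕ} (A : Params n) (P : Problem n) : Prop where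
  η_gt : 1 < A.η
  L₀_pos : 0 < A.L₀
  L₀_le_f : A.L₀ ≤ A.η * A.Lf
  L₀_le_g : A.L₀ ≤ A.η * A.Lg
  radius_f : ∃ x ∈ P.X, (∀ y ∈ P.X, P.f x ≤ P.f y) ∧ ‖A.x₀f - x‖ ≤ A.Rf
  radius_g : ∃ x ∈ P.X, (∀ y ∈ P.X, P.g x ≤ P.g y) ∧ ‖A.x₀g - x‖ ≤ A.Rg
  Lmin_pos : 0 < A.Lmin
  γ₁_gt : 1 < A.γ₁
  γ₂_ge : 1 ≤ A.γ₂
  Δ₁_pos : 0 < A.Δ₁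

section Algorithm

variable {n : ℕ} (P : Problem n) (A : Params n) (ε : ℝ)

/-- The run producing `x̃_f`, with tolerance `ε_f / 4 = ε`. -/
noncomputable def runF : Timed (EuclideanSpace ℝ (Fin n)) :=
  fista P.X P.f₁ P.rf₂ A.L₀ A.η A.x₀f A.Lf A.Rf ε

/-- The run producing `x̃_g`, with tolerance `ε_g / 3 = ε`. -/
noncomputable def runG : Timed (EuclideanSpace ℝ (Fin n)) :=
  fista P.X P.g₁ P.rg₂ A.L₀ A.η A.x₀g A.Lg A.Rg ε

/-- The point `x⁰ = x̃_f`. -/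
noncomputable def x0 : EuclideanSpace ℝ (Fin n) := (runF P A ε).val

/-- The point `x̃_g`. -/
noncomputable def xg : EuclideanSpace ℝ (Fin n) := (runG P A ε).val

/-- `l₀ = f(x̃_f) - ε_f / 4`. -/
noncomputable def l0 : ℝ := P.f (x0 P A ε) - ε

/-- `u₀ = f(x̃_g)`. -/
noncomputable def u0 : ℝ := P.f (xg P A ε)

/-- `D_z = (g(x⁰) - g(x̃_g) + 1) / Δ₁`. -/
noncomputable def Dz : ℝ := (P.g (x0 P A ε) - P.g (xg P A ε) + 1) / A.Δ₁

/-- `L_{φ₁} = L_{g₁} + 2 D_z L_{f₁} + 1`. -/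
noncomputable def Lφ : ℝ := A.Lg + 2 * Dz P A ε * A.Lf + 1

/-- `D₀ = g(x⁰) + max{0, -2 D_z f^*} + 2 D_z |u₀|`. -/
noncomputable def D0 : ℝ :=
  P.g (x0 P A ε) + max 0 (-2 * Dz P A ε * P.fStar) + 2 * Dz P A ε * |u0 P A ε|

/-- The diameter `R₁` of the level set of `g` at `D₀`. -/
noncomputable def R1 : ℝ := Metric.diam (P.levG (D0 P A ε))

/-- `D_{L_z} = D₀ + γ₁ L_{φ₁} R₁²`. -/
noncomputable def DL : ℝ := D0 P A ε + A.γ₁ * Lφ P A ε * R1 P A ε ^ 2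

/-- The diameter `D_g` of the level set of `g` at `D_{L_z}`. -/
noncomputable def Dg : ℝ := Metric.diam (P.levG (DL P A ε))

/-- Bounded level sets of `g`. -/
def BoundedLevelSets : Prop :=
  Bornology.IsBounded (P.levG (D0 P A ε)) ∧ Bornology.IsBounded (P.levG (DL P A ε))

/-- `B_f = max ‖∇f₁‖ + l_{f₂}`, the maximum over the level set of `g` at `D_{L_z}`. -/
noncomputable def Bf : ℝ :=
  sSup ((fun x => ‖gradient P.f₁ x‖) '' P.levG (DL P A ε)) + A.lf₂

/-- The constant `D` in the tolerances. -/
noncomputable def Dtol : ℝ :=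
  (1 + Dg P A ε * (1 + Dg P A ε)) *
    max (Bf P A ε) (2 * Dz P A ε * Bf P A ε + 2 * Dz P A ε * Bf P A ε ^ 2)

noncomputable def ε₁ : ℝ := ε ^ 2 / Dtol P A ε

noncomputable def ε₂ : ℝ := Bf P A ε * ε / Dtol P A ε

noncomputable def ε₃ : ℝ :=
  (2 * Dz P A ε * Bf P A ε + 2 * Dz P A ε * Bf P A ε ^ 2) * ε / Dtol P A ε

noncomputable def ε₄ : ℝ := ε ^ 2 / Dtol P A ε

/-- The call `APG_μ(g_ε + z f₁, g₂ + z f₂, L_min, μ, γ₁, γ₂, y, ε₁)` with `μ = ε` and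
`g_ε = g₁ + (ε / 2) ‖· - x⁰‖²`. The additional query pays for the evaluation of the objectives at
the output. -/
noncomputable def apgCall (z : ℝ) (y : EuclideanSpace ℝ (Fin n)) :
    Timed (EuclideanSpace ℝ (Fin n)) :=
  let r := apgMu P.X (fun x => P.g₁ x + ε / 2 * ‖x - x0 P A ε‖ ^ 2 + z * P.f₁ x)
    (fun x => P.rg₂ x + z * P.rf₂ x) A.Lmin ε A.γ₁ A.γ₂ y (ε₁ P A ε)
  ⟨r.val, r.cost + 1⟩

/-- A multiplier interval `[a, b]` with the point computed for the multiplier `b`. -/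
structure MultInterval (n : ℕ) where
  a : ℝ
  b : ℝ
  xb : EuclideanSpace ℝ (Fin n)

/-- The loop of the interval search for the constraint `f ≤ c`: double `b`. -/
noncomputable def intVLoop (c : ℝ) (s : MultInterval n) : Timed (MultInterval n) :=
  whileLoop (fun s => max (P.f s.xb - c) 0 > ε₂ P A ε ∧ s.b ≤ Dz P A ε)
    (fun s => ⟨{ a := s.b, b := 2 * s.b, xb := (apgCall P A ε (2 * s.b) s.xb).val },
      (apgCall P A ε (2 * s.b) s.xb).cost⟩) s

open Classical in
/-- Interval search from `[0, σ]` for the constraint `f ≤ c`, started at `x`. A single multiplier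
`{b}` is returned as `[b, b]`. -/
noncomputable def intV (c σ : ℝ) (x : EuclideanSpace ℝ (Fin n)) : Timed (MultInterval n) :=
  let r₀ := apgCall P A ε 0 x
  if max (P.f r₀.val - c) 0 ≤ ε₂ P A ε then ⟨{ a := 0, b := 0, xb := r₀.val }, r₀.cost⟩
  else
    let r₁ := apgCall P A ε σ r₀.val
    let r₂ := intVLoop P A ε c { a := 0, b := σ, xb := r₁.val }
    let Z := r₂.val
    ⟨if |Z.b * (P.f Z.xb - c)| ≤ ε₃ P A ε then { a := Z.b, b := Z.b, xb := Z.xb } else Z,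
      r₀.cost + r₁.cost + r₂.cost⟩

/-- The state of the dual bisection: the interval `[a, b]`, the point `xb` for the multiplier `b`,
the last computed point `x`, and whether the loop has been left early. -/
structure BisecState (n : ℕ) where
  a : ℝ
  b : ℝ
  xb : EuclideanSpace ℝ (Fin n)
  x : EuclideanSpace ℝ (Fin n)
  done : Bool

open Classical in
/-- One iteration of the dual bisection. -/
noncomputable def bisecBody (c : ℝ) (s : BisecState n) : Timed (BisecState n) :=
  let e := (s.a + s.b) / 2
  let r := apgCall P A ε e s.x
  let v := P.f r.val - c
  ⟨if max v 0 > ε₂ P A ε then { s with a := e, x := r.val }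
    else if |e * v| ≤ ε₃ P A ε then { s with b := e, xb := r.val, x := r.val, done := true }
    else { s with b := e, xb := r.val, x := r.val },
    r.cost⟩

/-- Bisection on the multiplier in `Z` for the constraint `f ≤ c`, started at `x`; it returns the
point for the final multiplier. -/
noncomputable def bisec (c : ℝ) (Z : MultInterval n) (x : EuclideanSpace ℝ (Fin n)) :
    Timed (EuclideanSpace ℝ (Fin n)) :=
  let r := whileLoop (fun s => s.done = false ∧ s.b - s.a > ε₄ P A ε) (bisecBody P A ε c)
    { a := Z.a, b := Z.b, xb := Z.xb, x := x, done := false }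
  ⟨r.val.xb, r.cost⟩

/-- The state of the main loop: bounds `l`, `u`, the point `xu` with `f(xu) = u`, the multiplier
interval `Z`, the current point `x`, and whether the loop has been left by the early exit. -/
structure MainState (n : ℕ) where
  l : ℝ
  u : ℝ
  xu : EuclideanSpace ℝ (Fin n)
  Z : MultInterval n
  x : EuclideanSpace ℝ (Fin n)
  halted : Bool

/-- The trial value `c = (l + u) / 2`. -/
noncomputable def MainState.c {n : ℕ} (s : MainState n) : ℝ := (s.l + s.u) / 2

/-- The loop condition `u - l > (3 / 4) ε_f`, where `ε_f = 4 ε`. -/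
def mainCond (s : MainState n) : Prop := s.halted = false ∧ s.u - s.l > 3 / 4 * (4 * ε)

open Classical in
/-- One iteration of the main loop. If the point `r` for the current `c` satisfies
`g(r) > g(x̃_g) + ε_g / 3`, then `c` becomes the lower bound and the multiplier interval becomes
`[0, max Z]`; otherwise `f(r)` becomes the upper bound and a new multiplier interval is searched
for, from `[0, 1]`, for the new value of `c`. The additional query pays for evaluating `f`, `g`
at `r`. -/
noncomputable def mainBody (s : MainState n) : Timed (MainState n) :=
  if s.c - l0 P A ε < A.Δ₁ then ⟨{ s with halted := true }, 0⟩
  else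
    let r := bisec P A ε s.c s.Z s.x
    if P.g r.val > P.g (xg P A ε) + ε then
      ⟨{ s with l := s.c, Z := { a := 0, b := s.Z.b, xb := s.Z.xb }, x := r.val }, r.cost + 1⟩
    else
      let i := intV P A ε ((s.l + P.f r.val) / 2) 1 r.val
      ⟨{ s with u := P.f r.val, xu := r.val, Z := i.val, x := i.val.xb }, r.cost + 1 + i.cost⟩

/-- The interval search before the main loop, with `c = (l₀ + u₀) / 2`. -/
noncomputable def initialSearch : Timed (MultInterval n) :=
  intV P A ε ((l0 P A ε + u0 P A ε) / 2) 1 (x0 P A ε)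

/-- The state in which the main loop is entered. -/
noncomputable def mainInit : MainState n :=
  { l := l0 P A ε
    u := u0 P A ε
    xu := xg P A ε
    Z := (initialSearch P A ε).val
    x := (initialSearch P A ε).val.xb
    halted := false }

/-- The bisection based value function algorithm for `ε_f = 4 ε`, `ε_g = 3 ε`. It returns the point
which has produced the final upper bound `u`. The two additional queries pay for evaluating `f`,
`g` at `x̃_f` and `x̃_g`. -/
noncomputable def bivfa : Timed (EuclideanSpace ℝ (Fin n)) :=
  let run := whileLoop (mainCond ε) (mainBody P A ε) (mainInit P A ε)
  ⟨run.val.xu,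
    (runF P A ε).cost + (runG P A ε).cost + 2 + (initialSearch P A ε).cost + run.cost⟩

/-- The regular condition: `f_c(x⁰) < -Δ₁` for every `c` that the main loop processes. -/
def RegularCondition : Prop :=
  ∀ k : ℕ, (∀ j ≤ k, mainCond ε ((fun s => (mainBody P A ε s).val)^[j] (mainInit P A ε))) →
    P.f (x0 P A ε) - ((fun s => (mainBody P A ε s).val)^[k] (mainInit P A ε)).c < -A.Δ₁

end Algorithm

end SimpleBilevel

/-! For a multiplier `z ≤ 2 D_z` the regularized Lagrangian `g + (ε/2)‖· - x⁰‖² + z f` (`lagr`) is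
`ε`-strongly convex with an `L_φ`-smooth part (the `+ 1` in `L_φ` absorbs `ε ≤ 1`). The accelerated
method contracts its potential linearly, so one call costs `O(√(L_φ/ε) |log ε|)` queries and yields
an `ApproxMin` (`exists_call`). Contraction holds against every comparison point, so no minimizer of
the Lagrangian has to be exhibited.

For a trial value `c` under the regularity condition, a multiplier above `D_z` forces `f ≤ c` up to
tolerance (`Regime.le_ε₂_of_large`). Doubling therefore stops after a bounded number of steps, and
bisection takes `O(|log ε|)` calls. Strong convexity makes approximate minimizers for multipliers at
distance `ε₄` close to each other (`Regime.complementarity`), so the bisection ends in a point `r`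
that nearly satisfies `f ≤ c` and for which either complementary slackness nearly holds or the
multiplier is at most `ε₄` (`Regime.bisec_spec`).

The heart is that a value `c > p^*` is never rejected (`Regime.le_pStar_of_reject`). Comparing `r`
with a lower-level solution `w` satisfying `f w ≤ c` gives `g r - g^* ≤ (ε/2)(‖w - x⁰‖² - ‖r - x⁰‖²)
+ θε + (1-θ)ε/4`. Here `θ < 1`, because two distinct lower-level solutions keep `D_g` away from
zero. An arbitrary such `w` shows `g r - g^* = O(ε)`. Compactness
(`Problem.Basic.exists_near_solution`) then supplies a `w` within a fixed small distance of `r`; the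
quadratic terms nearly cancel and the total falls below `ε`. No rate in this compactness step is
needed, since the distance is multiplied by `ε`.

Hence `l ≤ p^*` throughout, while `u` is the value of `f` at a point with `g ≤ g^* + 2ε`, and the
gap shrinks by the factor `5/6` (`Regime.mainBody_spec`). The bound is the product of `O(|log ε|)`
outer steps, `O(|log ε|)` bisection steps and the cost of a call. Uniformity of the constants in `ε`
comes from `exists_regime`. -/

namespace SimpleBilevel

/-! ### Loops -/

/-- An invariant indexed by the iteration number, which forces that number below `N` whenever the
condition holds, gives termination, the invariant at exit and the cost bound at once. All outer
loops are analysed through this rule. -/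
theorem whileLoop_spec {σ : Type} {cond : σ → Prop} {body : σ → Timed σ} {s : σ}
    (I : ℕ → σ → Prop) (N : ℕ) (c : ℕ∞) (h0 : I 0 s)
    (step : ∀ k t, I k t → cond t → k < N ∧ I (k + 1) (body t).val ∧ (body t).cost ≤ c) :
    (∃ k ≤ N, I k (whileLoop cond body s).val) ∧ ¬ cond (whileLoop cond body s).val ∧
      (whileLoop cond body s).cost ≤ N * c := by
  classical
  set F : σ → σ := fun t => (body t).val with hF
  have hI : ∀ k, (∀ j < k, cond (F^[j] s)) → I k (F^[k] s) := by
    intro k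
    induction k with
    | zero => intro _; simpa using h0
    | succ k ih =>
      intro h
      rw [Function.iterate_succ_apply']
      exact (step k _ (ih fun j hj => h j (by omega)) (h k (by omega))).2.1
  have hex : ∃ k : ℕ, ¬ cond (F^[k] s) := by
    by_contra! hcon
    exact lt_irrefl N (step N _ (hI N fun j _ => hcon j) (hcon N)).1
  have hlt : ∀ j < Nat.find hex, cond (F^[j] s) := fun j hj => by
    have := Nat.find_min hex hj
    simpa using this
  have hval : whileLoop cond body s = ⟨F^[Nat.find hex] s,
      ∑ i ∈ Finset.range (Nat.find hex), (body (F^[i] s)).cost⟩ := by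
    unfold whileLoop
    rw [dif_pos hex]
  have hle : Nat.find hex ≤ N := by
    by_contra! hcon
    exact lt_irrefl N (step N _ (hI N fun j hj => hlt j (by omega)) (hlt N hcon)).1
  rw [hval]
  refine ⟨⟨_, hle, hI _ hlt⟩, Nat.find_spec hex, ?_⟩
  calc ∑ i ∈ Finset.range (Nat.find hex), (body (F^[i] s)).cost
      ≤ ∑ i ∈ Finset.range (Nat.find hex), c := Finset.sum_le_sum fun i hi => by
        have hi' := Finset.mem_range.1 hi
        exact (step i _ (hI i fun j hj => hlt j (by omega)) (hlt i hi')).2.2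
    _ = (Nat.find hex : ℕ) * c := by simp
    _ ≤ N * c := by gcongr

/-- The body runs once before the first test, so the invariant of the inner `whileLoop` is shifted
by one and at most `N + 1` executions are paid for. -/
theorem repeatUntil_spec {σ : Type} {halt : σ → Prop} {body : σ → Timed σ} {s : σ}
    (I : ℕ → σ → Prop) (N : ℕ) (c : ℕ∞) (h0 : I 0 s)
    (step : ∀ k t, I k t → I (k + 1) (body t).val ∧ (body t).cost ≤ c)
    (halts : ∀ t, I (N + 1) t → halt t) :
    (∃ k, I (k + 1) (repeatUntil halt body s).val) ∧ halt (repeatUntil halt body s).val ∧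
      (repeatUntil halt body s).cost ≤ (N + 1) * c := by
  obtain ⟨⟨k, -, hk⟩, h1, h2⟩ := whileLoop_spec (cond := fun t => ¬ halt t) (body := body)
    (s := (body s).val) (fun k t => I (k + 1) t ∧ k ≤ N) N c ⟨(step 0 s h0).1, Nat.zero_le _⟩
    (by
      rintro k t ⟨ht, hk⟩ hc
      have hlt : k < N := by
        rcases hk.lt_or_eq with h | rfl
        · exact h
        · exact absurd (halts t ht) hc
      exact ⟨hlt, ⟨(step _ t ht).1, hlt⟩, (step _ t ht).2⟩)
  refine ⟨⟨k, hk.1⟩, not_not.1 h1, ?_⟩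
  change (body s).cost + _ ≤ _
  calc (body s).cost + (whileLoop (fun t => ¬ halt t) body (body s).val).cost
      ≤ c + N * c := add_le_add (step 0 s h0).2 h2
    _ = (N + 1) * c := by ring

/-- The trial preceding the first accepted one was rejected, hence lies below the threshold `Λ`; one
more factor `γ` gives the upper bound. -/
theorem backtrack_spec {γ L Λ : ℝ} {accept : ℝ → Prop} {J : ℕ} (hγ : 1 < γ) (hL : 0 < L)
    (hacc : ∀ L', Λ ≤ L' → 0 < L' → accept L') (hJ : Λ ≤ γ ^ J * L) :
    accept (backtrack γ L accept).val ∧ L ≤ (backtrack γ L accept).val ∧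
      (backtrack γ L accept).val ≤ max L (γ * Λ) ∧
      (backtrack γ L accept).cost ≤ 2 * (J + 1) := by
  classical
  have hpos : ∀ i : ℕ, 0 < γ ^ i * L := fun i => by positivity
  have hex : ∃ i : ℕ, accept (γ ^ i * L) := ⟨J, hacc _ hJ (hpos J)⟩
  have hb : backtrack γ L accept =
      ⟨γ ^ Nat.find hex * L, 2 * ((Nat.find hex : ℕ) + 1 : ℕ∞)⟩ := by
    unfold backtrack
    rw [dif_pos hex]
  rw [hb]
  refine ⟨Nat.find_spec hex, le_mul_of_one_le_left hL.le (one_le_pow₀ hγ.le), ?_, ?_⟩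
  · rcases Nat.eq_zero_or_pos (Nat.find hex) with h | h
    · rw [h]; simp
    · obtain ⟨i, hi⟩ : ∃ i, Nat.find hex = i + 1 := ⟨Nat.find hex - 1, by omega⟩
      have hnot : ¬ accept (γ ^ i * L) := Nat.find_min hex (by omega)
      have hlt : γ ^ i * L < Λ := by
        by_contra! hcon
        exact hnot (hacc _ hcon (hpos i))
      apply le_max_of_le_right
      rw [hi, pow_succ]
      nlinarith
  · have : Nat.find hex ≤ J := Nat.find_min' hex (hacc _ hJ (hpos J))
    have h2 : ((Nat.find hex : ℕ) : ℕ∞) ≤ (J : ℕ∞) := by exact_mod_cast this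
    change 2 * (((Nat.find hex : ℕ) : ℕ∞) + 1) ≤ _
    gcongr

/-! ### Smooth convex functions -/

section Smooth

variable {n : ℕ}

theorem hasDerivAt_line {h : EuclideanSpace ℝ (Fin n) → ℝ} (hh : Differentiable ℝ h)
    (y d : EuclideanSpace ℝ (Fin n)) (t : ℝ) :
    HasDerivAt (fun s : ℝ => h (y + s • d)) ⟪gradient h (y + t • d), d⟫ t := by
  have h1 := (hh (y + t • d)).hasGradientAt.hasFDerivAt
  have h2 : HasDerivAt (fun s : ℝ => y + s • d) d t := by
    simpa using ((hasDerivAt_id t).smul_const d).const_add y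
  have := h1.comp_hasDerivAt t h2
  simpa [Function.comp_def] using this

/-- The descent lemma. -/
theorem le_quadratic_of_lipschitz_gradient {h : EuclideanSpace ℝ (Fin n) → ℝ} {K : ℝ≥0}
    (hh : Differentiable ℝ h) (hK : LipschitzWith K (gradient h))
    (x y : EuclideanSpace ℝ (Fin n)) :
    h x ≤ h y + ⟪gradient h y, x - y⟫ + K / 2 * ‖x - y‖ ^ 2 := by
  set d := x - y with hd
  have hder : ∀ t : ℝ, HasDerivAt
      (fun s : ℝ => h (y + s • d) - s * ⟪gradient h y, d⟫ - K / 2 * ‖d‖ ^ 2 * s ^ 2)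
      (⟪gradient h (y + t • d), d⟫ - ⟪gradient h y, d⟫ - K / 2 * ‖d‖ ^ 2 * (2 * t)) t := by
    intro t
    have h1 := ((hasDerivAt_line hh y d t).sub
      ((hasDerivAt_id t).mul_const ⟪gradient h y, d⟫)).sub
      (((hasDerivAt_pow 2 t)).const_mul ((K : ℝ) / 2 * ‖d‖ ^ 2))
    exact h1.congr_deriv (by simp)
  have hanti : AntitoneOn
      (fun s : ℝ => h (y + s • d) - s * ⟪gradient h y, d⟫ - K / 2 * ‖d‖ ^ 2 * s ^ 2)
      (Set.Icc 0 1) := by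
    apply antitoneOn_of_deriv_nonpos (convex_Icc 0 1)
    · exact fun t _ => (hder t).continuousAt.continuousWithinAt
    · exact fun t _ => (hder t).differentiableAt.differentiableWithinAt
    · intro t ht
      rw [interior_Icc] at ht
      rw [(hder t).deriv, ← inner_sub_left]
      have h1 := real_inner_le_norm (gradient h (y + t • d) - gradient h y) d
      have h2 : ‖gradient h (y + t • d) - gradient h y‖ ≤ K * (t * ‖d‖) := by
        have := hK.dist_le_mul (y + t • d) y
        rw [dist_eq_norm, dist_eq_norm, add_sub_cancel_left, norm_smul, Real.norm_eq_abs,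
          abs_of_pos ht.1] at this
        exact this
      have h3 := mul_le_mul_of_nonneg_right h2 (norm_nonneg d)
      nlinarith
  have := hanti (Set.left_mem_Icc.2 zero_le_one) (Set.right_mem_Icc.2 zero_le_one) zero_le_one
  simp only [one_smul, zero_smul, add_zero, zero_mul, one_mul, one_pow, mul_one, hd,
    add_sub_cancel] at this
  simp only [hd]
  simp only [ne_eq, OfNat.ofNat_ne_zero, not_false_eq_true, zero_pow, mul_zero, sub_zero] at this
  linarith

theorem gradient_le_sub_of_convex {h : EuclideanSpace ℝ (Fin n) → ℝ}
    (hh : Differentiable ℝ h) (hc : ConvexOn ℝ Set.univ h)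
    (x y : EuclideanSpace ℝ (Fin n)) :
    h y + ⟪gradient h y, x - y⟫ ≤ h x := by
  have hder := hasDerivAt_line hh y (x - y) 0
  simp only [zero_smul, add_zero] at hder
  have hconv : ConvexOn ℝ Set.univ (fun s : ℝ => h (y + s • (x - y))) := by
    have := hc.comp_affineMap (AffineMap.lineMap y x : ℝ →ᵃ[ℝ] EuclideanSpace ℝ (Fin n))
    simpa [Function.comp_def, AffineMap.lineMap_apply, add_comm] using this
  have := hconv.le_slope_of_hasDerivAt (Set.mem_univ 0) (Set.mem_univ 1) zero_lt_one hder
  simp only [slope_def_field, one_smul, zero_smul, add_zero, sub_zero, div_one,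
    add_sub_cancel] at this
  linarith

end Smooth

/-! ### Composite models -/

section Model

variable {n : ℕ}

/-- A composite objective on `X` with `μ`-strongly convex, `L`-smooth part `φ₁` and convex,
proximable part `φ₂`. -/
structure CompositeModel (X : Set (EuclideanSpace ℝ (Fin n)))
    (φ₁ φ₂ : EuclideanSpace ℝ (Fin n) → ℝ) (μ L : ℝ) : Prop where
  convex : ConvexOn ℝ X φ₂
  exists_prox : ∀ t : ℝ, 0 < t → ∀ y, ∃ x, IsProx X φ₂ t y x
  lower : ∀ x y, φ₁ y + ⟪gradient φ₁ y, x - y⟫ + μ / 2 * ‖x - y‖ ^ 2 ≤ φ₁ x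
  upper : ∀ x y, φ₁ x ≤ φ₁ y + ⟪gradient φ₁ y, x - y⟫ + L / 2 * ‖x - y‖ ^ 2
  lipschitz : ∀ x y, ‖gradient φ₁ x - gradient φ₁ y‖ ≤ L * ‖x - y‖

theorem nonpos_of_le_mul_sq {a b : ℝ} (h : ∀ s : ℝ, 0 < s → s ≤ 1 → s * a ≤ s ^ 2 * b) :
    a ≤ 0 := by
  by_contra! ha
  have hb : 0 < b := by
    have := h 1 one_pos le_rfl
    linarith
  -- With `s ≤ a / (2b)` the right side is at most half the left one, a contradiction; the minimum
  -- with `1` keeps `s` admissible.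
  have h1 := h (min 1 (a / (2 * b))) (by positivity) (min_le_left _ _)
  set s := min 1 (a / (2 * b)) with hs
  have hs0 : 0 < s := by positivity
  have hs1 : s ≤ a / (2 * b) := min_le_right _ _
  have h2 : a ≤ s * b := by nlinarith
  have h3 : s * b ≤ a / (2 * b) * b := by gcongr
  have h4 : a / (2 * b) * b = a / 2 := by field_simp
  linarith

/-- First-order optimality of the proximal point: compare it with the points `(1-s)x + sw` of the
segment and let `s` tend to zero, which is the role of `nonpos_of_le_mul_sq`. -/
theorem IsProx.add_inner_le {X : Set (EuclideanSpace ℝ (Fin n))}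
    {ψ : EuclideanSpace ℝ (Fin n) → ℝ} (hψ : ConvexOn ℝ X ψ) {L : ℝ} (hL : 0 < L)
    {y x w : EuclideanSpace ℝ (Fin n)} (hx : IsProx X ψ (1 / L) y x) (hw : w ∈ X) :
    ψ x + L * ⟪y - x, w - x⟫ ≤ ψ w := by
  have key : ψ x + L * ⟪y - x, w - x⟫ - ψ w ≤ 0 := by
    apply nonpos_of_le_mul_sq (b := L / 2 * ‖w - x‖ ^ 2)
    intro s hs hs1
    have hmem : (1 - s) • x + s • w ∈ X := hψ.1 hx.1 hw (by linarith) hs.le (by ring)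
    have h1 := hx.2 _ hmem
    have h2 := hψ.2 hx.1 hw (by linarith : 0 ≤ 1 - s) hs.le (by ring)
    have h3 : (1 - s) • x + s • w - y = (x - y) + s • (w - x) := by module
    have h4 : 1 / (2 * (1 / L)) = L / 2 := by field_simp
    have h5 : ⟪y - x, w - x⟫ = -⟪x - y, w - x⟫ := by
      rw [← inner_neg_left, neg_sub]
    rw [h3, norm_add_sq_real, inner_smul_right, norm_smul, Real.norm_eq_abs, abs_of_pos hs,
      h4] at h1
    simp only [smul_eq_mul] at h2
    rw [h5]
    nlinarith
  linarith

variable {X : Set (EuclideanSpace ℝ (Fin n))} {φ₁ φ₂ : EuclideanSpace ℝ (Fin n) → ℝ} {μ L : ℝ}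

namespace CompositeModel

theorem descent (h : CompositeModel X φ₁ φ₂ μ L) {L' : ℝ} (hL : L ≤ L')
    (y x : EuclideanSpace ℝ (Fin n)) : Descent φ₁ L' y x := by
  have := h.upper x y
  unfold Descent
  nlinarith [sq_nonneg ‖x - y‖]

theorem isProx_proxGrad (h : CompositeModel X φ₁ φ₂ μ L) {l : ℝ} (hl : 0 < l)
    (y : EuclideanSpace ℝ (Fin n)) :
    IsProx X φ₂ (1 / l) (y - (1 / l) • gradient φ₁ y) (proxGrad X φ₁ φ₂ l y) :=
  Classical.epsilon_spec (h.exists_prox _ (by positivity) _)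

theorem proxGrad_mem (h : CompositeModel X φ₁ φ₂ μ L) {l : ℝ} (hl : 0 < l)
    (y : EuclideanSpace ℝ (Fin n)) : proxGrad X φ₁ φ₂ l y ∈ X :=
  (h.isProx_proxGrad hl y).1

theorem proxGrad_add_inner_le (h : CompositeModel X φ₁ φ₂ μ L) {l : ℝ} (hl : 0 < l)
    (y : EuclideanSpace ℝ (Fin n)) {w : EuclideanSpace ℝ (Fin n)} (hw : w ∈ X) :
    φ₂ (proxGrad X φ₁ φ₂ l y) +
      ⟪l • (y - proxGrad X φ₁ φ₂ l y) - gradient φ₁ y, w - proxGrad X φ₁ φ₂ l y⟫ ≤ φ₂ w := by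
  have h1 := (h.isProx_proxGrad hl y).add_inner_le h.convex hl hw
  set x := proxGrad X φ₁ φ₂ l y
  have h2 : l • (y - x) - gradient φ₁ y = l • (y - (1 / l) • gradient φ₁ y - x) := by
    rw [smul_sub, smul_sub, smul_sub, smul_smul, mul_one_div_cancel hl.ne', one_smul]
    abel
  rw [h2, inner_smul_left]
  simpa using h1

/-- The fundamental inequality of an accepted proximal gradient step. -/
theorem step (h : CompositeModel X φ₁ φ₂ μ L) {l : ℝ} (hl : 0 < l)
    {y w : EuclideanSpace ℝ (Fin n)} (hw : w ∈ X)
    (hd : Descent φ₁ l y (proxGrad X φ₁ φ₂ l y)) :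
    φ₁ (proxGrad X φ₁ φ₂ l y) + φ₂ (proxGrad X φ₁ φ₂ l y)
      + l / 2 * ‖w - proxGrad X φ₁ φ₂ l y‖ ^ 2 ≤ φ₁ w + φ₂ w + (l - μ) / 2 * ‖w - y‖ ^ 2 := by
  have h1 := h.proxGrad_add_inner_le hl y hw
  have h2 := h.lower w y
  unfold Descent at hd
  set x := proxGrad X φ₁ φ₂ l y
  have e1 : w - y = (w - x) + (x - y) := by abel
  have e2 : ‖w - y‖ ^ 2 = ‖w - x‖ ^ 2 + 2 * ⟪x - y, w - x⟫ + ‖x - y‖ ^ 2 := by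
    rw [e1, norm_add_sq_real, real_inner_comm]
  have e3 : ⟪gradient φ₁ y, w - y⟫ = ⟪gradient φ₁ y, w - x⟫ + ⟪gradient φ₁ y, x - y⟫ := by
    rw [e1, inner_add_right]
  have e4 : ⟪l • (y - x) - gradient φ₁ y, w - x⟫ =
      - l * ⟪x - y, w - x⟫ - ⟪gradient φ₁ y, w - x⟫ := by
    rw [inner_sub_left, inner_smul_left, ← neg_sub x y, inner_neg_left]
    simp
  have e5 : l / 2 * ‖w - y‖ ^ 2 =
      l / 2 * ‖w - x‖ ^ 2 + l * ⟪x - y, w - x⟫ + l / 2 * ‖x - y‖ ^ 2 := by rw [e2]; ring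
  rw [e4] at h1
  rw [e3] at h2
  linarith

/-- A step from a point bounds the distance of zero to the subdifferential at the new point. -/
theorem infEDist_subdiff_le (h : CompositeModel X φ₁ φ₂ μ L) (hμ : 0 ≤ μ) {l : ℝ} (hl : 0 < l)
    (y : EuclideanSpace ℝ (Fin n)) :
    Metric.infEDist 0 (subdiff X (fun x => φ₁ x + φ₂ x) (proxGrad X φ₁ φ₂ l y)) ≤
      ENNReal.ofReal ((L + l) * ‖proxGrad X φ₁ φ₂ l y - y‖) := by
  set x := proxGrad X φ₁ φ₂ l y with hx
  -- The optimality condition of the proximal step gives a subgradient of `φ₂` at `x`; adding the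
  -- gradient of `φ₁` at `x` gives an explicit subgradient of the sum.
  have hmem : gradient φ₁ x - gradient φ₁ y + l • (y - x) ∈
      subdiff X (fun x => φ₁ x + φ₂ x) x := by
    refine ⟨h.proxGrad_mem hl y, fun w hw => ?_⟩
    have h1 := h.proxGrad_add_inner_le hl y hw
    have h2 := h.lower w x
    rw [← hx] at h1
    have e : gradient φ₁ x - gradient φ₁ y + l • (y - x) =
      gradient φ₁ x + (l • (y - x) - gradient φ₁ y) := by abel
    rw [e, inner_add_left]
    have : 0 ≤ μ / 2 * ‖w - x‖ ^ 2 := by positivity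
    linarith
  refine (Metric.infEDist_le_edist_of_mem hmem).trans ?_
  rw [edist_dist, dist_zero_left]
  apply ENNReal.ofReal_le_ofReal
  calc ‖gradient φ₁ x - gradient φ₁ y + l • (y - x)‖
      ≤ ‖gradient φ₁ x - gradient φ₁ y‖ + ‖l • (y - x)‖ := norm_add_le _ _
    _ ≤ L * ‖x - y‖ + l * ‖x - y‖ := by
        gcongr
        · exact h.lipschitz x y
        · rw [norm_smul, Real.norm_eq_abs, abs_of_pos hl, norm_sub_rev]
    _ = _ := by ring

/-- Near stationarity gives approximate minimality. -/
theorem le_of_nearStationary (h : CompositeModel X φ₁ φ₂ μ L)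
    {x w : EuclideanSpace ℝ (Fin n)} {ε : ℝ} (hε : 0 ≤ ε)
    (hs : NearStationary X (fun x => φ₁ x + φ₂ x) ε x) (hw : w ∈ X) :
    φ₁ x + φ₂ x + μ / 2 * ‖w - x‖ ^ 2 ≤ φ₁ w + φ₂ w + ε * ‖w - x‖ := by
  have key : ∀ v ∈ subdiff X (fun x => φ₁ x + φ₂ x) x,
      φ₁ x + φ₂ x + μ / 2 * ‖w - x‖ ^ 2 ≤ φ₁ w + φ₂ w + ‖v‖ * ‖w - x‖ := by
    rintro v ⟨hx, hv⟩
    have h0 : φ₁ x + φ₂ x + μ / 2 * ‖w - x‖ ^ 2 - (φ₁ w + φ₂ w + ‖v‖ * ‖w - x‖) ≤ 0 := by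
      -- The subgradient inequality is tested at a point `p` of the segment, and the convex
      -- combination of the lower models of `φ₁` at `p` recovers the quadratic term as `s` tends to
      -- zero.
      apply nonpos_of_le_mul_sq (b := μ / 2 * ‖w - x‖ ^ 2)
      intro s hs hs1
      have hmem : (1 - s) • x + s • w ∈ X := h.convex.1 hx hw (by linarith) hs.le (by ring)
      have h1 := hv _ hmem
      have h2 := h.convex.2 hx hw (by linarith : 0 ≤ 1 - s) hs.le (by ring)
      set p := (1 - s) • x + s • w with hp
      have hpx : p - x = s • (w - x) := by rw [hp]; module
      have hxp : x - p = -(s • (w - x)) := by rw [hp]; module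
      have hwp : w - p = (1 - s) • (w - x) := by rw [hp]; module
      have h3 := h.lower x p
      have h4 := h.lower w p
      have h5 : -⟪v, w - x⟫ ≤ ‖v‖ * ‖w - x‖ := by
        have := abs_real_inner_le_norm v (w - x)
        exact (neg_le_abs _).trans this
      rw [hpx, inner_smul_right] at h1
      rw [hxp, inner_neg_right, inner_smul_right, norm_neg, norm_smul, Real.norm_eq_abs,
        abs_of_pos hs] at h3
      rw [hwp, inner_smul_right, norm_smul, Real.norm_eq_abs,
        abs_of_nonneg (by linarith : 0 ≤ 1 - s)] at h4
      simp only [smul_eq_mul] at h2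
      have h3' := mul_le_mul_of_nonneg_left h3 (by linarith : 0 ≤ 1 - s)
      have h4' := mul_le_mul_of_nonneg_left h4 hs.le
      have h5' := mul_le_mul_of_nonneg_left h5 hs.le
      nlinarith
    linarith
  -- The distance to the subdifferential is handled as an infimum that need not be attained, so a
  -- subgradient of norm slightly above `ε` is used and the excess `δ` removed afterwards.
  apply le_of_forall_pos_le_add
  intro δ hδ
  have hlt : Metric.infEDist 0 (subdiff X (fun x => φ₁ x + φ₂ x) x) <
      ENNReal.ofReal (ε + δ / (1 + ‖w - x‖)) := by
    refine hs.trans_lt (ENNReal.ofReal_lt_ofReal_iff_of_nonneg hε |>.2 ?_)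
    have : 0 < δ / (1 + ‖w - x‖) := by positivity
    linarith
  obtain ⟨v, hv, hvd⟩ := Metric.infEDist_lt_iff.1 hlt
  rw [edist_dist, dist_zero_left] at hvd
  have hv' : ‖v‖ ≤ ε + δ / (1 + ‖w - x‖) :=
    ((ENNReal.ofReal_lt_ofReal_iff (by positivity)).1 hvd).le
  have h1 := key v hv
  have h2 : ‖v‖ * ‖w - x‖ ≤ (ε + δ / (1 + ‖w - x‖)) * ‖w - x‖ := by gcongr
  have h3 : δ / (1 + ‖w - x‖) * ‖w - x‖ ≤ δ := by
    rw [div_mul_eq_mul_div, div_le_iff₀ (by positivity)]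
    nlinarith [norm_nonneg (w - x)]
  linarith

theorem mem_of_nearStationary {φ : EuclideanSpace ℝ (Fin n) → ℝ}
    {x : EuclideanSpace ℝ (Fin n)} {ε : ℝ} (hs : NearStationary X φ ε x) : x ∈ X := by
  have : Metric.infEDist 0 (subdiff X φ x) < ⊤ := hs.trans_lt ENNReal.ofReal_lt_top
  obtain ⟨v, hv, -⟩ := Metric.infEDist_lt_iff.1 this
  exact hv.1

end CompositeModel

end Model

/-! ### Convergence of FISTA -/

section Fista

variable {n : ℕ} {X : Set (EuclideanSpace ℝ (Fin n))} {φ₁ φ₂ : EuclideanSpace ℝ (Fin n) → ℝ}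
  {L : ℝ}

theorem norm_sq_affine_identity (p x w : EuclideanSpace ℝ (Fin n)) (t : ℝ) :
    t * ((t - 1) * ‖x - p‖ ^ 2 + ‖w - p‖ ^ 2) =
      ‖t • p - (t - 1) • x - w‖ ^ 2 + (t - 1) * ‖x - w‖ ^ 2 := by
  have e1 : t • p - (t - 1) • x - w = -((t - 1) • (x - p) + (w - p)) := by module
  have e2 : x - w = (x - p) - (w - p) := by abel
  rw [e1, e2, norm_neg]
  generalize x - p = a
  generalize w - p = b
  rw [norm_add_sq_real, norm_sub_sq_real, norm_smul, inner_smul_left, mul_pow,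
    Real.norm_eq_abs, sq_abs]
  simp only [conj_trivial]
  ring

/-- One accelerated step decreases the FISTA potential. -/
theorem CompositeModel.fista_step (h : CompositeModel X φ₁ φ₂ 0 L) {l t : ℝ} (hl : 0 < l)
    (ht : 1 ≤ t) {x y w : EuclideanSpace ℝ (Fin n)} (hx : t = 1 ∨ x ∈ X) (hw : w ∈ X)
    (hd : Descent φ₁ l y (proxGrad X φ₁ φ₂ l y)) :
    2 / l * t ^ 2 * (φ₁ (proxGrad X φ₁ φ₂ l y) + φ₂ (proxGrad X φ₁ φ₂ l y) - (φ₁ w + φ₂ w))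
      + ‖t • proxGrad X φ₁ φ₂ l y - (t - 1) • x - w‖ ^ 2 ≤
    2 / l * (t ^ 2 - t) * (φ₁ x + φ₂ x - (φ₁ w + φ₂ w)) + ‖t • y - (t - 1) • x - w‖ ^ 2 := by
  have hb := h.step hl hw hd
  set p := proxGrad X φ₁ φ₂ l y
  -- In the first iteration `t = 1` and the weight `t - 1` vanishes, so the initial point need not
  -- belong to `X`.
  have ha : (t - 1) * (φ₁ p + φ₂ p + l / 2 * ‖x - p‖ ^ 2) ≤
      (t - 1) * (φ₁ x + φ₂ x + (l - 0) / 2 * ‖x - y‖ ^ 2) := by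
    rcases hx with rfl | hx
    · simp
    · exact mul_le_mul_of_nonneg_left (h.step hl hx hd) (by linarith)
  have i1 := norm_sq_affine_identity p x w t
  have i2 := norm_sq_affine_identity y x w t
  have hsum := mul_le_mul_of_nonneg_left (add_le_add ha hb) (by positivity : 0 ≤ 2 / l * t)
  have hl' : 2 / l * (l / 2) = 1 := by field_simp
  have r1 : 2 / l * t * ((t - 1) * (φ₁ p + φ₂ p + l / 2 * ‖x - p‖ ^ 2) +
      (φ₁ p + φ₂ p + l / 2 * ‖w - p‖ ^ 2)) = 2 / l * t ^ 2 * (φ₁ p + φ₂ p)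
      + 2 / l * (l / 2) * (t * ((t - 1) * ‖x - p‖ ^ 2 + ‖w - p‖ ^ 2)) := by ring
  have r2 : 2 / l * t * ((t - 1) * (φ₁ x + φ₂ x + (l - 0) / 2 * ‖x - y‖ ^ 2) +
      (φ₁ w + φ₂ w + (l - 0) / 2 * ‖w - y‖ ^ 2)) = 2 / l * (t ^ 2 - t) * (φ₁ x + φ₂ x)
      + 2 / l * t * (φ₁ w + φ₂ w)
      + 2 / l * (l / 2) * (t * ((t - 1) * ‖x - y‖ ^ 2 + ‖w - y‖ ^ 2)) := by ring
  rw [r1, r2, hl', i1, i2] at hsum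
  linarith

-- The FISTA potential relative to a minimizer `w` stays below `R²`, which gives the `O(1/k²)` rate.
-- The extra conclusion that the output stays within `R` of `w` is what later bounds `f` at `x̃_g`
-- uniformly in `ε`.
set_option maxHeartbeats 800000 in
theorem CompositeModel.fista_spec (h : CompositeModel X φ₁ φ₂ 0 L) {L₀ η R ε : ℝ}
    {x₀ w : EuclideanSpace ℝ (Fin n)} {J N : ℕ} (hη : 1 < η) (hL₀ : 0 < L₀) (hL₀L : L₀ ≤ η * L)
    (hw : w ∈ X) (hmin : ∀ y ∈ X, φ₁ w + φ₂ w ≤ φ₁ y + φ₂ y) (hR : ‖x₀ - w‖ ≤ R)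
    (hJ : L ≤ η ^ J * L₀) (hN : 2 * η * L / ((N : ℝ) + 1 + 1) ^ 2 * R ^ 2 ≤ ε) :
    (fista X φ₁ φ₂ L₀ η x₀ L R ε).val ∈ X ∧
      φ₁ (fista X φ₁ φ₂ L₀ η x₀ L R ε).val + φ₂ (fista X φ₁ φ₂ L₀ η x₀ L R ε).val
        ≤ φ₁ w + φ₂ w + ε ∧
      ‖(fista X φ₁ φ₂ L₀ η x₀ L R ε).val - w‖ ≤ R ∧
      (fista X φ₁ φ₂ L₀ η x₀ L R ε).cost ≤ (N + 1) * (2 * (J + 1)) := by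
  have hR0 : 0 ≤ R := (norm_nonneg _).trans hR
  set F : EuclideanSpace ℝ (Fin n) → ℝ := fun x => φ₁ x + φ₂ x with hF
  -- The state after `k` iterations stores `t_{k+1}`, and `t_{k+1}² - t_{k+1} = t_k²`; this explains
  -- both the quadratic lower bound and the coefficient of the potential. They are stated for `1 ≤
  -- k` since `t² - t = 0` at the start.
  let I : ℕ → FistaState n → Prop := fun k s =>
    s.k = k ∧ (s.t = 1 ∨ s.x ∈ X) ∧ (1 ≤ k → s.x ∈ X) ∧ ‖s.x - w‖ ≤ R ∧
    ((k : ℝ) + 2) / 2 ≤ s.t ∧ (1 ≤ k → ((k : ℝ) + 1) ^ 2 / 4 ≤ s.t ^ 2 - s.t) ∧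
    L₀ ≤ s.L ∧ s.L ≤ η * L ∧
    2 / s.L * (s.t ^ 2 - s.t) * (F s.x - F w) + ‖s.t • s.y - (s.t - 1) • s.x - w‖ ^ 2 ≤ R ^ 2
  have hcore := repeatUntil_spec
    (halt := fun s : FistaState n => 2 * η * L / ((s.k : ℝ) + 1) ^ 2 * R ^ 2 ≤ ε)
    (body := fistaBody X φ₁ φ₂ η) (s := { k := 0, x := x₀, y := x₀, t := 1, L := L₀ })
    I N (2 * (J + 1)) ?_ ?_ ?_
  · obtain ⟨⟨k, hk⟩, hhalt, hcost⟩ := hcore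
    set s := (repeatUntil (fun s : FistaState n => 2 * η * L / ((s.k : ℝ) + 1) ^ 2 * R ^ 2 ≤ ε)
      (fistaBody X φ₁ φ₂ η) { k := 0, x := x₀, y := x₀, t := 1, L := L₀ }).val with hs
    have hval : (fista X φ₁ φ₂ L₀ η x₀ L R ε).val = s.x := rfl
    obtain ⟨h1, -, h2, h3, h4, h5, h6, h7, h8⟩ := hk
    rw [hval]
    refine ⟨h2 (by omega), ?_, h3, hcost⟩
    have h5' := h5 (by omega)
    have hL : 0 < s.L := hL₀.trans_le h6
    have hq : 0 < ((k + 1 : ℕ) + 1 : ℝ) ^ 2 / 4 := by positivity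
    have hT : 0 < s.t ^ 2 - s.t := hq.trans_le h5'
    have h9 : 2 / s.L * (s.t ^ 2 - s.t) * (F s.x - F w) ≤ R ^ 2 := by
      have := sq_nonneg ‖s.t • s.y - (s.t - 1) • s.x - w‖
      linarith
    have h10 : (F s.x - F w) ≤ R ^ 2 * s.L / (2 * (s.t ^ 2 - s.t)) := by
      rw [le_div_iff₀ (by positivity)]
      have : 2 / s.L * (s.t ^ 2 - s.t) * (F s.x - F w) * s.L =
        (F s.x - F w) * (2 * (s.t ^ 2 - s.t)) := by field_simp
      rw [← this]
      gcongr
    have h11 : R ^ 2 * s.L / (2 * (s.t ^ 2 - s.t)) ≤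
        R ^ 2 * (η * L) / (2 * (((k + 1 : ℕ) + 1 : ℝ) ^ 2 / 4)) := by
      have : 0 ≤ η * L := hL.le.trans h7
      gcongr
    have h12 : R ^ 2 * (η * L) / (2 * (((k + 1 : ℕ) + 1 : ℝ) ^ 2 / 4)) =
        2 * η * L / ((s.k : ℝ) + 1) ^ 2 * R ^ 2 := by
      rw [h1]; field_simp; ring
    have := h10.trans (h11.trans (h12.le.trans hhalt))
    simp only [hF] at this
    linarith
  · refine ⟨rfl, Or.inl rfl, fun h => absurd h (by norm_num), hR, by norm_num,
      fun h => absurd h (by norm_num), le_rfl, hL₀L, ?_⟩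
    simpa using pow_le_pow_left₀ (norm_nonneg _) hR 2
  · rintro k s ⟨h1, h2, h2', h3, h4, h5, h6, h7, h8⟩
    have hLs : 0 < s.L := hL₀.trans_le h6
    have hJs : L ≤ η ^ J * s.L := hJ.trans (by gcongr)
    obtain ⟨b1, b2, b3, b4⟩ := backtrack_spec (γ := η) (L := s.L) (Λ := L) (J := J)
      (accept := fun L => Descent φ₁ L s.y (proxGrad X φ₁ φ₂ L s.y)) hη hLs
      (fun L' hL' _ => h.descent hL' _ _) hJs
    set l := (backtrack η s.L fun L => Descent φ₁ L s.y (proxGrad X φ₁ φ₂ L s.y)).val with hl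
    have hl0 : 0 < l := hLs.trans_le b2
    set p := proxGrad X φ₁ φ₂ l s.y with hp
    set tn := (1 + √(1 + 4 * s.t ^ 2)) / 2 with htn
    have ht1 : 1 ≤ s.t := by
      have : (0 : ℝ) ≤ k := Nat.cast_nonneg k
      linarith
    have hsq : √(1 + 4 * s.t ^ 2) ^ 2 = 1 + 4 * s.t ^ 2 := Real.sq_sqrt (by positivity)
    have hsq2 : 2 * s.t ≤ √(1 + 4 * s.t ^ 2) := Real.le_sqrt_of_sq_le (by nlinarith)
    have htn2 : tn ^ 2 - tn = s.t ^ 2 := by rw [htn]; nlinarith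
    have htn1 : s.t + 1 / 2 ≤ tn := by rw [htn]; linarith
    have hpX : p ∈ X := h.proxGrad_mem hl0 _
    have hst := h.fista_step hl0 ht1 h2 hw b1
    rw [← hp] at hst
    -- The line search never decreases the constant, so `2 / l ≤ 2 / s.L`; since the objective gap
    -- is nonnegative the potential can only drop.
    have hu : 2 / l * s.t ^ 2 * (F p - F w) + ‖s.t • p - (s.t - 1) • s.x - w‖ ^ 2 ≤ R ^ 2 := by
      refine hst.trans (le_trans ?_ h8)
      gcongr ?_ + _
      rcases h2 with h2 | h2
      · rw [h2]; simp
      · have hv : 0 ≤ F s.x - F w := sub_nonneg.2 (hmin _ h2)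
        have ht2 : 0 ≤ s.t ^ 2 - s.t := by nlinarith
        change 2 / l * (s.t ^ 2 - s.t) * (F s.x - F w) ≤ _
        gcongr
    have hbody : (fistaBody X φ₁ φ₂ η s).val =
        { k := s.k + 1, x := p, y := p + ((s.t - 1) / tn) • (p - s.x), t := tn, L := l } := rfl
    have hFp : 0 ≤ F p - F w := sub_nonneg.2 (hmin _ hpX)
    have hun : ‖s.t • p - (s.t - 1) • s.x - w‖ ≤ R := by
      apply le_of_sq_le_sq _ hR0
      have : 0 ≤ 2 / l * s.t ^ 2 * (F p - F w) := by positivity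
      linarith
    refine ⟨?_, b4⟩
    rw [hbody]
    refine ⟨by simp [h1], Or.inr hpX, fun _ => hpX, ?_, ?_, ?_, h6.trans b2, ?_, ?_⟩
    -- The new point minus `w` is a convex combination of the potential vector scaled to norm at
    -- most `R` and of the previous difference, so the ball of radius `R` around `w` is not left.
    · have e : s.t • (p - w) = (s.t • p - (s.t - 1) • s.x - w) + (s.t - 1) • (s.x - w) := by
        module
      have h10 : s.t * ‖p - w‖ ≤ R + (s.t - 1) * R := by
        calc s.t * ‖p - w‖ = ‖s.t • (p - w)‖ := by
              rw [norm_smul, Real.norm_eq_abs, abs_of_pos (by linarith)]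
          _ ≤ ‖s.t • p - (s.t - 1) • s.x - w‖ + ‖(s.t - 1) • (s.x - w)‖ := by
              rw [e]; exact norm_add_le _ _
          _ ≤ R + (s.t - 1) * R := by
              rw [norm_smul, Real.norm_eq_abs, abs_of_nonneg (by linarith : 0 ≤ s.t - 1)]
              have : 0 ≤ s.t - 1 := by linarith
              gcongr
      exact le_of_mul_le_mul_left (by linarith : s.t * ‖p - w‖ ≤ s.t * R) (by linarith)
    · push_cast; linarith
    · intro _
      change ((k + 1 : ℕ) + 1 : ℝ) ^ 2 / 4 ≤ tn ^ 2 - tn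
      rw [htn2]
      have := pow_le_pow_left₀ (by positivity) h4 2
      push_cast
      linarith
    · exact b3.trans (max_le h7 le_rfl)
    · change 2 / l * (tn ^ 2 - tn) * (F p - F w) +
        ‖tn • (p + ((s.t - 1) / tn) • (p - s.x)) - (tn - 1) • p - w‖ ^ 2 ≤ R ^ 2
      have htn0 : tn ≠ 0 := by linarith
      have e : tn • (p + ((s.t - 1) / tn) • (p - s.x)) - (tn - 1) • p - w =
          s.t • p - (s.t - 1) • s.x - w := by
        rw [smul_add, smul_smul, mul_div_cancel₀ _ htn0]
        module
      rw [e, htn2]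
      exact hu
  · rintro s ⟨h1, -⟩
    rw [h1]
    push_cast
    exact hN

end Fista

/-! ### Convergence of the strongly convex accelerated method -/

section Apg

variable {n : ℕ} {X : Set (EuclideanSpace ℝ (Fin n))} {φ₁ φ₂ : EuclideanSpace ℝ (Fin n) → ℝ}
  {μ L : ℝ}

theorem norm_sq_convex_comb (a b : EuclideanSpace ℝ (Fin n)) (α : ℝ) :
    ‖(1 - α) • a + α • b‖ ^ 2 =
      (1 - α) * ‖a‖ ^ 2 + α * ‖b‖ ^ 2 - α * (1 - α) * ‖a - b‖ ^ 2 := by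
  rw [norm_add_sq_real, norm_sub_sq_real, norm_smul, norm_smul, inner_smul_left, inner_smul_right,
    mul_pow, mul_pow, Real.norm_eq_abs, Real.norm_eq_abs, sq_abs, sq_abs]
  simp only [conj_trivial]
  ring

/-- One accelerated step contracts the potential with respect to every comparison point. -/
theorem CompositeModel.apg_step (h : CompositeModel X φ₁ φ₂ μ L) {l α : ℝ} (hl : 0 < l)
    (hα : 0 < α) (hα1 : α ≤ 1) (hμ : l * α ^ 2 = μ) {x y v w : EuclideanSpace ℝ (Fin n)}
    (hx : x ∈ X) (hw : w ∈ X) (hy : (1 + α) • y = x + α • v)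
    (hd : Descent φ₁ l y (proxGrad X φ₁ φ₂ l y)) :
    φ₁ (proxGrad X φ₁ φ₂ l y) + φ₂ (proxGrad X φ₁ φ₂ l y) - (φ₁ w + φ₂ w)
      + μ / 2 * ‖x + (1 / α) • (proxGrad X φ₁ φ₂ l y - x) - w‖ ^ 2 ≤
    (1 - α) * (φ₁ x + φ₂ x - (φ₁ w + φ₂ w) + μ / 2 * ‖v - w‖ ^ 2) := by
  have ha := mul_le_mul_of_nonneg_left (h.step hl hx hd) (by linarith : 0 ≤ 1 - α)
  have hb := mul_le_mul_of_nonneg_left (h.step hl hw hd) hα.le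
  set p := proxGrad X φ₁ φ₂ l y
  have i1 := norm_sq_convex_comb (x - p) (w - p) α
  have i2 := norm_sq_convex_comb (x - y) (w - y) α
  have i3 := norm_sq_convex_comb (v - w) (y - w) α
  rw [sub_sub_sub_cancel_right] at i1 i2 i3
  have e1 : x + (1 / α) • (p - x) - w = (-(1 / α)) • ((1 - α) • (x - p) + α • (w - p)) := by
    match_scalars <;> field_simp <;> ring
  -- The coupling `hy` of `x`, `y` and `v` is designed for this identity: together with `l α² = μ`
  -- it turns the terms at `y` into the potential at `v`.
  have e2 : (1 - α) • (x - y) + α • (w - y) = (-α) • ((1 - α) • (v - w) + α • (y - w)) := by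
    have hxe : x = (1 + α) • y - α • v := by rw [hy]; abel
    rw [hxe]
    module
  have n1 : μ / 2 * ‖x + (1 / α) • (p - x) - w‖ ^ 2 =
      l / 2 * ‖(1 - α) • (x - p) + α • (w - p)‖ ^ 2 := by
    rw [e1, norm_smul, mul_pow, Real.norm_eq_abs, sq_abs, ← hμ]
    field_simp
  have n2 : l / 2 * ‖(1 - α) • (x - y) + α • (w - y)‖ ^ 2 =
      μ / 2 * ‖(1 - α) • (v - w) + α • (y - w)‖ ^ 2 := by
    rw [e2, norm_smul, mul_pow, Real.norm_eq_abs, sq_abs, ← hμ]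
    ring
  rw [i1] at n1
  rw [i2, i3] at n2
  have hμ0 : 0 ≤ μ := by rw [← hμ]; positivity
  -- The terms in `‖y - w‖²` cancel against the strong convexity gain; what remains are these two
  -- squares, discarded with a favourable sign.
  have k1 : 0 ≤ μ / 2 * (α * (1 - α) * ‖v - y‖ ^ 2) := by
    have : 0 ≤ 1 - α := by linarith
    positivity
  have k2 : 0 ≤ μ / 2 * ((1 - α) * ‖x - y‖ ^ 2) := by
    have : 0 ≤ 1 - α := by linarith
    positivity
  have k3 : ‖w - y‖ ^ 2 = ‖y - w‖ ^ 2 := by rw [norm_sub_rev]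
  rw [n1]
  rw [k3] at n2 hb
  linarith

/-- The auxiliary point of the accelerated method. -/
noncomputable def ApgState.aux (s : ApgState n) : EuclideanSpace ℝ (Fin n) :=
  s.xprev + (1 / s.α) • (s.x - s.xprev)

/-- This rewrites the momentum form of the algorithm in the three-sequence form that
`CompositeModel.apg_step` requires. -/
theorem apgExtrapolate_eq (s : ApgState n) (hα : 0 < s.α) (l : ℝ) :
    (1 + √(μ / l)) • apgExtrapolate μ s l = s.x + √(μ / l) • s.aux := by
  have h1 : 0 ≤ √(μ / l) := Real.sqrt_nonneg _
  unfold apgExtrapolate ApgState.aux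
  match_scalars <;> field_simp <;> ring

theorem sqrt_div_le_one {l : ℝ} (h1 : μ ≤ l) (hl : 0 < l) : √(μ / l) ≤ 1 := by
  rw [Real.sqrt_le_iff]
  exact ⟨zero_le_one, by simpa using (div_le_one hl).2 h1⟩

-- Small objective decrease in the final proximal step means a short step, and a short step means a
-- small subgradient at `x̂`. Since `x̂` is not known in advance, `hN` asks for the numerical bound
-- at every point of `X` with the a priori approximate optimality of `x̂`.
set_option maxHeartbeats 800000 in
theorem CompositeModel.apgMu_spec (h : CompositeModel X φ₁ φ₂ μ L)
    {Lmin Lbar γ₁ γ₂ ε : ℝ} {y₀ : EuclideanSpace ℝ (Fin n)} {J N : ℕ} (hμ : 0 < μ)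
    (hμL : μ ≤ Lmin) (hL : 0 ≤ L) (hγ₁ : 1 < γ₁) (hγ₂ : 1 ≤ γ₂) (hLb : Lmin ≤ Lbar)
    (hLb' : γ₁ * L ≤ Lbar) (hJ : L ≤ γ₁ ^ J * Lmin) (hε : 0 ≤ ε)
    (hN : ∀ x ∈ X, (∀ w ∈ X, φ₁ x + φ₂ x ≤ φ₁ w + φ₂ w + Lbar / 2 * ‖y₀ - w‖ ^ 2) →
      (L + Lbar) ^ 2 * (2 / Lmin * ((1 - √(μ / Lbar)) ^ (N + 1) * (Lbar / 2 * ‖y₀ - x‖ ^ 2)))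
        ≤ ε ^ 2) :
    NearStationary X (fun x => φ₁ x + φ₂ x) ε (apgMu X φ₁ φ₂ Lmin μ γ₁ γ₂ y₀ ε).val ∧
      (apgMu X φ₁ φ₂ Lmin μ γ₁ γ₂ y₀ ε).cost ≤ 2 * (J + 1) + (N + 1) * (4 * (J + 1) + 1) := by
  have hLmin : 0 < Lmin := hμ.trans_le hμL
  have hLbar : 0 < Lbar := hLmin.trans_le hLb
  set F : EuclideanSpace ℝ (Fin n) → ℝ := fun x => φ₁ x + φ₂ x with hF
  set q := 1 - √(μ / Lbar) with hq
  have hq0 : 0 ≤ q := sub_nonneg.2 (sqrt_div_le_one (hμL.trans hLb) hLbar)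
  have hq1 : q ≤ 1 := by
    have := Real.sqrt_nonneg (μ / Lbar)
    rw [hq]; linarith
  obtain ⟨b1, b2, b3, b4⟩ := backtrack_spec (γ := γ₁) (L := Lmin) (Λ := L) (J := J)
    (accept := fun L => Descent φ₁ L y₀ (proxGrad X φ₁ φ₂ L y₀)) hγ₁ hLmin
    (fun L' hL' _ => h.descent hL' _ _) hJ
  set S := backtrack γ₁ Lmin fun L => Descent φ₁ L y₀ (proxGrad X φ₁ φ₂ L y₀) with hS
  set l₀ := S.val with hl₀
  have hl₀pos : 0 < l₀ := hLmin.trans_le b2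
  have hl₀b : l₀ ≤ Lbar := b3.trans (max_le hLb hLb')
  set x₀ := proxGrad X φ₁ φ₂ l₀ y₀ with hx₀
  have hdiv : ∀ l, 0 < l → l ≤ Lbar → max Lmin (l / γ₂) ≤ Lbar := fun l h1 h2 =>
    max_le hLb ((div_le_self h1.le hγ₂).trans h2)
  let I : ℕ → ApgState n → Prop := fun k s =>
    s.x ∈ X ∧ 0 < s.α ∧ Lmin ≤ s.L ∧ s.L ≤ Lbar ∧
    (∀ w ∈ X, F s.x - F w + μ / 2 * ‖s.aux - w‖ ^ 2 ≤ q ^ k * (Lbar / 2 * ‖y₀ - w‖ ^ 2)) ∧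
    (1 ≤ k → s.xhat ∈ X ∧ F s.xhat + Lmin / 2 * ‖s.x - s.xhat‖ ^ 2 ≤ F s.x ∧
      Metric.infEDist 0 (subdiff X F s.xhat) ≤ ENNReal.ofReal ((L + Lbar) * ‖s.xhat - s.x‖))
  have hcore := repeatUntil_spec (halt := fun s : ApgState n => NearStationary X F ε s.xhat)
    (body := apgBody X φ₁ φ₂ Lmin μ γ₁ γ₂)
    (s := { xprev := x₀, x := x₀, α := 1, L := max Lmin (l₀ / γ₂), xhat := x₀ })
    I N (4 * (J + 1) + 1) ?_ ?_ ?_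
  · obtain ⟨-, hhalt, hcost⟩ := hcore
    exact ⟨hhalt, add_le_add b4 hcost⟩
  · refine ⟨h.proxGrad_mem hl₀pos _, one_pos, le_max_left _ _, hdiv _ hl₀pos hl₀b, ?_,
      fun hc => absurd hc (by norm_num)⟩
    intro w hw
    have h1 := h.step hl₀pos hw b1
    rw [← hx₀] at h1
    simp only [ApgState.aux, sub_self, smul_zero, add_zero, pow_zero, one_mul]
    rw [norm_sub_rev x₀ w, norm_sub_rev y₀ w]
    have h2 : μ / 2 * ‖w - x₀‖ ^ 2 ≤ l₀ / 2 * ‖w - x₀‖ ^ 2 := by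
      have : μ ≤ l₀ := hμL.trans b2
      gcongr
    have h3 : (l₀ - μ) / 2 * ‖w - y₀‖ ^ 2 ≤ Lbar / 2 * ‖w - y₀‖ ^ 2 := by
      gcongr
      linarith
    simp only [hF]
    linarith
  · rintro k s ⟨h1, h2, h4, h5, h6, -⟩
    have hs0 : 0 < s.L := hLmin.trans_le h4
    obtain ⟨c1, c2, c3, c4⟩ := backtrack_spec (γ := γ₁) (L := s.L) (Λ := L) (J := J)
      (accept := fun L => Descent φ₁ L (apgExtrapolate μ s L)
        (proxGrad X φ₁ φ₂ L (apgExtrapolate μ s L))) hγ₁ hs0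
      (fun L' hL' _ => h.descent hL' _ _) (hJ.trans (by gcongr))
    set S1 := backtrack γ₁ s.L (fun L => Descent φ₁ L (apgExtrapolate μ s L)
        (proxGrad X φ₁ φ₂ L (apgExtrapolate μ s L))) with hS1
    set lt := S1.val with hlt
    have hlt0 : 0 < lt := hs0.trans_le c2
    have hltb : lt ≤ Lbar := c3.trans (max_le h5 hLb')
    have hltm : Lmin ≤ lt := h4.trans c2
    set y := apgExtrapolate μ s lt with hy
    set p := proxGrad X φ₁ φ₂ lt y with hp
    have hpX : p ∈ X := h.proxGrad_mem hlt0 _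
    obtain ⟨d1, d2, d3, d4⟩ := backtrack_spec (γ := γ₁) (L := lt) (Λ := L) (J := J)
      (accept := fun L => Descent φ₁ L p (proxGrad X φ₁ φ₂ L p)) hγ₁ hlt0
      (fun L' hL' _ => h.descent hL' _ _) (hJ.trans (by gcongr))
    set S2 := backtrack γ₁ lt (fun L => Descent φ₁ L p (proxGrad X φ₁ φ₂ L p)) with hS2
    set lh := S2.val with hlh
    have hlh0 : 0 < lh := hlt0.trans_le d2
    have hlhb : lh ≤ Lbar := d3.trans (max_le hltb hLb')
    set xh := proxGrad X φ₁ φ₂ lh p with hxh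
    have hbody : (apgBody X φ₁ φ₂ Lmin μ γ₁ γ₂ s).val =
      { xprev := s.x, x := p, α := √(μ / lt), L := max Lmin (lt / γ₂), xhat := xh } := rfl
    have hα : 0 < √(μ / lt) := Real.sqrt_pos.2 (by positivity)
    have hα1 : √(μ / lt) ≤ 1 := sqrt_div_le_one (hμL.trans hltm) hlt0
    constructor
    · rw [hbody]
      refine ⟨hpX, hα, le_max_left _ _, hdiv _ hlt0 hltb, ?_, fun _ => ?_⟩
      · intro w hw
        have hst := h.apg_step (v := s.aux) hlt0 hα hα1
          (by rw [Real.sq_sqrt (by positivity)]; field_simp) h1 hw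
          (apgExtrapolate_eq s h2 lt) c1
        have hB : 0 ≤ q ^ k * (Lbar / 2 * ‖y₀ - w‖ ^ 2) := by positivity
        have hαq : 1 - √(μ / lt) ≤ q := by
          rw [hq]
          have : √(μ / Lbar) ≤ √(μ / lt) := by gcongr
          linarith
        calc F p - F w + μ / 2 * ‖s.x + (1 / √(μ / lt)) • (p - s.x) - w‖ ^ 2
            ≤ (1 - √(μ / lt)) * (F s.x - F w + μ / 2 * ‖s.aux - w‖ ^ 2) := hst
          _ ≤ (1 - √(μ / lt)) * (q ^ k * (Lbar / 2 * ‖y₀ - w‖ ^ 2)) := by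
              have : 0 ≤ 1 - √(μ / lt) := by linarith
              gcongr
              exact h6 w hw
          _ ≤ q * (q ^ k * (Lbar / 2 * ‖y₀ - w‖ ^ 2)) := by gcongr
          _ = q ^ (k + 1) * (Lbar / 2 * ‖y₀ - w‖ ^ 2) := by ring
      · refine ⟨h.proxGrad_mem hlh0 _, ?_, ?_⟩
        · have hst := h.step hlh0 hpX d1
          simp only [sub_self, norm_zero] at hst
          have h7 : Lmin / 2 * ‖p - xh‖ ^ 2 ≤ lh / 2 * ‖p - xh‖ ^ 2 := by
            have : Lmin ≤ lh := hltm.trans d2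
            gcongr
          change F xh + Lmin / 2 * ‖p - xh‖ ^ 2 ≤ F p
          change F xh + lh / 2 * ‖p - xh‖ ^ 2 ≤ F p + _ at hst
          linarith
        · refine (h.infEDist_subdiff_le hμ.le hlh0 p).trans (ENNReal.ofReal_le_ofReal ?_)
          change (L + lh) * ‖xh - p‖ ≤ (L + Lbar) * ‖xh - p‖
          gcongr
    · change S1.cost + S2.cost + 1 ≤ _
      calc S1.cost + S2.cost + 1 ≤ 2 * ((J : ℕ∞) + 1) + 2 * (J + 1) + 1 := by gcongr
        _ = 4 * (J + 1) + 1 := by ring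
  · rintro s ⟨h1, h2, h4, h5, h6, h7⟩
    obtain ⟨h8, h9, h10⟩ := h7 (by omega)
    refine h10.trans (ENNReal.ofReal_le_ofReal ?_)
    have hle : ∀ w ∈ X, F s.x ≤ F w + q ^ (N + 1) * (Lbar / 2 * ‖y₀ - w‖ ^ 2) := fun w hw => by
      have := h6 w hw
      have : 0 ≤ μ / 2 * ‖s.aux - w‖ ^ 2 := by positivity
      linarith
    have h11 := hN s.xhat h8 (fun w hw => by
      have e1 := hle w hw
      have e2 : q ^ (N + 1) * (Lbar / 2 * ‖y₀ - w‖ ^ 2) ≤ Lbar / 2 * ‖y₀ - w‖ ^ 2 :=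
        mul_le_of_le_one_left (by positivity) (pow_le_one₀ hq0 hq1)
      have e3 : 0 ≤ Lmin / 2 * ‖s.x - s.xhat‖ ^ 2 := by positivity
      change F s.xhat ≤ F w + _
      linarith)
    -- The comparison point is the output `x̂` itself: `F x - F x̂` is bounded below by the squared
    -- step and above by the contracted potential.
    have h12 : ‖s.xhat - s.x‖ ^ 2 ≤
        2 / Lmin * (q ^ (N + 1) * (Lbar / 2 * ‖y₀ - s.xhat‖ ^ 2)) := by
      have e1 := hle _ h8
      have e2 : Lmin / 2 * ‖s.x - s.xhat‖ ^ 2 ≤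
        q ^ (N + 1) * (Lbar / 2 * ‖y₀ - s.xhat‖ ^ 2) := by linarith
      rw [norm_sub_rev]
      calc ‖s.x - s.xhat‖ ^ 2 = 2 / Lmin * (Lmin / 2 * ‖s.x - s.xhat‖ ^ 2) := by field_simp
        _ ≤ _ := by gcongr
    apply le_of_sq_le_sq _ hε
    rw [mul_pow]
    refine le_trans ?_ h11
    gcongr

end Apg

/-! ### Consequences of the basic assumption -/

section Data

variable {n : ℕ}

theorem ProperLscConvex.convexOn_toReal {h : EuclideanSpace ℝ (Fin n) → EReal}
    (hh : ProperLscConvex h) : ConvexOn ℝ {x | h x ≠ ⊤} fun x => (h x).toReal := by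
  have key : ∀ x, h x ≠ ⊤ → ∀ y, h y ≠ ⊤ → ∀ a b : ℝ, 0 ≤ a → 0 ≤ b → a + b = 1 →
      h (a • x + b • y) ≤ ((a * (h x).toReal + b * (h y).toReal : ℝ) : EReal) := by
    intro x hx y hy a b ha hb hab
    have h1 : ((x, (h x).toReal) : EuclideanSpace ℝ (Fin n) × ℝ) ∈
      {p : EuclideanSpace ℝ (Fin n) × ℝ | h p.1 ≤ (p.2 : EReal)} := EReal.le_coe_toReal hx
    have h2 : ((y, (h y).toReal) : EuclideanSpace ℝ (Fin n) × ℝ) ∈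
      {p : EuclideanSpace ℝ (Fin n) × ℝ | h p.1 ≤ (p.2 : EReal)} := EReal.le_coe_toReal hy
    simpa using hh.convex_epigraph h1 h2 ha hb hab
  refine ⟨fun x hx y hy a b ha hb hab => ?_, fun x hx y hy a b ha hb hab => ?_⟩
  · exact ne_top_of_le_ne_top (EReal.coe_ne_top _) (key x hx y hy a b ha hb hab)
  · have := EReal.toReal_le_toReal (key x hx y hy a b ha hb hab) (hh.ne_bot _)
      (EReal.coe_ne_top _)
    simpa only [EReal.toReal_coe, smul_eq_mul] using this

namespace Problem.Basic

variable {P : Problem n} {Lf Lg lf₂ : ℝ≥0}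

theorem convex_X (hP : P.Basic Lf Lg lf₂) : Convex ℝ P.X :=
  (hP.f₂_proper.convexOn_toReal.1).inter (hP.g₂_proper.convexOn_toReal.1)

theorem convexOn_rf₂ (hP : P.Basic Lf Lg lf₂) : ConvexOn ℝ P.X P.rf₂ :=
  hP.f₂_proper.convexOn_toReal.subset (fun _ hx => hx.1) hP.convex_X

theorem convexOn_rg₂ (hP : P.Basic Lf Lg lf₂) : ConvexOn ℝ P.X P.rg₂ :=
  hP.g₂_proper.convexOn_toReal.subset (fun _ hx => hx.2) hP.convex_X

theorem gExt_eq (hP : P.Basic Lf Lg lf₂) {x : EuclideanSpace ℝ (Fin n)} (hx : P.g₂ x ≠ ⊤) :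
    P.gExt x = (P.g x : EReal) := by
  unfold Problem.gExt Problem.g Problem.rg₂
  rw [EReal.coe_add, EReal.coe_toReal hx (hP.g₂_proper.ne_bot x)]

theorem mem_levG (hP : P.Basic Lf Lg lf₂) {x : EuclideanSpace ℝ (Fin n)} (hx : x ∈ P.X) {D : ℝ} :
    x ∈ P.levG D ↔ P.g x ≤ D := by
  unfold Problem.levG
  rw [Set.mem_ofPred_eq, hP.gExt_eq hx.2, EReal.coe_le_coe_iff]

theorem gStar_le (hP : P.Basic Lf Lg lf₂) {x : EuclideanSpace ℝ (Fin n)} (hx : x ∈ P.X) :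
    P.gStar ≤ P.g x := csInf_le hP.bddBelow_g ⟨x, hx, rfl⟩

theorem fStar_le (hP : P.Basic Lf Lg lf₂) {x : EuclideanSpace ℝ (Fin n)} (hx : x ∈ P.X) :
    P.fStar ≤ P.f x := csInf_le hP.bddBelow_f ⟨x, hx, rfl⟩

theorem lower_mem_levG (hP : P.Basic Lf Lg lf₂) {x y : EuclideanSpace ℝ (Fin n)}
    (hx : x ∈ P.lowerSolutions) (hy : y ∈ P.X) {D : ℝ} (hD : P.g y ≤ D) : x ∈ P.levG D :=
  (hx y).trans ((hP.mem_levG hy).2 hD)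

theorem g_le_of_lower (hP : P.Basic Lf Lg lf₂) {x y : EuclideanSpace ℝ (Fin n)}
    (hx : x ∈ P.X ∩ P.lowerSolutions) (hy : y ∈ P.X) : P.g x ≤ P.g y :=
  (hP.mem_levG hx.1).1 (hP.lower_mem_levG hx.2 hy le_rfl)

theorem g_eq_gStar (hP : P.Basic Lf Lg lf₂) {x : EuclideanSpace ℝ (Fin n)}
    (hx : x ∈ P.X ∩ P.lowerSolutions) : P.g x = P.gStar := by
  refine le_antisymm (le_csInf ⟨_, x, hx.1, rfl⟩ ?_) (hP.gStar_le hx.1)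
  rintro _ ⟨y, hy, rfl⟩
  exact hP.g_le_of_lower hx hy

theorem mem_lowerSolutions (hP : P.Basic Lf Lg lf₂) {x : EuclideanSpace ℝ (Fin n)}
    (hx : x ∈ P.X) (hg : P.g x ≤ P.gStar) : x ∈ P.lowerSolutions := by
  obtain ⟨s, hs⟩ := hP.feasible
  intro y
  refine le_trans ?_ (hs.2 y)
  rw [hP.gExt_eq hx.2, hP.gExt_eq hs.1.2, hP.g_eq_gStar hs]
  exact_mod_cast hg

theorem bddBelow_pStar (hP : P.Basic Lf Lg lf₂) :
    BddBelow (P.f '' (P.X ∩ P.lowerSolutions)) :=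
  hP.bddBelow_f.mono (Set.image_mono Set.inter_subset_left)

theorem pStar_le (hP : P.Basic Lf Lg lf₂) {x : EuclideanSpace ℝ (Fin n)}
    (hx : x ∈ P.X ∩ P.lowerSolutions) : P.pStar ≤ P.f x := csInf_le hP.bddBelow_pStar ⟨x, hx, rfl⟩

theorem exists_f_lt (hP : P.Basic Lf Lg lf₂) {c : ℝ} (hc : P.pStar < c) :
    ∃ x ∈ P.X ∩ P.lowerSolutions, P.f x < c := by
  obtain ⟨_, ⟨x, hx, rfl⟩, h⟩ := exists_lt_of_csInf_lt (hP.feasible.image P.f) hc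
  exact ⟨x, hx, h⟩

theorem fStar_le_pStar (hP : P.Basic Lf Lg lf₂) : P.fStar ≤ P.pStar := by
  obtain ⟨Δ, h1, h2⟩ := hP.gap
  linarith

theorem differentiable_f₁ (hP : P.Basic Lf Lg lf₂) : Differentiable ℝ P.f₁ :=
  hP.smooth_f₁.differentiable (by norm_num)

theorem differentiable_g₁ (hP : P.Basic Lf Lg lf₂) : Differentiable ℝ P.g₁ :=
  hP.smooth_g₁.differentiable (by norm_num)

theorem rf₂_sub_le (hP : P.Basic Lf Lg lf₂) {x y : EuclideanSpace ℝ (Fin n)}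
    (hx : x ∈ P.X) (hy : y ∈ P.X) : P.rf₂ x - P.rf₂ y ≤ lf₂ * ‖x - y‖ := by
  have := hP.lipschitz_f₂.dist_le_mul x hx.1 y hy.1
  rw [dist_eq_norm, dist_eq_norm, Real.norm_eq_abs] at this
  exact (le_abs_self _).trans this

theorem f_sub_le (hP : P.Basic Lf Lg lf₂) {x y : EuclideanSpace ℝ (Fin n)}
    (hx : x ∈ P.X) (hy : y ∈ P.X) :
    P.f x - P.f y ≤ (‖gradient P.f₁ x‖ + lf₂) * ‖x - y‖ := by
  have h1 := gradient_le_sub_of_convex hP.differentiable_f₁ hP.convex_f₁ y x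
  have h2 := hP.rf₂_sub_le hx hy
  have h3 := real_inner_le_norm (gradient P.f₁ x) (x - y)
  have h4 : ⟪gradient P.f₁ x, y - x⟫ = -⟪gradient P.f₁ x, x - y⟫ := by
    rw [← inner_neg_right, neg_sub]
  unfold Problem.f
  rw [h4] at h1
  linarith

theorem norm_gradient_f₁_le (hP : P.Basic Lf Lg lf₂) (x y : EuclideanSpace ℝ (Fin n)) :
    ‖gradient P.f₁ x‖ ≤ ‖gradient P.f₁ y‖ + Lf * ‖x - y‖ := by
  have h1 := hP.lipschitz_grad_f₁.dist_le_mul x y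
  rw [dist_eq_norm, dist_eq_norm] at h1
  have h2 := norm_sub_norm_le (gradient P.f₁ x) (gradient P.f₁ y)
  linarith

theorem convexOn_f (hP : P.Basic Lf Lg lf₂) : ConvexOn ℝ P.X P.f :=
  (hP.convex_f₁.subset (Set.subset_univ _) hP.convex_X).add hP.convexOn_rf₂

theorem convexOn_g (hP : P.Basic Lf Lg lf₂) : ConvexOn ℝ P.X P.g :=
  (hP.convex_g₁.subset (Set.subset_univ _) hP.convex_X).add hP.convexOn_rg₂

theorem compositeModel_f (hP : P.Basic Lf Lg lf₂) : CompositeModel P.X P.f₁ P.rf₂ 0 Lf where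
  convex := hP.convexOn_rf₂
  exists_prox := hP.prox_f₂
  lower x y := by
    simpa using gradient_le_sub_of_convex hP.differentiable_f₁ hP.convex_f₁ x y
  upper x y := le_quadratic_of_lipschitz_gradient hP.differentiable_f₁ hP.lipschitz_grad_f₁ x y
  lipschitz x y := by
    simpa [dist_eq_norm] using hP.lipschitz_grad_f₁.dist_le_mul x y

theorem compositeModel_g (hP : P.Basic Lf Lg lf₂) : CompositeModel P.X P.g₁ P.rg₂ 0 Lg where
  convex := hP.convexOn_rg₂
  exists_prox := by simpa using hP.prox_g₂ 0 le_rfl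
  lower x y := by
    simpa using gradient_le_sub_of_convex hP.differentiable_g₁ hP.convex_g₁ x y
  upper x y := le_quadratic_of_lipschitz_gradient hP.differentiable_g₁ hP.lipschitz_grad_g₁ x y
  lipschitz x y := by
    simpa [dist_eq_norm] using hP.lipschitz_grad_g₁.dist_le_mul x y

theorem gradient_regularized (hP : P.Basic Lf Lg lf₂) (ε z : ℝ)
    (a x : EuclideanSpace ℝ (Fin n)) :
    gradient (fun x => P.g₁ x + ε / 2 * ‖x - a‖ ^ 2 + z * P.f₁ x) x =
      gradient P.g₁ x + ε • (x - a) + z • gradient P.f₁ x := by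
  apply HasGradientAt.gradient
  rw [hasGradientAt_iff_hasFDerivAt]
  have h1 := (hP.differentiable_g₁ x).hasGradientAt.hasFDerivAt
  have h2 := (hP.differentiable_f₁ x).hasGradientAt.hasFDerivAt
  have h3 : HasFDerivAt (fun x => ‖x - a‖ ^ 2) (2 • (innerSL ℝ (x - a))) x := by
    have := ((hasFDerivAt_id x).sub_const a).norm_sq
    simpa using this
  refine ((h1.add (h3.const_mul (ε / 2))).add (h2.const_mul z)).congr_fderiv ?_
  ext v
  simp [-inner_gradient_left]
  ring

theorem compositeModel_regularized (hP : P.Basic Lf Lg lf₂) {ε z : ℝ} (hε : 0 ≤ ε) (hz : 0 ≤ z)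
    (a : EuclideanSpace ℝ (Fin n)) {L : ℝ} (hL : Lg + ε + z * Lf ≤ L) :
    CompositeModel P.X (fun x => P.g₁ x + ε / 2 * ‖x - a‖ ^ 2 + z * P.f₁ x)
      (fun x => P.rg₂ x + z * P.rf₂ x) ε L where
  convex := hP.convexOn_rg₂.add (hP.convexOn_rf₂.smul hz)
  exists_prox := hP.prox_g₂ z hz
  lower x y := by
    rw [hP.gradient_regularized]
    have h1 := gradient_le_sub_of_convex hP.differentiable_g₁ hP.convex_g₁ x y
    have h2 := mul_le_mul_of_nonneg_left
      (gradient_le_sub_of_convex hP.differentiable_f₁ hP.convex_f₁ x y) hz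
    have e : x - a = (y - a) + (x - y) := by abel
    rw [inner_add_left, inner_add_left, inner_smul_left, inner_smul_left, e, norm_add_sq_real]
    simp only [conj_trivial]
    linarith
  upper x y := by
    rw [hP.gradient_regularized]
    have h1 := le_quadratic_of_lipschitz_gradient hP.differentiable_g₁ hP.lipschitz_grad_g₁ x y
    have h2 := mul_le_mul_of_nonneg_left (le_quadratic_of_lipschitz_gradient
      hP.differentiable_f₁ hP.lipschitz_grad_f₁ x y) hz
    have h3 := mul_le_mul_of_nonneg_right hL (by positivity : 0 ≤ ‖x - y‖ ^ 2 / 2)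
    have e : x - a = (y - a) + (x - y) := by abel
    rw [inner_add_left, inner_add_left, inner_smul_left, inner_smul_left, e, norm_add_sq_real]
    simp only [conj_trivial]
    linarith
  lipschitz x y := by
    rw [hP.gradient_regularized, hP.gradient_regularized]
    have h1 := hP.lipschitz_grad_g₁.dist_le_mul x y
    have h2 := hP.lipschitz_grad_f₁.dist_le_mul x y
    rw [dist_eq_norm, dist_eq_norm] at h1 h2
    have e : gradient P.g₁ x + ε • (x - a) + z • gradient P.f₁ x -
        (gradient P.g₁ y + ε • (y - a) + z • gradient P.f₁ y) =
        (gradient P.g₁ x - gradient P.g₁ y) + ε • (x - y) +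
          z • (gradient P.f₁ x - gradient P.f₁ y) := by module
    rw [e]
    calc _ ≤ ‖gradient P.g₁ x - gradient P.g₁ y‖ + ‖ε • (x - y)‖ +
          ‖z • (gradient P.f₁ x - gradient P.f₁ y)‖ := norm_add₃_le
      _ ≤ Lg * ‖x - y‖ + ε * ‖x - y‖ + z * (Lf * ‖x - y‖) := by
          rw [norm_smul, norm_smul, Real.norm_eq_abs, Real.norm_eq_abs, abs_of_nonneg hε,
            abs_of_nonneg hz]
          gcongr
      _ = (Lg + ε + z * Lf) * ‖x - y‖ := by ring
      _ ≤ L * ‖x - y‖ := by gcongr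

end Problem.Basic

end Data

open Filter Topology

/-! ### Facts about a run with small tolerance -/

section Regime

variable {n : ℕ}

theorem eventually_pos_lt {δ : ℝ} (hδ : 0 < δ) : ∀ᶠ ε in 𝓝[>] (0 : ℝ), 0 < ε ∧ ε < δ :=
  Ioo_mem_nhdsGT hδ

theorem CompositeModel.exists_fista_cost {X : Set (EuclideanSpace ℝ (Fin n))}
    {φ₁ φ₂ : EuclideanSpace ℝ (Fin n) → ℝ} {L : ℝ} (h : CompositeModel X φ₁ φ₂ 0 L)
    {L₀ η R : ℝ} {x₀ w : EuclideanSpace ℝ (Fin n)} (hη : 1 < η) (hL₀ : 0 < L₀)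
    (hL₀L : L₀ ≤ η * L) (hw : w ∈ X) (hmin : ∀ y ∈ X, φ₁ w + φ₂ w ≤ φ₁ y + φ₂ y)
    (hR : ‖x₀ - w‖ ≤ R) :
    ∃ C : ℝ, 0 ≤ C ∧ ∀ ε : ℝ, 0 < ε → ε ≤ 1 →
      (fista X φ₁ φ₂ L₀ η x₀ L R ε).val ∈ X ∧
      φ₁ (fista X φ₁ φ₂ L₀ η x₀ L R ε).val + φ₂ (fista X φ₁ φ₂ L₀ η x₀ L R ε).val
        ≤ φ₁ w + φ₂ w + ε ∧
      ‖(fista X φ₁ φ₂ L₀ η x₀ L R ε).val - w‖ ≤ R ∧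
      ∃ T : ℕ, (fista X φ₁ φ₂ L₀ η x₀ L R ε).cost ≤ T ∧ (T : ℝ) ≤ C / √ε := by
  obtain ⟨J, hJ⟩ := pow_unbounded_of_one_lt (L / L₀) hη
  have hJ' : L ≤ η ^ J * L₀ := ((div_lt_iff₀ hL₀).1 hJ).le
  have hL : 0 < L := pos_of_mul_pos_right (hL₀.trans_le hL₀L) (by linarith)
  set B := 2 * η * L * R ^ 2 with hB
  have hB0 : 0 ≤ B := by positivity
  refine ⟨(√B + 2) * (2 * (J + 1)), by positivity, fun ε hε hε1 => ?_⟩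
  have hs : 0 < √ε := Real.sqrt_pos.2 hε
  have hs1 : √ε ≤ 1 := by simpa using hε1
  set N := ⌈√B / √ε⌉₊ with hN
  have hN1 : √B / √ε ≤ N := Nat.le_ceil _
  have hN2 : (N : ℝ) < √B / √ε + 1 := Nat.ceil_lt_add_one (by positivity)
  have hcond : 2 * η * L / ((N : ℝ) + 1 + 1) ^ 2 * R ^ 2 ≤ ε := by
    have h1 : √B ≤ ((N : ℝ) + 1 + 1) * √ε := by
      have := (div_le_iff₀ hs).1 hN1
      nlinarith
    have h2 := pow_le_pow_left₀ (Real.sqrt_nonneg _) h1 2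
    rw [Real.sq_sqrt hB0, mul_pow, Real.sq_sqrt hε.le] at h2
    rw [div_mul_eq_mul_div, div_le_iff₀ (by positivity), ← hB]
    linarith
  obtain ⟨h1, h2, h3, h4⟩ := h.fista_spec hη hL₀ hL₀L hw hmin hR hJ' hcond
  refine ⟨h1, h2, h3, (N + 1) * (2 * (J + 1)), by exact_mod_cast h4, ?_⟩
  push_cast
  rw [mul_div_right_comm]
  gcongr
  rw [add_div]
  have : 2 ≤ 2 / √ε := by
    rw [le_div_iff₀ hs]; linarith
  linarith

/-- The hypotheses of the complexity estimate on the tolerance `ε`, apart from regularity. -/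
structure Setting (P : Problem n) (A : Params n) (M ε : ℝ) : Prop where
  bounded : BoundedLevelSets P A ε
  dz_ge : 1 ≤ 2 * Dz P A ε
  dz_le : Dz P A ε ≤ M
  dg_le : Dg P A ε ≤ M

/-- Bounds on the quantities of a run, uniform in the tolerance `ε`. -/
structure Regime (P : Problem n) (A : Params n) (M d β CD U ε : ℝ) : Prop
    extends Setting P A M ε where
  ε_pos : 0 < ε
  ε_le_one : ε ≤ 1
  x0_mem : x0 P A ε ∈ P.X
  f_x0_le : P.f (x0 P A ε) ≤ P.fStar + ε
  xg_mem : xg P A ε ∈ P.X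
  g_xg_le : P.g (xg P A ε) ≤ P.gStar + ε
  u0_le : u0 P A ε ≤ U
  d_pos : 0 < d
  d_le_R1 : d ≤ R1 P A ε
  d_le_Dg : d ≤ Dg P A ε
  β_pos : 0 < β
  grad_le : ∀ x ∈ P.levG (DL P A ε), ‖gradient P.f₁ x‖ + A.lf₂ ≤ Bf P A ε
  β_le : β ≤ Bf P A ε
  Dtol_le : Dtol P A ε ≤ CD

theorem Params.Admissible.exists_runF {P : Problem n} {A : Params n} (hA : A.Admissible P)
    (hP : P.Basic A.Lf A.Lg A.lf₂) : ∃ C : ℝ, 0 ≤ C ∧ ∀ ε : ℝ, 0 < ε → ε ≤ 1 →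
      x0 P A ε ∈ P.X ∧ P.f (x0 P A ε) ≤ P.fStar + ε ∧
      ∃ T : ℕ, (runF P A ε).cost ≤ T ∧ (T : ℝ) ≤ C / √ε := by
  obtain ⟨w, hw, hmin, hR⟩ := hA.radius_f
  obtain ⟨C, hC, h⟩ := hP.compositeModel_f.exists_fista_cost hA.η_gt hA.L₀_pos hA.L₀_le_f hw
    hmin hR
  refine ⟨C, hC, fun ε h1 h2 => ?_⟩
  obtain ⟨h3, h4, -, h5⟩ := h ε h1 h2
  refine ⟨h3, h4.trans ?_, h5⟩
  have : P.f w ≤ P.fStar := le_csInf ⟨_, w, hw, rfl⟩ (by rintro _ ⟨y, hy, rfl⟩; exact hmin y hy)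
  change P.f w + ε ≤ _
  linarith

/-- The bound `U` on `u₀` does not depend on `ε`, since `x̃_g` stays within `R_g` of a fixed
minimizer, where `f` is controlled by convexity and the Lipschitz gradient. -/
theorem Params.Admissible.exists_runG {P : Problem n} {A : Params n} (hA : A.Admissible P)
    (hP : P.Basic A.Lf A.Lg A.lf₂) : ∃ C U : ℝ, 0 ≤ C ∧ ∀ ε : ℝ, 0 < ε → ε ≤ 1 →
      xg P A ε ∈ P.X ∧ P.g (xg P A ε) ≤ P.gStar + ε ∧ u0 P A ε ≤ U ∧
      ∃ T : ℕ, (runG P A ε).cost ≤ T ∧ (T : ℝ) ≤ C / √ε := by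
  obtain ⟨w, hw, hmin, hR⟩ := hA.radius_g
  obtain ⟨C, hC, h⟩ := hP.compositeModel_g.exists_fista_cost hA.η_gt hA.L₀_pos hA.L₀_le_g hw
    hmin hR
  refine ⟨C, P.f w + (‖gradient P.f₁ w‖ + A.Lf * A.Rg + A.lf₂) * A.Rg, hC, fun ε h1 h2 => ?_⟩
  obtain ⟨h3, h4, h6, h5⟩ := h ε h1 h2
  refine ⟨h3, h4.trans ?_, ?_, h5⟩
  · have : P.g w ≤ P.gStar :=
      le_csInf ⟨_, w, hw, rfl⟩ (by rintro _ ⟨y, hy, rfl⟩; exact hmin y hy)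
    change P.g w + ε ≤ _
    linarith
  · have e1 := hP.f_sub_le h3 hw
    have e2 := hP.norm_gradient_f₁_le (xg P A ε) w
    change ‖xg P A ε - w‖ ≤ A.Rg at h6
    have e3 : (‖gradient P.f₁ (xg P A ε)‖ + A.lf₂) * ‖xg P A ε - w‖ ≤
        (‖gradient P.f₁ w‖ + A.Lf * A.Rg + A.lf₂) * A.Rg := by
      have : ‖gradient P.f₁ (xg P A ε)‖ ≤ ‖gradient P.f₁ w‖ + A.Lf * A.Rg :=
        e2.trans (by gcongr)
      have : 0 ≤ A.Rg := (norm_nonneg _).trans hR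
      gcongr
    change P.f (xg P A ε) ≤ _
    change P.f (xg P A ε) - _ ≤ (‖gradient P.f₁ (xg P A ε)‖ + A.lf₂) * ‖xg P A ε - w‖ at e1
    linarith

theorem le_D0 {P : Problem n} {A : Params n} {ε : ℝ} (h : 1 ≤ 2 * Dz P A ε) :
    P.g (x0 P A ε) ≤ D0 P A ε := by
  unfold D0
  have h1 : 0 ≤ max 0 (-2 * Dz P A ε * P.fStar) := le_max_left _ _
  have h2 : 0 ≤ 2 * Dz P A ε * |u0 P A ε| := by
    have := abs_nonneg (u0 P A ε)
    nlinarith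
  linarith

theorem one_le_Lφ {P : Problem n} {A : Params n} {ε : ℝ} (h : 1 ≤ 2 * Dz P A ε) :
    1 ≤ Lφ P A ε := by
  unfold Lφ
  have : 0 ≤ 2 * Dz P A ε * A.Lf := mul_nonneg (by linarith) A.Lf.2
  have : 0 ≤ (A.Lg : ℝ) := A.Lg.2
  linarith

theorem D0_add_le_DL {P : Problem n} {A : Params n} {ε : ℝ} (hγ : 1 < A.γ₁)
    (h : 1 ≤ 2 * Dz P A ε) : D0 P A ε + R1 P A ε ^ 2 ≤ DL P A ε := by
  unfold DL
  have h1 := one_le_Lφ h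
  have h2 : 1 ≤ A.γ₁ * Lφ P A ε := by nlinarith
  nlinarith [sq_nonneg (R1 P A ε)]

theorem Problem.levG_mono (P : Problem n) {a b : ℝ} (h : a ≤ b) : P.levG a ⊆ P.levG b :=
  fun x hx => show P.gExt x ≤ b from le_trans (show P.gExt x ≤ a from hx) (by exact_mod_cast h)

/-- Every lower-level solution lies in both level sets. Two distinct ones bound `R₁` and `D_g` below
by `d`, and the diameter bound `M` around one of them bounds the gradients, hence `B_f` and the
tolerance constant, above. -/
theorem exists_regime {P : Problem n} {A : Params n} (hP : P.Basic A.Lf A.Lg A.lf₂)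
    (hA : A.Admissible P) {M : ℝ} (hM : 0 < M) :
    ∃ d β CD U : ℝ, 0 < d ∧ 0 < β ∧ 0 < CD ∧ ∀ᶠ ε in 𝓝[>] (0 : ℝ), Setting P A M ε → Regime P A M d β CD U ε := by
  obtain ⟨CF, -, hF⟩ := hA.exists_runF hP
  obtain ⟨CG, U, -, hG⟩ := hA.exists_runG hP
  obtain ⟨p, hp, q, hq, hpq⟩ := hP.solutions_nontrivial
  obtain ⟨s, hs⟩ := hP.feasible
  obtain ⟨Δ, hΔ, hgap⟩ := hP.gap
  set CB := ‖gradient P.f₁ p‖ + A.Lf * M + A.lf₂ with hCB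
  refine ⟨dist p q, Δ / (2 * M),
    max 1 ((1 + M * (1 + M)) * max CB (2 * M * CB + 2 * M * CB ^ 2)), U, dist_pos.2 hpq,
    by positivity, by positivity, ?_⟩
  filter_upwards [eventually_pos_lt one_pos, eventually_pos_lt (half_pos hΔ)]
    with ε hε' hεΔ' hS
  obtain ⟨hε, hε1⟩ := hε'
  have hεΔ := hεΔ'.2
  obtain ⟨f1, f2, -⟩ := hF ε hε hε1.le
  obtain ⟨g1, g2, g3, -⟩ := hG ε hε hε1.le
  have hD0 := le_D0 hS.dz_ge
  have hDL : D0 P A ε ≤ DL P A ε := by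
    have := D0_add_le_DL hA.γ₁_gt hS.dz_ge
    nlinarith [sq_nonneg (R1 P A ε)]
  have hlow : ∀ x ∈ P.lowerSolutions, x ∈ P.levG (D0 P A ε) := fun x hx =>
    hP.lower_mem_levG hx f1 hD0
  have hsub := P.levG_mono hDL
  have hbdd : ∀ x ∈ P.levG (DL P A ε), ‖gradient P.f₁ x‖ + A.lf₂ ≤ CB := fun x hx => by
    have h1 := hP.norm_gradient_f₁_le x p
    have h2 : ‖x - p‖ ≤ M := by
      rw [← dist_eq_norm]
      exact (Metric.dist_le_diam_of_mem hS.bounded.2 hx (hsub (hlow p hp))).trans hS.dg_le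
    have h3 : (A.Lf : ℝ) * ‖x - p‖ ≤ A.Lf * M := by gcongr
    linarith
  have hgrad : ∀ x ∈ P.levG (DL P A ε), ‖gradient P.f₁ x‖ + A.lf₂ ≤ Bf P A ε := fun x hx => by
    have : ‖gradient P.f₁ x‖ ≤ sSup ((fun x => ‖gradient P.f₁ x‖) '' P.levG (DL P A ε)) := by
      refine le_csSup ?_ (Set.mem_image_of_mem _ hx)
      refine ⟨CB, ?_⟩
      rintro _ ⟨y, hy, rfl⟩
      have := hbdd y hy
      have h0 : (0 : ℝ) ≤ A.lf₂ := A.lf₂.2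
      simp only
      linarith
    unfold Bf
    linarith
  have hBf : Bf P A ε ≤ CB := by
    have : sSup ((fun x => ‖gradient P.f₁ x‖) '' P.levG (DL P A ε)) ≤ CB - A.lf₂ := by
      refine csSup_le (Set.Nonempty.image _ ⟨p, hsub (hlow p hp)⟩) ?_
      rintro _ ⟨y, hy, rfl⟩
      have := hbdd y hy
      simp only
      linarith
    unfold Bf
    linarith
  have hBf0 : 0 ≤ Bf P A ε :=
    le_trans (by positivity) (hgrad p (hsub (hlow p hp)))
  have hDg0 : 0 ≤ Dg P A ε := Metric.diam_nonneg
  refine ⟨hS, hε, hε1.le, f1, f2, g1, g2, g3, dist_pos.2 hpq, ?_, ?_, by positivity, hgrad, ?_, ?_⟩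
  · exact Metric.dist_le_diam_of_mem hS.bounded.1 (hlow p hp) (hlow q hq)
  · exact Metric.dist_le_diam_of_mem hS.bounded.2 (hsub (hlow p hp)) (hsub (hlow q hq))
  -- The gap `p^* - f^* ≥ Δ` enters here: `f` drops by at least `Δ/2` from `s` to `x⁰` over a
  -- distance at most `M`, so its slope bound `B_f` is at least `Δ / (2M)`.
  · have h1 := hP.f_sub_le hs.1 f1
    have h2 := hP.pStar_le hs
    have h3 : ‖s - x0 P A ε‖ ≤ M := by
      rw [← dist_eq_norm]
      exact (Metric.dist_le_diam_of_mem hS.bounded.2 (hsub (hlow s hs.2))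
        (hsub ((hP.mem_levG f1).2 hD0))).trans hS.dg_le
    have h4 : (‖gradient P.f₁ s‖ + A.lf₂) * ‖s - x0 P A ε‖ ≤ Bf P A ε * M := by
      have := hgrad s (hsub (hlow s hs.2))
      gcongr
    rw [div_le_iff₀ (by positivity)]
    linarith
  · have hDz : 0 ≤ Dz P A ε := by linarith [hS.dz_ge]
    apply le_max_of_le_right
    unfold Dtol
    have := hS.dz_le
    have := hS.dg_le
    gcongr

end Regime

/-! ### Calls of the strongly convex method -/

section Call

variable {n : ℕ} {P : Problem n} {A : Params n} {M d β CD U ε : ℝ}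

theorem Regime.M_pos (R : Regime P A M d β CD U ε) : 0 < M := by
  linarith [R.dz_ge, R.dz_le]

theorem Regime.Dz_pos (R : Regime P A M d β CD U ε) : 0 < Dz P A ε := by
  linarith [R.dz_ge]

theorem Regime.Bf_pos (R : Regime P A M d β CD U ε) : 0 < Bf P A ε := R.β_pos.trans_le R.β_le

theorem Regime.x0_lev (R : Regime P A M d β CD U ε) (hγ : 1 < A.γ₁) :
    x0 P A ε ∈ P.levG (DL P A ε) := by
  have h1 := le_D0 R.dz_ge
  have h2 := D0_add_le_DL hγ R.dz_ge
  have h3 := sq_nonneg (R1 P A ε)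
  by_contra hcon
  apply hcon
  have : P.levG (P.g (x0 P A ε)) ⊆ P.levG (DL P A ε) := P.levG_mono (by linarith)
  apply this
  change P.gExt _ ≤ _
  unfold Problem.gExt Problem.g Problem.rg₂
  rw [EReal.coe_add]
  gcongr
  exact EReal.le_coe_toReal R.x0_mem.2

theorem Regime.norm_sub_le (R : Regime P A M d β CD U ε) {x y : EuclideanSpace ℝ (Fin n)}
    (hx : x ∈ P.levG (DL P A ε)) (hy : y ∈ P.levG (DL P A ε)) : ‖x - y‖ ≤ M := by
  rw [← dist_eq_norm]
  exact (Metric.dist_le_diam_of_mem R.bounded.2 hx hy).trans R.dg_le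

theorem Regime.one_le_factor (R : Regime P A M d β CD U ε) :
    1 + d * (1 + d) ≤ 1 + Dg P A ε * (1 + Dg P A ε) := by
  have := R.d_le_Dg
  have := R.d_pos
  have : 0 ≤ Dg P A ε := Metric.diam_nonneg
  gcongr

theorem Regime.Bf_le_Dtol (R : Regime P A M d β CD U ε) : Bf P A ε ≤ Dtol P A ε := by
  have h1 := R.one_le_factor
  have hd := R.d_pos
  have h2 : 1 ≤ 1 + Dg P A ε * (1 + Dg P A ε) := by nlinarith
  have h3 := le_max_left (Bf P A ε) (2 * Dz P A ε * Bf P A ε + 2 * Dz P A ε * Bf P A ε ^ 2)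
  have h4 := R.Bf_pos
  unfold Dtol
  nlinarith

theorem Regime.Dtol_pos (R : Regime P A M d β CD U ε) : 0 < Dtol P A ε :=
  R.Bf_pos.trans_le R.Bf_le_Dtol

theorem Regime.ε₁_pos (R : Regime P A M d β CD U ε) : 0 < ε₁ P A ε := by
  have := R.ε_pos
  have := R.Dtol_pos
  unfold ε₁
  positivity

theorem Regime.ε₁_le (R : Regime P A M d β CD U ε) : ε₁ P A ε ≤ ε ^ 2 / β := by
  have := R.β_pos
  have := R.β_le.trans R.Bf_le_Dtol
  unfold ε₁
  gcongr

theorem Regime.le_ε₁ (R : Regime P A M d β CD U ε) : ε ^ 2 / CD ≤ ε₁ P A ε := by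
  have := R.Dtol_pos
  have := R.Dtol_le
  unfold ε₁
  gcongr

theorem Regime.slack_le (R : Regime P A M d β CD U ε) :
    ε₁ P A ε ^ 2 / (2 * ε) ≤ ε ^ 3 / (2 * β ^ 2) := by
  have h0 := R.ε_pos
  have hβ := R.β_pos
  have h1 := pow_le_pow_left₀ R.ε₁_pos.le R.ε₁_le 2
  calc ε₁ P A ε ^ 2 / (2 * ε) ≤ (ε ^ 2 / β) ^ 2 / (2 * ε) := by gcongr
    _ = ε ^ 3 / (2 * β ^ 2) := by field_simp

theorem Regime.ε₂_nonneg (R : Regime P A M d β CD U ε) : 0 ≤ ε₂ P A ε := by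
  have := R.ε_pos
  have := R.Dtol_pos
  have := R.Bf_pos
  unfold ε₂
  positivity

theorem Regime.ε₂_le (R : Regime P A M d β CD U ε) : ε₂ P A ε ≤ ε := by
  unfold ε₂
  rw [div_le_iff₀ R.Dtol_pos, mul_comm]
  have := R.ε_pos
  have := R.Bf_le_Dtol
  gcongr

/-- The factor `1 + D_g (1 + D_g)` in the tolerance constant makes the complementarity error a
fraction of `ε` strictly below one, uniformly in `ε`, because `D_g ≥ d > 0`. This margin pays for
all other errors when a value is rejected. -/
theorem Regime.ε₃_le (R : Regime P A M d β CD U ε) :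
    ε₃ P A ε ≤ 1 / (1 + d * (1 + d)) * ε := by
  have hε := R.ε_pos
  have hB := R.Bf_pos
  have hz := R.Dz_pos
  have hd := R.d_pos
  have h1 := R.one_le_factor
  set B := 2 * Dz P A ε * Bf P A ε + 2 * Dz P A ε * Bf P A ε ^ 2 with hBdef
  have hB0 : 0 ≤ B := by positivity
  have h2 : (1 + d * (1 + d)) * B ≤ Dtol P A ε := by
    unfold Dtol
    exact mul_le_mul h1 (le_max_right _ _) hB0 (le_trans (by positivity) h1)
  unfold ε₃
  rw [div_le_iff₀ R.Dtol_pos, ← hBdef]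
  calc B * ε = 1 / (1 + d * (1 + d)) * ε * ((1 + d * (1 + d)) * B) := by
        field_simp
    _ ≤ 1 / (1 + d * (1 + d)) * ε * Dtol P A ε := by gcongr

/-- The regularized Lagrangian `g + (ε / 2) ‖· - x⁰‖² + z f`. -/
noncomputable def lagr (P : Problem n) (A : Params n) (ε z : ℝ)
    (x : EuclideanSpace ℝ (Fin n)) : ℝ :=
  P.g x + ε / 2 * ‖x - x0 P A ε‖ ^ 2 + z * P.f x

/-- What a call of the strongly convex method with multiplier `z` guarantees for its output. -/
structure ApproxMin (P : Problem n) (A : Params n) (ε z : ℝ)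
    (x : EuclideanSpace ℝ (Fin n)) : Prop where
  mem : x ∈ P.X
  lev : x ∈ P.levG (DL P A ε)
  opt : ∀ w ∈ P.X,
    lagr P A ε z x + ε / 2 * ‖w - x‖ ^ 2 ≤ lagr P A ε z w + ε₁ P A ε * ‖w - x‖

/-- Maximizing `ε₁ t - (ε/2) t²` over `t` turns the stationarity error into an additive one that no
longer depends on the distance. -/
theorem lagr_le_of_opt {z : ℝ} (hε : 0 < ε) {x w : EuclideanSpace ℝ (Fin n)}
    (h : lagr P A ε z x + ε / 2 * ‖w - x‖ ^ 2 ≤ lagr P A ε z w + ε₁ P A ε * ‖w - x‖) :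
    lagr P A ε z x ≤ lagr P A ε z w + ε₁ P A ε ^ 2 / (2 * ε) := by
  have h1 : ε₁ P A ε * ‖w - x‖ - ε / 2 * ‖w - x‖ ^ 2 ≤ ε₁ P A ε ^ 2 / (2 * ε) := by
    rw [le_div_iff₀ (by positivity)]
    nlinarith [sq_nonneg (ε₁ P A ε - ε * ‖w - x‖)]
  linarith

theorem Regime.g_x0_le (R : Regime P A M d β CD U ε) (hΔ : 0 < A.Δ₁) :
    P.g (x0 P A ε) ≤ P.gStar + M * A.Δ₁ + ε := by
  have h1 : Dz P A ε * A.Δ₁ = P.g (x0 P A ε) - P.g (xg P A ε) + 1 := by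
    unfold Dz
    field_simp
  have h2 : Dz P A ε * A.Δ₁ ≤ M * A.Δ₁ := by
    have := R.dz_le
    gcongr
  linarith [R.g_xg_le]

theorem exp_neg_mul_abs_log {ε : ℝ} (hε : 0 < ε) (hε1 : ε ≤ 1) (k : ℕ) :
    Real.exp (-(k * |Real.log ε|)) = ε ^ k := by
  rw [abs_of_nonpos (Real.log_nonpos hε.le hε1), mul_neg, neg_neg, ← Real.log_pow,
    Real.exp_log (by positivity)]

theorem one_le_abs_log {ε : ℝ} (hε : 0 < ε) (h : ε ≤ Real.exp (-1)) : 1 ≤ |Real.log ε| := by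
  have h1 := Real.log_le_log hε h
  rw [Real.log_exp] at h1
  rw [abs_of_nonpos (by linarith)]
  linarith

/-- From `1 - u ≤ exp (-u)`: a multiple `k` of `√(b/ε) |log ε|` iterations yields a factor `ε ^ k`.
-/
theorem one_sub_sqrt_pow_le {b ε : ℝ} {N : ℕ} (k : ℕ) (hε : 0 < ε) (hε1 : ε ≤ 1)
    (h1 : ε ≤ b) (hN : k * (√(b / ε) * |Real.log ε|) ≤ N) :
    (1 - √(ε / b)) ^ N ≤ ε ^ k := by
  have hbp : 0 < b := hε.trans_le h1
  have h2 : √(ε / b) ≤ 1 := sqrt_div_le_one h1 hbp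
  rw [← exp_neg_mul_abs_log hε hε1]
  calc (1 - √(ε / b)) ^ N ≤ Real.exp (-√(ε / b)) ^ N := by
        gcongr
        exact Real.one_sub_le_exp_neg _
    _ = Real.exp (-(N * √(ε / b))) := by rw [← Real.exp_nat_mul]; ring_nf
    _ ≤ Real.exp (-(k * |Real.log ε|)) := by
        apply Real.exp_le_exp.2
        apply neg_le_neg
        have e : √(b / ε) * √(ε / b) = 1 := by
          rw [← Real.sqrt_mul (by positivity), div_mul_div_comm, mul_comm b ε,
            div_self (by positivity), Real.sqrt_one]
        calc k * |Real.log ε| = k * (√(b / ε) * |Real.log ε|) * √(ε / b) := by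
              linear_combination (-(k : ℝ) * |Real.log ε|) * e
          _ ≤ N * √(ε / b) := by gcongr

theorem norm_sub_sq_le_two_mul (y x a : EuclideanSpace ℝ (Fin n)) :
    ‖y - x‖ ^ 2 ≤ 2 * ‖y - a‖ ^ 2 + 2 * ‖x - a‖ ^ 2 := by
  have h1 := parallelogram_law_with_norm ℝ (y - a) (x - a)
  rw [sub_sub_sub_cancel_right] at h1
  have h2 := mul_self_nonneg ‖y - a + (x - a)‖
  linarith

-- The iteration count depends on neither the multiplier nor the starting point as long as the
-- latter is within `M` of `x⁰`; membership of the output in the level set is what keeps later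
-- starting points in that range.
set_option maxHeartbeats 1600000 in
theorem exists_call (hP : P.Basic A.Lf A.Lg A.lf₂) (hA : A.Admissible P) {M d β CD U : ℝ}
    (hM : 0 < M) (hd : 0 < d) (hβ : 0 < β) (hCD : 0 < CD) :
    ∃ C : ℝ, 0 ≤ C ∧ ∀ᶠ ε in 𝓝[>] (0 : ℝ), Regime P A M d β CD U ε →
      ∃ T : ℕ, (T : ℝ) ≤ C * (√(Lφ P A ε / ε) * |Real.log ε|) ∧
        ∀ z y, 0 ≤ z → z ≤ 2 * Dz P A ε → ‖y - x0 P A ε‖ ≤ M →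
          (apgCall P A ε z y).cost ≤ T ∧ ApproxMin P A ε z (apgCall P A ε z y).val := by
  have hγ := hA.γ₁_gt
  have hLm := hA.Lmin_pos
  have hΔ := hA.Δ₁_pos
  set Λ : ℝ := A.Lg + 2 * M * A.Lf + 1 with hΛ
  have hΛ0 : 0 < Λ := by positivity
  -- Since `L_φ ≥ 1`, the multiple `K L_φ` dominates both `L_min` and `γ₁ L_φ`, while staying
  -- proportional to `L_φ` as the final bound requires.
  set K : ℝ := max A.Lmin A.γ₁ with hK
  have hK1 : A.γ₁ ≤ K := le_max_right _ _
  have hK0 : 1 < K := hγ.trans_le hK1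
  obtain ⟨J, hJ⟩ := pow_unbounded_of_one_lt (Λ / A.Lmin) hγ
  have hJ' : Λ ≤ A.γ₁ ^ J * A.Lmin := ((div_lt_iff₀ hLm).1 hJ).le
  -- Comparing the Lagrangian with its value at `x⁰` bounds `(ε/2)‖x - x⁰‖²` by `C₁`, for every
  -- candidate output `x`; hence `‖y - x‖² = O(1/ε)`.
  set C₁ : ℝ := M * A.Δ₁ + 1 + 2 * M + K * Λ / 2 * M ^ 2 with hC₁
  have hC₁0 : 0 < C₁ := by positivity
  set C₃ : ℝ := (Λ + K * Λ) ^ 2 * (2 / A.Lmin * (K * Λ / 2 * (2 * M ^ 2 + 4 * C₁))) with hC₃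
  have hC₃0 : 0 < C₃ := by positivity
  refine ⟨2 * (J + 1) + (6 * √K + 2) * (4 * (J + 1) + 1) + 1, by positivity, ?_⟩
  filter_upwards [eventually_pos_lt hLm, eventually_pos_lt (Real.exp_pos (-1)),
    eventually_pos_lt (by positivity : 0 < 1 / (C₃ * CD ^ 2)),
    eventually_pos_lt (by positivity : 0 < d ^ 2 / (2 * M + 1 / (2 * β ^ 2)))]
    with ε k1 k2 k3 k4 R
  have hε := R.ε_pos
  have hε1 := R.ε_le_one
  have hlog := one_le_abs_log hε k2.2.le
  have hLφ1 := one_le_Lφ R.dz_ge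
  have hLφΛ : Lφ P A ε ≤ Λ := by
    have := R.dz_le
    unfold Lφ
    rw [hΛ]
    gcongr
  set Λe := Lφ P A ε with hΛe
  set lb := K * Λe with hlb
  have hlb1 : ε ≤ lb := hε1.trans (one_le_mul_of_one_le_of_one_le hK0.le hLφ1)
  have hlb0 : 0 < lb := by positivity
  set S := √(Λe / ε) * |Real.log ε| with hS
  have hsq1 : 1 ≤ √(Λe / ε) := by
    rw [Real.one_le_sqrt, one_le_div hε]
    linarith
  have hS1 : 1 ≤ S := one_le_mul_of_one_le_of_one_le hsq1 hlog
  have hsK : √(lb / ε) * |Real.log ε| = √K * S := by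
    rw [hlb, mul_div_assoc, Real.sqrt_mul (by positivity)]
    ring
  -- Exponent `6`: one power of `ε` is lost to `‖y - x‖² = O(1/ε)`, four are needed for `ε₁²`, and
  -- the fifth beats the constants.
  set N := ⌈6 * (√(lb / ε) * |Real.log ε|)⌉₊ with hN
  have hN1 : 6 * (√(lb / ε) * |Real.log ε|) ≤ N := Nat.le_ceil _
  have hN2 : (N : ℝ) < 6 * (√(lb / ε) * |Real.log ε|) + 1 :=
    Nat.ceil_lt_add_one (by positivity)
  have hqN : (1 - √(ε / lb)) ^ (N + 1) ≤ ε ^ 6 := by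
    apply one_sub_sqrt_pow_le 6 hε hε1 hlb1
    push_cast
    linarith
  have hq0 : 0 ≤ 1 - √(ε / lb) := sub_nonneg.2 (sqrt_div_le_one hlb1 hlb0)
  refine ⟨2 * (J + 1) + (N + 1) * (4 * (J + 1) + 1) + 1, ?_, fun z y hz hz2 hy => ?_⟩
  · push_cast
    rw [hsK] at hN2
    have e1 : (N : ℝ) + 1 ≤ (6 * √K + 2) * S := by linarith
    have e2 : ((N : ℝ) + 1) * (4 * (J + 1) + 1) ≤ (6 * √K + 2) * S * (4 * (J + 1) + 1) := by
      gcongr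
    have e3 : (2 * ((J : ℝ) + 1) + 1) * 1 ≤ (2 * (J + 1) + 1) * S := by gcongr
    linarith
  · have hmod := hP.compositeModel_regularized hε.le hz (x0 P A ε) (L := Λe) (by
      have : z * A.Lf ≤ 2 * Dz P A ε * A.Lf := by gcongr
      rw [hΛe]
      unfold Lφ
      linarith)
    have hzM : z ≤ 2 * M := hz2.trans (by linarith [R.dz_le])
    have hlagr : ∀ x, P.g₁ x + ε / 2 * ‖x - x0 P A ε‖ ^ 2 + z * P.f₁ x +
        (P.rg₂ x + z * P.rf₂ x) = lagr P A ε z x := fun x => by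
      unfold lagr Problem.f Problem.g
      ring
    obtain ⟨a1, a2⟩ := hmod.apgMu_spec (Lmin := A.Lmin) (Lbar := lb) (γ₁ := A.γ₁) (γ₂ := A.γ₂)
      (ε := ε₁ P A ε) (y₀ := y) (J := J) (N := N) hε k1.2.le (by linarith) hγ hA.γ₂_ge
      (by
        calc A.Lmin ≤ K * 1 := by rw [mul_one]; exact le_max_left _ _
          _ ≤ lb := by rw [hlb]; gcongr)
      (by rw [hlb]; gcongr) (hLφΛ.trans hJ') R.ε₁_pos.le (by
        intro x hx hle
        have b1 := hle _ R.x0_mem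
        rw [hlagr, hlagr] at b1
        unfold lagr at b1
        rw [sub_self, norm_zero] at b1
        have b2 := hP.gStar_le hx
        have b3 := hP.fStar_le hx
        have b4 := R.g_x0_le hΔ
        have b5 : z * (P.f (x0 P A ε) - P.f x) ≤ 2 * M * ε := by
          have : P.f (x0 P A ε) - P.f x ≤ ε := by linarith [R.f_x0_le]
          calc z * (P.f (x0 P A ε) - P.f x) ≤ z * ε := by gcongr
            _ ≤ 2 * M * ε := by gcongr
        have b6 : lb / 2 * ‖y - x0 P A ε‖ ^ 2 ≤ K * Λ / 2 * M ^ 2 := by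
          rw [hlb]; gcongr
        have b7 : ε / 2 * ‖x - x0 P A ε‖ ^ 2 ≤ C₁ := by
          have : 2 * M * ε ≤ 2 * M * 1 := by gcongr
          rw [hC₁]
          linarith
        have b8 : ‖y - x‖ ^ 2 ≤ (2 * M ^ 2 + 4 * C₁) / ε := by
          have c2 : ‖y - x‖ ^ 2 ≤ 2 * M ^ 2 + 2 * ‖x - x0 P A ε‖ ^ 2 := by
            refine (norm_sub_sq_le_two_mul y x (x0 P A ε)).trans ?_
            gcongr
          rw [le_div_iff₀ hε]
          have c5 : ‖y - x‖ ^ 2 * ε ≤ (2 * M ^ 2 + 2 * ‖x - x0 P A ε‖ ^ 2) * ε := by gcongr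
          have c6 : 2 * M ^ 2 * ε ≤ 2 * M ^ 2 * 1 := by gcongr
          linarith
        calc (Λe + lb) ^ 2 * (2 / A.Lmin * ((1 - √(ε / lb)) ^ (N + 1) * (lb / 2 * ‖y - x‖ ^ 2)))
            ≤ (Λ + K * Λ) ^ 2 * (2 / A.Lmin * (ε ^ 6 *
                (K * Λ / 2 * ((2 * M ^ 2 + 4 * C₁) / ε)))) := by
              rw [hlb]; gcongr
          _ = C₃ * ε ^ 5 := by rw [hC₃]; field_simp
          _ ≤ (ε ^ 2 / CD) ^ 2 := by
              have := (lt_div_iff₀ (by positivity)).1 k3.2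
              rw [div_pow, le_div_iff₀ (by positivity)]
              calc C₃ * ε ^ 5 * CD ^ 2 = ε ^ 4 * (ε * (C₃ * CD ^ 2)) := by ring
                _ ≤ ε ^ 4 * 1 := by gcongr
                _ = (ε ^ 2) ^ 2 := by ring
          _ ≤ ε₁ P A ε ^ 2 := by
              have := R.le_ε₁
              gcongr)
    have hmem : (apgCall P A ε z y).val ∈ P.X := CompositeModel.mem_of_nearStationary a1
    have hopt : ∀ w ∈ P.X, lagr P A ε z (apgCall P A ε z y).val +
        ε / 2 * ‖w - (apgCall P A ε z y).val‖ ^ 2 ≤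
        lagr P A ε z w + ε₁ P A ε * ‖w - (apgCall P A ε z y).val‖ := fun w hw => by
      have := hmod.le_of_nearStationary R.ε₁_pos.le a1 hw
      rw [hlagr, hlagr] at this
      exact this
    refine ⟨?_, hmem, ?_, hopt⟩
    · change _ + 1 ≤ _
      push_cast
      gcongr
    -- As `f(x⁰) ≤ f^* + ε`, the multiplier term can raise `g` above `g(x⁰)` only by `O(ε)`, and the
    -- margin `R₁² ≥ d²` between the two level sets absorbs this.
    · rw [hP.mem_levG hmem]
      set x := (apgCall P A ε z y).val
      have h1 := lagr_le_of_opt hε (hopt _ R.x0_mem)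
      have h2 := R.slack_le
      unfold lagr at h1
      rw [sub_self, norm_zero] at h1
      have h3 := hP.fStar_le hmem
      have h5 : z * (P.f (x0 P A ε) - P.f x) ≤ 2 * M * ε := by
        have : P.f (x0 P A ε) - P.f x ≤ ε := by linarith [R.f_x0_le]
        calc z * (P.f (x0 P A ε) - P.f x) ≤ z * ε := by gcongr
          _ ≤ 2 * M * ε := by gcongr
      have h6 : ε ^ 3 / (2 * β ^ 2) ≤ 1 / (2 * β ^ 2) * ε := by
        rw [div_eq_inv_mul, one_div]
        gcongr
        calc ε ^ 3 ≤ ε ^ 1 := pow_le_pow_of_le_one hε.le hε1 (by norm_num)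
          _ = ε := pow_one _
      have h7 := (lt_div_iff₀ (by positivity)).1 k4.2
      have h8 : d ^ 2 ≤ R1 P A ε ^ 2 := by
        have := R.d_le_R1
        gcongr
      have h9 := D0_add_le_DL hγ R.dz_ge
      have h10 := le_D0 R.dz_ge
      have h11 : 0 ≤ ε / 2 * ‖x - x0 P A ε‖ ^ 2 := by positivity
      linarith

end Call

/-! ### Interval search and bisection -/

section Dual

variable {n : ℕ} {P : Problem n} {A : Params n} {M d β CD U ε : ℝ}

/-- Two approximate minimizers for close multipliers, one of which violates the constraint, show
that the other one nearly satisfies complementarity. -/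
theorem Regime.complementarity (R : Regime P A M d β CD U ε)
    (hP : P.Basic A.Lf A.Lg A.lf₂) {a b c : ℝ} {xa xb : EuclideanSpace ℝ (Fin n)}
    (ha : ApproxMin P A ε a xa) (hb : ApproxMin P A ε b xb) (hab : a ≤ b)
    (hba : b - a ≤ ε₄ P A ε) (hb0 : 0 ≤ b) (hbz : b ≤ 2 * Dz P A ε)
    (hfa : ε₂ P A ε < P.f xa - c) (hfb : P.f xb - c ≤ ε₂ P A ε) :
    |b * (P.f xb - c)| ≤ ε₃ P A ε := by
  have hε := R.ε_pos
  have hD := R.Dtol_pos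
  have hB := R.Bf_pos
  have hz := R.Dz_pos
  set B := Bf P A ε with hBdef
  set t := ε / Dtol P A ε with ht
  have ht0 : 0 < t := by positivity
  have e2 : ε₂ P A ε = B * t := by unfold ε₂; rw [ht]; ring
  have e3 : ε₃ P A ε = 2 * Dz P A ε * ((B + B ^ 2) * t) := by unfold ε₃; rw [ht]; ring
  have e1 : ε₁ P A ε = ε * t := by unfold ε₁; rw [ht]; ring
  have e4 : ε₄ P A ε = ε * t := by unfold ε₄; rw [ht]; ring
  have h1 := ha.opt xb hb.mem
  have h2 := hb.opt xa ha.mem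
  have h3 : P.f xa - P.f xb ≤ B * ‖xb - xa‖ := by
    have h4 := hP.f_sub_le ha.mem hb.mem
    rw [norm_sub_rev xa xb] at h4
    refine h4.trans ?_
    gcongr
    exact R.grad_le _ ha.lev
  rw [norm_sub_rev xa xb] at h2
  set D := ‖xb - xa‖ with hDdef
  have hD0 : 0 ≤ D := norm_nonneg _
  unfold lagr at h1 h2
  have h5 : (b - a) * (P.f xa - P.f xb) ≤ ε * t * (B * D) := by
    calc (b - a) * (P.f xa - P.f xb) ≤ (b - a) * (B * D) := by
          have : 0 ≤ b - a := by linarith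
          gcongr
      _ ≤ ε * t * (B * D) := by rw [← e4]; gcongr
  rw [e1] at h1 h2
  -- Adding the two optimality inequalities leaves `ε D² ≤ (b - a)(f xa - f xb) + 2 ε₁ D`, and both
  -- terms on the right are linear in `D`.
  have h6 : D ≤ (B + 2) * t := by
    rcases hD0.eq_or_lt with h | h
    · rw [← h]; positivity
    · have h7 : ε * D * D ≤ ε * D * ((B + 2) * t) := by
        linarith
      exact le_of_mul_le_mul_left h7 (by positivity)
  have h8 : B * D ≤ B * ((B + 2) * t) := by gcongr
  have h9 : -((B + B ^ 2) * t) ≤ P.f xb - c := by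
    rw [e2] at hfa
    linarith
  rw [abs_le, e3]
  constructor
  · have : b * ((B + B ^ 2) * t) ≤ 2 * Dz P A ε * ((B + B ^ 2) * t) := by gcongr
    have h10 := mul_le_mul_of_nonneg_left h9 hb0
    linarith
  · have h10 : b * (P.f xb - c) ≤ b * ((B + B ^ 2) * t) := by
      apply mul_le_mul_of_nonneg_left _ hb0
      rw [e2] at hfb
      have : 0 ≤ B ^ 2 * t := by positivity
      linarith
    refine h10.trans ?_
    gcongr

/-- The multiplier interval lies in `[0, 2 D_z]` and its point belongs to its right end. -/
structure MultInterval.Valid (P : Problem n) (A : Params n) (ε : ℝ) (Z : MultInterval n) :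
    Prop where
  a_nonneg : 0 ≤ Z.a
  a_le_b : Z.a ≤ Z.b
  b_le : Z.b ≤ 2 * Dz P A ε
  approx : ApproxMin P A ε Z.b Z.xb

/-- The left end of an interval is zero or too small a multiplier for the constraint `f ≤ c`, or
the right end is accepted. -/
def LeftEnd (P : Problem n) (A : Params n) (ε c a b : ℝ) (xb : EuclideanSpace ℝ (Fin n)) : Prop :=
  a = 0 ∨ (∃ xa, ApproxMin P A ε a xa ∧ ε₂ P A ε < P.f xa - c) ∨
    (a = b ∧ |b * (P.f xb - c)| ≤ ε₃ P A ε)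

/-- The multiplier interval brackets a multiplier for the constraint `f ≤ c`. -/
def MultInterval.Brackets (P : Problem n) (A : Params n) (ε c : ℝ) (Z : MultInterval n) : Prop :=
  P.f Z.xb - c ≤ ε₂ P A ε ∧ LeftEnd P A ε c Z.a Z.b Z.xb

/-- The guarantee of all calls of the strongly convex method, at a cost of at most `T`. -/
def CallSpec (P : Problem n) (A : Params n) (M ε : ℝ) (T : ℕ) : Prop :=
  ∀ z y, 0 ≤ z → z ≤ 2 * Dz P A ε → ‖y - x0 P A ε‖ ≤ M →
    (apgCall P A ε z y).cost ≤ T ∧ ApproxMin P A ε z (apgCall P A ε z y).val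

theorem Regime.near (R : Regime P A M d β CD U ε) (hγ : 1 < A.γ₁) {z : ℝ}
    {x : EuclideanSpace ℝ (Fin n)} (hx : ApproxMin P A ε z x) : ‖x - x0 P A ε‖ ≤ M :=
  R.norm_sub_le hx.lev (R.x0_lev hγ)

/-- A multiplier exceeding `D_z` is large enough for a regular constraint. -/
theorem Regime.le_ε₂_of_large (R : Regime P A M d β CD U ε) (hP : P.Basic A.Lf A.Lg A.lf₂)
    (hA : A.Admissible P) (hsm : ε + ε ^ 3 / (2 * β ^ 2) ≤ 1) {b c : ℝ}
    {x : EuclideanSpace ℝ (Fin n)} (hx : ApproxMin P A ε b x) (hb : Dz P A ε < b)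
    (hc : P.f (x0 P A ε) - c < -A.Δ₁) : P.f x - c ≤ ε₂ P A ε := by
  have hε := R.ε_pos
  have hz := R.Dz_pos
  have h1 := lagr_le_of_opt hε (hx.opt _ R.x0_mem)
  have h2 := R.slack_le
  unfold lagr at h1
  rw [sub_self, norm_zero] at h1
  have h3 := hP.gStar_le hx.mem
  have h4 := R.g_xg_le
  have h5 : Dz P A ε * A.Δ₁ = P.g (x0 P A ε) - P.g (xg P A ε) + 1 := by
    have := hA.Δ₁_pos
    unfold Dz
    field_simp
  have h6 : Dz P A ε * A.Δ₁ < b * A.Δ₁ := mul_lt_mul_of_pos_right hb hA.Δ₁_pos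
  have h7 : 0 ≤ ε / 2 * ‖x - x0 P A ε‖ ^ 2 := by positivity
  have h8 : b * (P.f (x0 P A ε) - c) ≤ b * -A.Δ₁ :=
    mul_le_mul_of_nonneg_left hc.le (by linarith)
  -- By the definition of `D_z`, the term `b Δ₁` exceeds `g(x⁰) - g(x̃_g) + 1`; the unit covers
  -- `g(x̃_g) - g^* ≤ ε` and the slack, by `hsm`.
  have h9 : b * (P.f x - c) < 0 := by linarith
  have h10 : P.f x - c < 0 := by
    by_contra! hcon
    have : 0 ≤ b * (P.f x - c) := mul_nonneg (by linarith) hcon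
    linarith
  exact h10.le.trans R.ε₂_nonneg

/-- The right end is `2 ^ k` and doubling requires it to be at most `D_z ≤ M`, so `m` doublings
suffice. Validity and cost hold for every `c`; only bracketing needs regularity, because the search
is also run for a value that the main loop may never process. -/
theorem Regime.intV_spec (R : Regime P A M d β CD U ε) (hP : P.Basic A.Lf A.Lg A.lf₂)
    (hA : A.Admissible P) (hsm : ε + ε ^ 3 / (2 * β ^ 2) ≤ 1) {T m : ℕ}
    (hT : CallSpec P A M ε T) (hm : M < 2 ^ m) (c : ℝ) {x : EuclideanSpace ℝ (Fin n)}
    (hx : ‖x - x0 P A ε‖ ≤ M) :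
    (intV P A ε c 1 x).val.Valid P A ε ∧ (intV P A ε c 1 x).cost ≤ (m + 2) * T ∧
      (P.f (x0 P A ε) - c < -A.Δ₁ → (intV P A ε c 1 x).val.Brackets P A ε c) := by
  have hγ := hA.γ₁_gt
  have hz := R.Dz_pos
  have he2 := R.ε₂_nonneg
  obtain ⟨t1, o1⟩ := hT 0 x le_rfl (by linarith) hx
  unfold intV
  set r₀ := apgCall P A ε 0 x with hr₀
  by_cases hif : max (P.f r₀.val - c) 0 ≤ ε₂ P A ε
  · simp only [hif, if_true]
    refine ⟨⟨le_rfl, le_rfl, by simpa using hz.le, o1⟩, ?_, fun _ =>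
      ⟨(le_max_left _ _).trans hif, Or.inl rfl⟩⟩
    calc r₀.cost ≤ T := t1
      _ = 1 * T := (one_mul _).symm
      _ ≤ (m + 2) * T := by
        gcongr
        exact le_add_left (by norm_num)
  · simp only [hif, if_false]
    have hv0 : ε₂ P A ε < P.f r₀.val - c := by
      rcases lt_max_iff.1 (not_le.1 hif) with h | h
      · exact h
      · exact absurd h (not_lt.2 he2)
    obtain ⟨t2, o2⟩ := hT 1 r₀.val zero_le_one R.dz_ge (R.near hγ o1)
    set r₁ := apgCall P A ε 1 r₀.val with hr₁
    obtain ⟨⟨k, -, h1, h2, h3, h4, h5, h6⟩, hex, hcost⟩ := whileLoop_spec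
      (cond := fun s : MultInterval n =>
        max (P.f s.xb - c) 0 > ε₂ P A ε ∧ s.b ≤ Dz P A ε)
      (body := fun s : MultInterval n =>
        ⟨{ a := s.b, b := 2 * s.b, xb := (apgCall P A ε (2 * s.b) s.xb).val },
          (apgCall P A ε (2 * s.b) s.xb).cost⟩)
      (s := { a := 0, b := 1, xb := r₁.val })
      (fun k s => s.b = 2 ^ k ∧ 0 ≤ s.a ∧ s.a ≤ s.b ∧ s.b ≤ 2 * Dz P A ε ∧
        ApproxMin P A ε s.b s.xb ∧
        ∃ xa, ApproxMin P A ε s.a xa ∧ ε₂ P A ε < P.f xa - c)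
      m T ⟨by simp, le_rfl, zero_le_one, R.dz_ge, o2, _, o1, hv0⟩ (by
        rintro k s ⟨h1, h2, h3, h4, h5, h6⟩ ⟨h7, h8⟩
        obtain ⟨t3, o3⟩ := hT (2 * s.b) s.xb (by linarith) (by linarith) (R.near hγ h5)
        have hv : ε₂ P A ε < P.f s.xb - c := by
          rcases lt_max_iff.1 h7 with h | h
          · exact h
          · exact absurd h (not_lt.2 he2)
        refine ⟨?_, ⟨?_, ?_, ?_, ?_, o3, s.xb, h5, hv⟩, t3⟩
        · have : (2 : ℝ) ^ k < 2 ^ m := by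
            rw [← h1]
            exact (h8.trans R.dz_le).trans_lt hm
          exact (pow_lt_pow_iff_right₀ (by norm_num)).1 this
        · change 2 * s.b = _
          rw [h1, pow_succ]; ring
        · change 0 ≤ s.b
          linarith
        · change s.b ≤ 2 * s.b
          linarith
        · change 2 * s.b ≤ 2 * Dz P A ε
          linarith)
    change ¬ (max (P.f (intVLoop P A ε c { a := 0, b := 1, xb := r₁.val }).val.xb - c) 0 >
      ε₂ P A ε ∧ (intVLoop P A ε c { a := 0, b := 1, xb := r₁.val }).val.b ≤ Dz P A ε) at hex
    change (intVLoop P A ε c { a := 0, b := 1, xb := r₁.val }).cost ≤ _ at hcost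
    change (intVLoop P A ε c { a := 0, b := 1, xb := r₁.val }).val.b = _ at h1
    change 0 ≤ (intVLoop P A ε c { a := 0, b := 1, xb := r₁.val }).val.a at h2
    change (intVLoop P A ε c { a := 0, b := 1, xb := r₁.val }).val.a ≤
      (intVLoop P A ε c { a := 0, b := 1, xb := r₁.val }).val.b at h3
    change (intVLoop P A ε c { a := 0, b := 1, xb := r₁.val }).val.b ≤ _ at h4
    change ApproxMin P A ε (intVLoop P A ε c { a := 0, b := 1, xb := r₁.val }).val.b
      (intVLoop P A ε c { a := 0, b := 1, xb := r₁.val }).val.xb at h5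
    change ∃ xa, ApproxMin P A ε (intVLoop P A ε c { a := 0, b := 1, xb := r₁.val }).val.a xa ∧ _
      at h6
    set r₂ := intVLoop P A ε c { a := 0, b := 1, xb := r₁.val } with hr₂
    have hbr : P.f (x0 P A ε) - c < -A.Δ₁ → P.f r₂.val.xb - c ≤ ε₂ P A ε := fun hc => by
      by_contra! hcon
      have hb : Dz P A ε < r₂.val.b := by
        by_contra! hb
        exact hex ⟨lt_max_of_lt_left hcon, hb⟩
      exact absurd (R.le_ε₂_of_large hP hA hsm h5 hb hc) (not_le.2 hcon)
    refine ⟨?_, ?_, fun hc => ?_⟩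
    · split_ifs with hif2
      · exact ⟨h2.trans h3, le_rfl, h4, h5⟩
      · exact ⟨h2, h3, h4, h5⟩
    · calc r₀.cost + r₁.cost + r₂.cost ≤ T + T + m * T := by gcongr
        _ = (m + 2) * T := by ring
    · split_ifs with hif2
      · exact ⟨hbr hc, Or.inr (Or.inr ⟨rfl, hif2⟩)⟩
      · exact ⟨hbr hc, Or.inr (Or.inl h6)⟩

/-- On leaving with a short interval, the left end decides: if it is zero the multiplier is at most
`ε₄`, if its point violates the constraint then `Regime.complementarity` applies, and a singleton
was already accepted. -/
theorem Regime.bisec_spec (R : Regime P A M d β CD U ε) (hP : P.Basic A.Lf A.Lg A.lf₂)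
    (hA : A.Admissible P) {T N : ℕ} (hT : CallSpec P A M ε T)
    (hN : 2 * M / 2 ^ N ≤ ε₄ P A ε) {c : ℝ} {Z : MultInterval n} (hZ : Z.Valid P A ε)
    (hZc : Z.Brackets P A ε c) {x : EuclideanSpace ℝ (Fin n)} (hx : ‖x - x0 P A ε‖ ≤ M) :
    (∃ b, 0 ≤ b ∧ b ≤ 2 * Dz P A ε ∧ ApproxMin P A ε b (bisec P A ε c Z x).val ∧
      P.f (bisec P A ε c Z x).val - c ≤ ε₂ P A ε ∧
      (|b * (P.f (bisec P A ε c Z x).val - c)| ≤ ε₃ P A ε ∨ b ≤ ε₄ P A ε)) ∧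
      (bisec P A ε c Z x).cost ≤ N * T := by
  have hγ := hA.γ₁_gt
  have he2 := R.ε₂_nonneg
  have hM := R.M_pos
  have he4 : 0 < ε₄ P A ε := R.ε₁_pos
  obtain ⟨⟨k, -, h1, h2, h3, h4, h5, h6, h7, h8⟩, hex, hcost⟩ := whileLoop_spec
    (cond := fun s : BisecState n => s.done = false ∧ s.b - s.a > ε₄ P A ε)
    (body := bisecBody P A ε c)
    (s := { a := Z.a, b := Z.b, xb := Z.xb, x := x, done := false })
    (fun k s => 0 ≤ s.a ∧ s.a ≤ s.b ∧ s.b ≤ 2 * Dz P A ε ∧ ApproxMin P A ε s.b s.xb ∧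
      ‖s.x - x0 P A ε‖ ≤ M ∧ P.f s.xb - c ≤ ε₂ P A ε ∧
      (s.done = true → |s.b * (P.f s.xb - c)| ≤ ε₃ P A ε) ∧
      (s.done = false → LeftEnd P A ε c s.a s.b s.xb ∧ s.b - s.a ≤ 2 * M / 2 ^ k))
    N T ⟨hZ.a_nonneg, hZ.a_le_b, hZ.b_le, hZ.approx, hx, hZc.1, fun h => by simp at h,
      fun _ => ⟨hZc.2, by
        have := hZ.a_nonneg
        have := hZ.b_le
        have := R.dz_le
        simp only [pow_zero, div_one]
        linarith⟩⟩ (by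
      rintro k s ⟨h1, h2, h3, h4, h5, h6, h7, h8⟩ ⟨h9, h10⟩
      obtain ⟨h11, h12⟩ := h8 h9
      have hk : k < N := by
        by_contra! hcon
        have : 2 * M / 2 ^ k ≤ 2 * M / 2 ^ N := by
          gcongr
          norm_num
        linarith
      have hhalf : 2 * M / 2 ^ (k + 1) = (2 * M / 2 ^ k) / 2 := by
        rw [pow_succ]; field_simp
      have hleft : s.a = 0 ∨ ∃ xa, ApproxMin P A ε s.a xa ∧ ε₂ P A ε < P.f xa - c := by
        rcases h11 with h | h | h
        · exact Or.inl h
        · exact Or.inr h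
        · linarith [h.1]
      obtain ⟨t1, o1⟩ := hT ((s.a + s.b) / 2) s.x (by linarith) (by linarith) h5
      refine ⟨hk, ?_, t1⟩
      simp only [bisecBody]
      set r := apgCall P A ε ((s.a + s.b) / 2) s.x with hr
      by_cases hv : max (P.f r.val - c) 0 > ε₂ P A ε
      · have hv' : ε₂ P A ε < P.f r.val - c := by
          rcases lt_max_iff.1 hv with h | h
          · exact h
          · exact absurd h (not_lt.2 he2)
        simp only [hv, if_true]
        refine ⟨by linarith, by linarith, h3, h4, R.near hγ o1, h6, h7, fun _ =>
          ⟨Or.inr (Or.inl ⟨_, o1, hv'⟩), ?_⟩⟩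
        rw [hhalf]
        linarith
      · have hv' : P.f r.val - c ≤ ε₂ P A ε := (le_max_left _ _).trans (not_lt.1 hv)
        simp only [hv, if_false]
        split_ifs with hif
        · exact ⟨h1, by simp only; linarith, by simp only; linarith, o1, R.near hγ o1, hv',
            fun _ => hif, fun h => by simp at h⟩
        · refine ⟨h1, by simp only; linarith, by simp only; linarith, o1, R.near hγ o1, hv',
            fun h => by simp [h9] at h, fun _ => ⟨?_, ?_⟩⟩
          · rcases hleft with h | h
            · exact Or.inl h
            · exact Or.inr (Or.inl h)
          · simp only
            rw [hhalf]
            linarith)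
  refine ⟨⟨_, h1.trans h2, h3, h4, h6, ?_⟩, hcost⟩
  rcases Bool.eq_false_or_eq_true (whileLoop (fun s : BisecState n => s.done = false ∧
    s.b - s.a > ε₄ P A ε) (bisecBody P A ε c)
    { a := Z.a, b := Z.b, xb := Z.xb, x := x, done := false }).val.done with hd | hd
  · exact Or.inl (h7 hd)
  · have hlen := not_lt.1 fun h => hex ⟨hd, h⟩
    rcases (h8 hd).1 with h | ⟨xa, ha, hfa⟩ | h
    · right
      linarith
    · exact Or.inl (R.complementarity hP ha h4 h2 hlen (h1.trans h2) h3 hfa h6)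
    · exact Or.inl h.2

end Dual

/-! ### Nearly feasible points are near solutions of the lower-level problem -/

section Compactness

variable {n : ℕ} {P : Problem n} {Lf Lg lf₂ : ℝ≥0}

/-- Sublevel sets are closed by lower semicontinuity, so a bound along the sequence survives in the
limit and also keeps the limit in the domain. -/
theorem ProperLscConvex.toReal_le_of_tendsto {h : EuclideanSpace ℝ (Fin n) → EReal}
    (hh : ProperLscConvex h) {r : ℕ → EuclideanSpace ℝ (Fin n)} {a : EuclideanSpace ℝ (Fin n)}
    (hr : Tendsto r atTop (𝓝 a)) (hdom : ∀ k, h (r k) ≠ ⊤) {b : ℕ → ℝ} {B : ℝ}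
    (hb : Tendsto b atTop (𝓝 B)) (hle : ∀ k, (h (r k)).toReal ≤ b k) :
    h a ≠ ⊤ ∧ (h a).toReal ≤ B := by
  have key : ∀ y : ℝ, B < y → h a ≤ (y : EReal) := by
    intro y hy
    have hclosed : IsClosed (h ⁻¹' Set.Iic (y : EReal)) := hh.lsc.isClosed_preimage _
    refine hclosed.mem_of_tendsto hr ?_
    filter_upwards [hb.eventually_lt_const hy] with k hk
    calc h (r k) ≤ ((h (r k)).toReal : EReal) := EReal.le_coe_toReal (hdom k)
      _ ≤ (y : EReal) := by exact_mod_cast (hle k).trans hk.le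
  have htop : h a ≠ ⊤ := ne_top_of_le_ne_top (EReal.coe_ne_top _) (key (B + 1) (by linarith))
  refine ⟨htop, le_of_forall_gt_imp_ge_of_dense fun y hy => ?_⟩
  have := EReal.toReal_le_toReal (key y hy) (hh.ne_bot _) (EReal.coe_ne_top _)
  rwa [EReal.toReal_coe] at this

/-- Compactness: a sequence of counterexamples with tolerances tending to zero has a limit `(x, C)`
in which `x` solves the lower-level problem and `f x ≤ C`. Such an `x`, or a slight perturbation of
it, contradicts the choice of the sequence. -/
theorem Problem.Basic.exists_near_solution (hP : P.Basic Lf Lg lf₂) (K ρ cmax : ℝ) {δ : ℝ}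
    (a : EuclideanSpace ℝ (Fin n)) (hδ : 0 < δ) :
    ∀ᶠ ε in 𝓝[>] (0 : ℝ), ∀ c r, P.pStar < c → c ≤ cmax → r ∈ P.X → ‖r - a‖ ≤ ρ →
      P.f r ≤ c + ε → P.g r ≤ P.gStar + K * ε →
      ∃ w ∈ P.X ∩ P.lowerSolutions, P.f w ≤ c ∧ ‖w - r‖ ≤ δ := by
  by_contra hcon
  obtain ⟨e, he, hbad⟩ := exists_seq_forall_of_frequently (not_eventually.1 hcon)
  push Not at hbad
  choose c r h1 h2 h3 h4 h5 h6 h7 using hbad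
  have he0 : Tendsto e atTop (𝓝 0) := he.mono_right nhdsWithin_le_nhds
  have hcomp : IsCompact (Metric.closedBall a ρ ×ˢ Set.Icc P.pStar cmax) :=
    (isCompact_closedBall a ρ).prod isCompact_Icc
  obtain ⟨⟨x, C⟩, -, φ, hφ, hlim⟩ := hcomp.tendsto_subseq (x := fun k => (r k, c k)) fun k =>
    ⟨by simpa [dist_eq_norm] using h4 k, (h1 k).le, h2 k⟩
  have hx : Tendsto (fun k => r (φ k)) atTop (𝓝 x) :=
    (continuous_fst.tendsto _).comp hlim
  have hC : Tendsto (fun k => c (φ k)) atTop (𝓝 C) := (continuous_snd.tendsto _).comp hlim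
  have heφ : Tendsto (fun k => e (φ k)) atTop (𝓝 0) := he0.comp hφ.tendsto_atTop
  have hxn : Tendsto (fun k => ‖x - r (φ k)‖) atTop (𝓝 0) := by
    have := ((tendsto_const_nhds (x := x)).sub hx).norm
    simpa using this
  obtain ⟨g1, g2⟩ := hP.g₂_proper.toReal_le_of_tendsto hx (fun k => (h3 _).2)
    (b := fun k => P.gStar + K * e (φ k) - P.g₁ (r (φ k))) (B := P.gStar + K * 0 - P.g₁ x)
    ((tendsto_const_nhds.add (heφ.const_mul K)).sub
      ((hP.differentiable_g₁.continuous.tendsto x).comp hx)) (fun k => by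
      have := h6 (φ k)
      unfold Problem.g Problem.rg₂ at this
      linarith)
  -- Only membership of the limit in the domain of `f₂` is needed here; the Lipschitz condition
  -- bounds `f₂` along the sequence.
  obtain ⟨f1, -⟩ := hP.f₂_proper.toReal_le_of_tendsto hx (fun k => (h3 _).1)
    (b := fun _ => P.rf₂ (r 0) + lf₂ * (ρ + ρ)) tendsto_const_nhds (fun k => by
      have e1 := hP.rf₂_sub_le (h3 (φ k)) (h3 0)
      have e2 : ‖r (φ k) - r 0‖ ≤ ρ + ρ := by
        rw [← sub_sub_sub_cancel_right _ _ a]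
        exact (norm_sub_le _ _).trans (add_le_add (h4 _) (h4 _))
      have e3 : (lf₂ : ℝ) * ‖r (φ k) - r 0‖ ≤ lf₂ * (ρ + ρ) := by gcongr
      unfold Problem.rf₂ at e1 ⊢
      linarith)
  have hxX : x ∈ P.X := ⟨f1, g1⟩
  have hxg : P.g x ≤ P.gStar := by
    unfold Problem.g Problem.rg₂
    linarith
  have hxS : x ∈ P.X ∩ P.lowerSolutions := ⟨hxX, hP.mem_lowerSolutions hxX hxg⟩
  have hxf : P.f x ≤ C := by
    have hlim' : Tendsto (fun k => c (φ k) + e (φ k) +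
        (‖gradient P.f₁ x‖ + lf₂) * ‖x - r (φ k)‖) atTop
        (𝓝 (C + 0 + (‖gradient P.f₁ x‖ + lf₂) * 0)) :=
      (hC.add heφ).add (hxn.const_mul _)
    rw [mul_zero, add_zero, add_zero] at hlim'
    refine ge_of_tendsto' hlim' fun k => ?_
    have := hP.f_sub_le hxX (h3 (φ k))
    linarith [h5 (φ k)]
  -- At `C ≤ p^*` the limit itself satisfies `f x ≤ p^* < c` for every trial value of the sequence.
  rcases le_or_gt C P.pStar with hCp | hCp
  · obtain ⟨k, hk⟩ := (hxn.eventually_lt_const hδ).exists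
    exact absurd (h7 (φ k) x hxS (hxf.trans (hCp.trans (h1 _).le))) (not_lt.2 hk.le)
  -- For `C > p^*` the values `c` may approach `C` from below, so `x` is moved a little towards a
  -- lower-level solution with `f s < C`; convexity then makes `f w < C` strict.
  · obtain ⟨s, hs, hsC⟩ := hP.exists_f_lt hCp
    set t := min 1 (δ / (2 * (1 + ‖s - x‖))) with ht
    have ht0 : 0 < t := by positivity
    have ht1 : t ≤ 1 := min_le_left _ _
    have ht2 : t * ‖s - x‖ ≤ δ / 2 := by
      have e1 : t ≤ δ / (2 * (1 + ‖s - x‖)) := min_le_right _ _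
      rw [le_div_iff₀ (by positivity)] at e1
      nlinarith [norm_nonneg (s - x)]
    set w := (1 - t) • x + t • s with hw
    have hwX : w ∈ P.X := hP.convex_X hxX hs.1 (by linarith) ht0.le (by ring)
    have hwf := hP.convexOn_f.2 hxX hs.1 (by linarith : 0 ≤ 1 - t) ht0.le (by ring)
    have hwg := hP.convexOn_g.2 hxX hs.1 (by linarith : 0 ≤ 1 - t) ht0.le (by ring)
    simp only [smul_eq_mul] at hwf hwg
    rw [← hw] at hwf hwg
    have hwg' : P.g w ≤ P.gStar := by
      rw [hP.g_eq_gStar hs, hP.g_eq_gStar hxS] at hwg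
      linarith
    have hwC : P.f w < C := by nlinarith
    obtain ⟨k, hk1, hk2⟩ := ((hxn.eventually_lt_const (half_pos hδ)).and
      (hC.eventually_const_lt hwC)).exists
    have := h7 (φ k) w ⟨hwX, hP.mem_lowerSolutions hwX hwg'⟩ hk2.le
    have e1 : w - r (φ k) = t • (s - x) + (x - r (φ k)) := by rw [hw]; module
    have e2 : ‖w - r (φ k)‖ ≤ t * ‖s - x‖ + ‖x - r (φ k)‖ := by
      rw [e1]
      refine (norm_add_le _ _).trans ?_
      rw [norm_smul, Real.norm_eq_abs, abs_of_pos ht0]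
    linarith

end Compactness

/-! ### The main loop -/

section Main

variable {n : ℕ} {P : Problem n} {A : Params n} {M d β CD U ε : ℝ}

/-- The guarantee of the dual bisection for the constraint `f ≤ c`. -/
def DualSolution (P : Problem n) (A : Params n) (ε c : ℝ) (r : EuclideanSpace ℝ (Fin n)) : Prop :=
  ∃ b, 0 ≤ b ∧ b ≤ 2 * Dz P A ε ∧ ApproxMin P A ε b r ∧ P.f r - c ≤ ε₂ P A ε ∧
    (|b * (P.f r - c)| ≤ ε₃ P A ε ∨ b ≤ ε₄ P A ε)

/-- Every point `r ∈ X` close to optimality for the constraint `f ≤ c`, where `p^* < c ≤ cmax`,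
lies within `δ` of a lower-level solution satisfying the constraint. -/
def NearSolutions (P : Problem n) (K ρ cmax δ : ℝ) (a : EuclideanSpace ℝ (Fin n)) (ε : ℝ) : Prop :=
  ∀ c r, P.pStar < c → c ≤ cmax → r ∈ P.X → ‖r - a‖ ≤ ρ →
    P.f r ≤ c + ε → P.g r ≤ P.gStar + K * ε →
    ∃ w ∈ P.X ∩ P.lowerSolutions, P.f w ≤ c ∧ ‖w - r‖ ≤ δ

/-- A trial value is rejected only if it is at most `p^*`. -/
theorem Regime.le_pStar_of_reject (R : Regime P A M d β CD U ε)
    (hP : P.Basic A.Lf A.Lg A.lf₂) (hγ : 1 < A.γ₁) {θ cmax c : ℝ}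
    {a r : EuclideanSpace ℝ (Fin n)} (hθ : θ = 1 / (1 + d * (1 + d)))
    (ha : a ∈ P.X ∩ P.lowerSolutions)
    (hnear : NearSolutions P (M ^ 2 / 2 + 2) M cmax ((1 - θ) / (4 * M)) a ε)
    (hs1 : ε * (cmax - P.fStar) ≤ θ * β) (hs2 : ε ≤ (1 - θ) * β ^ 2 / 2) (hc : c ≤ cmax)
    (hr : DualSolution P A ε c r) (hrej : P.g (xg P A ε) + ε < P.g r) : c ≤ P.pStar := by
  by_contra! hcp
  obtain ⟨b, hb0, hbz, happ, hfr, hcompl⟩ := hr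
  have hε := R.ε_pos
  have hβ := R.β_pos
  have hd := R.d_pos
  have hM := R.M_pos
  have hθ0 : 0 < θ := by rw [hθ]; positivity
  have hθ1 : θ < 1 := by
    rw [hθ, div_lt_one (by positivity)]
    nlinarith
  have hslack : ε₁ P A ε ^ 2 / (2 * ε) ≤ ε * ((1 - θ) / 4) := by
    refine R.slack_le.trans ?_
    rw [div_le_iff₀ (by positivity)]
    calc ε ^ 3 = ε ^ 2 * ε := by ring
      _ ≤ ε ^ 2 * ((1 - θ) * β ^ 2 / 2) := by gcongr
      _ ≤ ε ^ 1 * ((1 - θ) * β ^ 2 / 2) := by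
          have : 0 ≤ (1 - θ) * β ^ 2 / 2 := hε.le.trans hs2
          have : ε ^ 2 ≤ ε ^ 1 := pow_le_pow_of_le_one hε.le R.ε_le_one (by norm_num)
          gcongr
      _ = ε * ((1 - θ) / 4) * (2 * β ^ 2) := by ring
  have hbv : b * (c - P.f r) ≤ θ * ε := by
    rcases hcompl with h | h
    · have h1 := (abs_le.1 h).1
      have h2 := R.ε₃_le
      rw [← hθ] at h2
      linarith
    -- A multiplier at most `ε₄ = O(ε²)` times a bounded gap `c - f r` is negligible against `θ ε`.
    · rcases le_or_gt c (P.f r) with h1 | h1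
      · have : b * (c - P.f r) ≤ 0 := mul_nonpos_of_nonneg_of_nonpos hb0 (by linarith)
        have : 0 ≤ θ * ε := by positivity
        linarith
      · have h2 := hP.fStar_le happ.mem
        have h3 : ε₄ P A ε ≤ ε ^ 2 / β := R.ε₁_le
        calc b * (c - P.f r) ≤ ε ^ 2 / β * (cmax - P.fStar) := by
              have : 0 ≤ c - P.f r := by linarith
              have := h.trans h3
              gcongr
          _ = ε / β * (ε * (cmax - P.fStar)) := by ring
          _ ≤ ε / β * (θ * β) := by gcongr
          _ = θ * ε := by field_simp
  have hlow : ∀ w ∈ P.X ∩ P.lowerSolutions, w ∈ P.levG (DL P A ε) := fun w hw => by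
    refine P.levG_mono ?_ (hP.lower_mem_levG hw.2 R.x0_mem (le_D0 R.dz_ge))
    have := D0_add_le_DL hγ R.dz_ge
    nlinarith [sq_nonneg (R1 P A ε)]
  have hx0 := R.x0_lev hγ
  have hcomp : ∀ w ∈ P.X ∩ P.lowerSolutions, P.f w ≤ c →
      P.g r ≤ P.gStar + ε / 2 * (‖w - x0 P A ε‖ ^ 2 - ‖r - x0 P A ε‖ ^ 2)
        + θ * ε + ε * ((1 - θ) / 4) := fun w hw hwc => by
    have h1 := lagr_le_of_opt hε (happ.opt w hw.1)
    unfold lagr at h1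
    rw [hP.g_eq_gStar hw] at h1
    have h2 : b * P.f w ≤ b * c := by gcongr
    linarith
  obtain ⟨s, hs, hsc⟩ := hP.exists_f_lt hcp
  have hgr : P.g r ≤ P.gStar + (M ^ 2 / 2 + 2) * ε := by
    have h1 := hcomp s hs hsc.le
    have h2 : ‖s - x0 P A ε‖ ^ 2 ≤ M ^ 2 := by
      have := R.norm_sub_le (hlow s hs) hx0
      gcongr
    have h3 : ε / 2 * (‖s - x0 P A ε‖ ^ 2 - ‖r - x0 P A ε‖ ^ 2) ≤ ε / 2 * M ^ 2 := by
      have := sq_nonneg ‖r - x0 P A ε‖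
      gcongr
      linarith
    have h4 : θ * ε ≤ 1 * ε := by gcongr
    have h5 : ε * ((1 - θ) / 4) ≤ ε * 1 := by
      gcongr
      linarith
    linarith
  -- The second pass uses a solution so close to `r` that the regularization costs at most `ε
  -- (1-θ)/4`; the total `θ + (1-θ)/4 + (1-θ)/4` is below one.
  obtain ⟨w, hw, hwc, hwr⟩ := hnear c r hcp hc happ.mem
    (R.norm_sub_le happ.lev (hlow a ha)) (by linarith [R.ε₂_le]) hgr
  have h1 := hcomp w hw hwc
  have h2 : ‖w - x0 P A ε‖ ^ 2 - ‖r - x0 P A ε‖ ^ 2 ≤ (1 - θ) / (4 * M) * (2 * M) := by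
    have e1 := R.norm_sub_le (hlow w hw) hx0
    have e2 := R.norm_sub_le happ.lev hx0
    have e3 : ‖w - x0 P A ε‖ ≤ ‖w - r‖ + ‖r - x0 P A ε‖ := norm_sub_le_norm_sub_add_norm_sub _ _ _
    have e4 : ‖w - x0 P A ε‖ - ‖r - x0 P A ε‖ ≤ (1 - θ) / (4 * M) := by linarith
    have e5 : 0 ≤ (1 - θ) / (4 * M) := (norm_nonneg _).trans hwr
    calc ‖w - x0 P A ε‖ ^ 2 - ‖r - x0 P A ε‖ ^ 2
        = (‖w - x0 P A ε‖ - ‖r - x0 P A ε‖) * (‖w - x0 P A ε‖ + ‖r - x0 P A ε‖) := by ring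
      _ ≤ (1 - θ) / (4 * M) * (2 * M) := by
          gcongr
          linarith
  have h3 : (1 - θ) / (4 * M) * (2 * M) = (1 - θ) / 2 := by field_simp; norm_num
  rw [h3] at h2
  have h4 : ε / 2 * (‖w - x0 P A ε‖ ^ 2 - ‖r - x0 P A ε‖ ^ 2) ≤ ε / 2 * ((1 - θ) / 2) := by gcongr
  have h5 := hP.gStar_le R.xg_mem
  have h6 : 0 < ε * (1 - θ) := mul_pos hε (by linarith)
  linarith

/-- The invariant of the main loop. -/
structure MainInv (P : Problem n) (A : Params n) (M U ε : ℝ) (s : MainState n) : Prop where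
  l_le : s.l ≤ P.pStar
  u_le : s.u ≤ U
  f_xu : P.f s.xu = s.u
  g_xu : P.g s.xu ≤ P.gStar + 2 * ε
  xu_mem : s.xu ∈ P.X
  valid : s.Z.Valid P A ε
  near : ‖s.x - x0 P A ε‖ ≤ M
  not_halted : s.halted = false

/-- The main loop maintains its invariant and shrinks the gap between the bounds. -/
theorem Regime.mainBody_spec (R : Regime P A M d β CD U ε) (hP : P.Basic A.Lf A.Lg A.lf₂)
    (hA : A.Admissible P) (hsm : ε + ε ^ 3 / (2 * β ^ 2) ≤ 1) {T m N : ℕ}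
    (hT : CallSpec P A M ε T) (hm : M < 2 ^ m) (hN : 2 * M / 2 ^ N ≤ ε₄ P A ε)
    (hrej : ∀ c r, c ≤ max P.pStar U → DualSolution P A ε c r →
      P.g (xg P A ε) + ε < P.g r → c ≤ P.pStar)
    {s : MainState n} (hs : MainInv P A M U ε s) (hZ : s.Z.Brackets P A ε s.c)
    (hcond : mainCond ε s) (hreg : P.f (x0 P A ε) - s.c < -A.Δ₁) :
    MainInv P A M U ε (mainBody P A ε s).val ∧
      ((P.f (x0 P A ε) - (mainBody P A ε s).val.c < -A.Δ₁) →
        (mainBody P A ε s).val.Z.Brackets P A ε (mainBody P A ε s).val.c) ∧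
      (mainBody P A ε s).val.u - (mainBody P A ε s).val.l ≤ 5 / 6 * (s.u - s.l) ∧
      (mainBody P A ε s).cost ≤ N * T + 1 + (m + 2) * T := by
  have hε := R.ε_pos
  have he2 := R.ε₂_le
  have hgap : 3 * ε < s.u - s.l := by
    have := hcond.2
    linarith
  have hc : s.c = (s.l + s.u) / 2 := rfl
  -- Regularity rules out the early exit, since `l₀` lies below `f(x⁰)`.
  have hearly : ¬ s.c - l0 P A ε < A.Δ₁ := by
    unfold l0
    linarith
  obtain ⟨hdual, hcost⟩ := R.bisec_spec hP hA hT hN hs.valid hZ hs.near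
  have hcmax : s.c ≤ max P.pStar U := by
    have h1 := hs.l_le.trans (le_max_left P.pStar U)
    have h2 := hs.u_le.trans (le_max_right P.pStar U)
    linarith
  unfold mainBody
  rw [if_neg hearly]
  set r := bisec P A ε s.c s.Z s.x with hr
  obtain ⟨b, -, -, happ, hfr, -⟩ := id hdual
  simp only
  by_cases hif : P.g r.val > P.g (xg P A ε) + ε
  · rw [if_pos hif]
    have hcp := hrej s.c r.val hcmax hdual hif
    refine ⟨⟨hcp, hs.u_le, hs.f_xu, hs.g_xu, hs.xu_mem, ⟨le_rfl, hs.valid.a_nonneg.trans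
      hs.valid.a_le_b, hs.valid.b_le, hs.valid.approx⟩, R.near hA.γ₁_gt happ, hs.not_halted⟩,
      fun _ => ⟨?_, Or.inl rfl⟩, ?_, ?_⟩
    -- Rejection raises `c`, so the point at the right end stays feasible for the new constraint and
    -- the reset left end `0` brackets trivially.
    · have h1 := hZ.1
      change P.f s.Z.xb - (s.c + s.u) / 2 ≤ _
      linarith
    · change s.u - s.c ≤ _
      linarith
    · change r.cost + 1 ≤ _
      calc r.cost + 1 ≤ N * T + 1 := by gcongr
        _ ≤ N * T + 1 + (m + 2) * T := le_self_add
  · rw [if_neg hif]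
    obtain ⟨i1, i2, i3⟩ := R.intV_spec hP hA hsm hT hm ((s.l + P.f r.val) / 2)
      (R.near hA.γ₁_gt happ)
    refine ⟨⟨hs.l_le, ?_, rfl, ?_, happ.mem, i1, R.near hA.γ₁_gt i1.approx, hs.not_halted⟩,
      i3, ?_, ?_⟩
    · change P.f r.val ≤ U
      linarith [hs.u_le]
    · change P.g r.val ≤ _
      linarith [R.g_xg_le, not_lt.1 hif]
    -- The new upper bound is at most `c + ε`, and `ε` is below a third of the gap while the loop
    -- runs: `1/2 + 1/3 = 5/6`.
    · change P.f r.val - s.l ≤ _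
      linarith
    · change r.cost + 1 + _ ≤ _
      gcongr

theorem Regime.bivfa_spec (R : Regime P A M d β CD U ε) (hP : P.Basic A.Lf A.Lg A.lf₂)
    (hA : A.Admissible P) (hsm : ε + ε ^ 3 / (2 * β ^ 2) ≤ 1) {T m N N' TF TG : ℕ}
    (hT : CallSpec P A M ε T) (hm : M < 2 ^ m) (hN : 2 * M / 2 ^ N ≤ ε₄ P A ε)
    (hN' : (5 / 6) ^ N' * (U - P.fStar + 1) ≤ 3 * ε)
    (hrej : ∀ c r, c ≤ max P.pStar U → DualSolution P A ε c r →
      P.g (xg P A ε) + ε < P.g r → c ≤ P.pStar)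
    (hreg : RegularCondition P A ε) (hTF : (runF P A ε).cost ≤ TF) (hTG : (runG P A ε).cost ≤ TG) :
    P.IsOptimal (4 * ε) (3 * ε) (bivfa P A ε).val ∧
      (bivfa P A ε).cost ≤
        TF + TG + 2 + (m + 2) * T + N' * (N * T + 1 + (m + 2) * T) := by
  have hε := R.ε_pos
  have hx0 : ‖x0 P A ε - x0 P A ε‖ ≤ M := by
    rw [sub_self, norm_zero]
    exact R.M_pos.le
  obtain ⟨i1, i2, i3⟩ := R.intV_spec hP hA hsm hT hm ((l0 P A ε + u0 P A ε) / 2) hx0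
  set F : MainState n → MainState n := fun s => (mainBody P A ε s).val with hF
  set W := U - P.fStar + 1 with hW
  obtain ⟨⟨k, -, -, -, hinv, -, -⟩, hex, hcost⟩ := whileLoop_spec (cond := mainCond ε)
    (body := mainBody P A ε) (s := mainInit P A ε)
    -- The invariant records that `s` is the `k`-th iterate and that all earlier conditions held,
    -- because the regularity condition is stated for such iterates. Bracketing stays conditional on
    -- regularity at the current value.
    (fun k s => s = F^[k] (mainInit P A ε) ∧ (∀ j < k, mainCond ε (F^[j] (mainInit P A ε))) ∧
      MainInv P A M U ε s ∧
      (P.f (x0 P A ε) - s.c < -A.Δ₁ → s.Z.Brackets P A ε s.c) ∧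
      s.u - s.l ≤ (5 / 6) ^ k * W)
    N' (N * T + 1 + (m + 2) * T)
    (by
      refine ⟨rfl, fun j hj => absurd hj (Nat.not_lt_zero j), ⟨?_, R.u0_le, rfl, ?_, R.xg_mem, i1,
        R.near hA.γ₁_gt i1.approx, rfl⟩, i3, ?_⟩
      · change P.f (x0 P A ε) - ε ≤ _
        linarith [R.f_x0_le, hP.fStar_le_pStar]
      · change P.g (xg P A ε) ≤ _
        linarith [R.g_xg_le]
      · change u0 P A ε - (P.f (x0 P A ε) - ε) ≤ _
        rw [pow_zero, one_mul, hW]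
        linarith [R.u0_le, hP.fStar_le R.x0_mem, R.ε_le_one])
    (by
      rintro k s ⟨h1, h2, h3, h4, h5⟩ hc
      have h6 : ∀ j ≤ k, mainCond ε (F^[j] (mainInit P A ε)) := fun j hj => by
        rcases hj.lt_or_eq with h | rfl
        · exact h2 j h
        · rw [← h1]; exact hc
      have h7 := hreg k h6
      change P.f (x0 P A ε) - (F^[k] (mainInit P A ε)).c < -A.Δ₁ at h7
      rw [← h1] at h7
      obtain ⟨b1, b2, b3, b4⟩ := R.mainBody_spec hP hA hsm hT hm hN hrej h3 (h4 h7) hc h7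
      refine ⟨?_, ⟨?_, fun j hj => h6 j (by omega), b1, b2, ?_⟩, b4⟩
      · by_contra! hcon
        have h8 : (5 / 6 : ℝ) ^ k ≤ (5 / 6) ^ N' :=
          pow_le_pow_of_le_one (by norm_num) (by norm_num) hcon
        have h9 := hc.2
        have h10 : 0 < (5 / 6 : ℝ) ^ k := by positivity
        have hW0 : 0 < W := by
          by_contra! hW0
          have : (5 / 6 : ℝ) ^ k * W ≤ 0 := mul_nonpos_of_nonneg_of_nonpos h10.le hW0
          linarith
        have : (5 / 6 : ℝ) ^ k * W ≤ (5 / 6) ^ N' * W := by gcongr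
        linarith
      · rw [Function.iterate_succ_apply', ← h1]
      · refine b3.trans ?_
        rw [pow_succ]
        linarith)
  set s := (whileLoop (mainCond ε) (mainBody P A ε) (mainInit P A ε)).val with hs
  have hval : (bivfa P A ε).val = s.xu := rfl
  have hlen : s.u - s.l ≤ 3 * ε := by
    by_contra! hcon
    exact hex ⟨hinv.not_halted, by linarith⟩
  refine ⟨?_, ?_⟩
  · rw [hval]
    refine ⟨hinv.xu_mem, ?_, ?_⟩
    · rw [hinv.f_xu]
      linarith [hinv.l_le]
    · linarith [hinv.g_xu]
  · change (runF P A ε).cost + (runG P A ε).cost + 2 + (initialSearch P A ε).cost +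
      (whileLoop (mainCond ε) (mainBody P A ε) (mainInit P A ε)).cost ≤ _
    have i2' : (initialSearch P A ε).cost ≤ (m + 2) * T := i2
    gcongr

/-- It is applied with `(1/2)² ≤ 1/e` for bisection and `(5/6)⁸ ≤ 1/e` for the main loop; this is
where the factors `2` and `8` in the iteration counts originate. -/
theorem pow_mul_le_pow_of_log {q : ℝ} {p m : ℕ} (k : ℕ) (hq : 0 ≤ q)
    (hqp : q ^ p ≤ Real.exp (-1)) (hε : 0 < ε) (hε1 : ε ≤ 1) (hm : k * |Real.log ε| ≤ m) :
    q ^ (p * m) ≤ ε ^ k := by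
  rw [← exp_neg_mul_abs_log hε hε1, pow_mul]
  calc (q ^ p) ^ m ≤ Real.exp (-1) ^ m := by gcongr
    _ = Real.exp (-m) := by rw [← Real.exp_nat_mul]; ring_nf
    _ ≤ _ := by
      apply Real.exp_le_exp.2
      linarith

theorem one_third_le_exp_neg_one : (1 / 3 : ℝ) ≤ Real.exp (-1) := by
  rw [Real.exp_neg, one_div]
  apply inv_anti₀ (Real.exp_pos 1)
  exact (Real.exp_one_lt_d9.trans (by norm_num)).le

end Main

/-! ### Total query count and choice of the constants. -/

section Complexity

variable {n : ℕ}

/-- The total query count, in terms of `ℓ = |log ε|` and `Q = √(L_φ / ε)`. -/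
theorem total_cost_le {C CF CG Q ℓ : ℝ} {m T N N' TF TG : ℕ} (hC : 0 ≤ C) (hCF : 0 ≤ CF)
    (hCG : 0 ≤ CG) (hQ : 1 ≤ Q) (hℓ : 1 ≤ ℓ) (hT : (T : ℝ) ≤ C * (Q * ℓ))
    (hTF : (TF : ℝ) ≤ CF * Q) (hTG : (TG : ℝ) ≤ CG * Q) (hN : (N : ℝ) ≤ 8 * ℓ)
    (hN' : (N' : ℝ) ≤ 24 * ℓ) :
    ((TF + TG + 2 + (m + 2) * T + N' * (N * T + 1 + (m + 2) * T) : ℕ) : ℝ) ≤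
      (CF + CG + 2 + (m + 2) * C + 24 * (8 * C + 1 + (m + 2) * C)) * Q * ℓ ^ 3 := by
  have hQ0 : 0 ≤ Q := by linarith
  have hℓ0 : 0 ≤ ℓ := by linarith
  have p1 : ℓ ≤ ℓ ^ 3 := le_self_pow₀ hℓ (by norm_num)
  have p3 : (1 : ℝ) ≤ ℓ ^ 3 := one_le_pow₀ hℓ
  have q1 : ℓ ≤ ℓ ^ 2 := le_self_pow₀ hℓ (by norm_num)
  have q2 : (1 : ℝ) ≤ Q * ℓ ^ 2 := one_le_mul_of_one_le_of_one_le hQ (one_le_pow₀ hℓ)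
  have h1 : CF * Q ≤ CF * Q * ℓ ^ 3 := le_mul_of_one_le_right (by positivity) p3
  have h2 : CG * Q ≤ CG * Q * ℓ ^ 3 := le_mul_of_one_le_right (by positivity) p3
  have h3 : (1 : ℝ) ≤ Q * ℓ ^ 3 := one_le_mul_of_one_le_of_one_le hQ p3
  have h4 : ((m : ℝ) + 2) * T ≤ (m + 2) * C * Q * ℓ ^ 3 := by
    calc ((m : ℝ) + 2) * T ≤ (m + 2) * (C * (Q * ℓ)) := by gcongr
      _ = (m + 2) * C * Q * ℓ := by ring
      _ ≤ (m + 2) * C * Q * ℓ ^ 3 := by gcongr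
  have h5 : ((m : ℝ) + 2) * T ≤ (m + 2) * C * (Q * ℓ ^ 2) := by
    calc ((m : ℝ) + 2) * T ≤ (m + 2) * (C * (Q * ℓ)) := by gcongr
      _ = (m + 2) * C * (Q * ℓ) := by ring
      _ ≤ (m + 2) * C * (Q * ℓ ^ 2) := by gcongr
  have h6 : (N : ℝ) * T ≤ 8 * C * (Q * ℓ ^ 2) := by
    calc (N : ℝ) * T ≤ 8 * ℓ * (C * (Q * ℓ)) := by gcongr
      _ = _ := by ring
  have h7 : (N' : ℝ) * (N * T + 1 + (m + 2) * T) ≤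
      24 * ℓ * ((8 * C + 1 + (m + 2) * C) * (Q * ℓ ^ 2)) := by
    gcongr
    linarith
  push_cast
  linarith

/-- The guarantee and the complexity of the algorithm for all small tolerances. -/
theorem exists_complexity_bound (P : Problem n) (A : Params n)
    (hP : P.Basic A.Lf A.Lg A.lf₂) (hA : A.Admissible P) {M : ℝ} (hM : 0 < M) :
    ∃ C : ℝ, 0 < C ∧ ∀ᶠ ε in 𝓝[>] (0 : ℝ), RegularCondition P A ε → BoundedLevelSets P A ε →
      1 ≤ 2 * Dz P A ε → Dz P A ε ≤ M → Dg P A ε ≤ M →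
      P.IsOptimal (4 * ε) (3 * ε) (bivfa P A ε).val ∧
      ∃ T : ℕ, (bivfa P A ε).cost = (T : ℕ∞) ∧
        (T : ℝ) ≤ C * √((A.Lg + 2 * Dz P A ε * A.Lf + 1) / ε) * |Real.log ε| ^ 3 := by
  obtain ⟨d, β, CD, U, hd, hβ, hCD, hreg⟩ := exists_regime hP hA hM
  obtain ⟨C, hC, hcall⟩ := exists_call hP hA (U := U) hM hd hβ hCD
  obtain ⟨CF, hCF, hF⟩ := hA.exists_runF hP
  obtain ⟨CG, U', hCG, hG⟩ := hA.exists_runG hP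
  obtain ⟨a, ha⟩ := hP.feasible
  obtain ⟨m, hm⟩ := pow_unbounded_of_one_lt M (one_lt_two : (1 : ℝ) < 2)
  set θ := 1 / (1 + d * (1 + d)) with hθ
  have hθ0 : 0 < θ := by positivity
  have hθ1 : 0 < 1 - θ := by
    rw [hθ, sub_pos, div_lt_one (by positivity)]
    nlinarith
  have hnear := hP.exists_near_solution (M ^ 2 / 2 + 2) M (max P.pStar U) a
    (by positivity : 0 < (1 - θ) / (4 * M))
  set W := U - P.fStar + 1 with hW
  set G := max P.pStar U - P.fStar with hG'
  refine ⟨CF + CG + 2 + (m + 2) * C + 24 * (8 * C + 1 + (m + 2) * C),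
    by positivity, ?_⟩
  -- In order, the explicit thresholds ensure: `|log ε| ≥ 1`; the slack condition `hsm`; the
  -- small-multiplier and slack estimates behind rejection; the bisection count; the outer count.
  filter_upwards [hreg, hcall, hnear, eventually_pos_lt (Real.exp_pos (-1)),
    eventually_pos_lt (by positivity : 0 < 1 / (1 + 1 / (2 * β ^ 2))),
    eventually_pos_lt (by positivity : 0 < θ * β / (|G| + 1)),
    eventually_pos_lt (by positivity : 0 < (1 - θ) * β ^ 2 / 2),
    eventually_pos_lt (by positivity : 0 < 1 / (2 * M * CD)),
    eventually_pos_lt (by positivity : 0 < 3 / (|W| + 1))]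
    with ε e1 e2 e3 e4 e5 e6 e7 e8 e9 hR hB hz1 hz2 hg
  have R := e1 ⟨hB, hz1, hz2, hg⟩
  obtain ⟨T, hT1, hT⟩ := e2 R
  have hε := R.ε_pos
  have hε1 := R.ε_le_one
  have hℓ := one_le_abs_log hε e4.2.le
  obtain ⟨-, -, TF, hTF, hTF'⟩ := hF ε hε hε1
  obtain ⟨-, -, -, TG, hTG, hTG'⟩ := hG ε hε hε1
  have hsm : ε + ε ^ 3 / (2 * β ^ 2) ≤ 1 := by
    have h1 := ((lt_div_iff₀ (by positivity)).1 e5.2).le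
    have h2 : ε ^ 3 / (2 * β ^ 2) ≤ ε ^ 1 / (2 * β ^ 2) := by
      have : ε ^ 3 ≤ ε ^ 1 := pow_le_pow_of_le_one hε.le hε1 (by norm_num)
      gcongr
    have h3 : ε ^ 1 / (2 * β ^ 2) = ε * (1 / (2 * β ^ 2)) := by ring
    linarith
  set ℓ := |Real.log ε| with hℓdef
  have hceil : ∀ k : ℕ, (⌈k * ℓ⌉₊ : ℝ) ≤ (k + 1) * ℓ := fun k => by
    have := Nat.ceil_lt_add_one (by positivity : 0 ≤ k * ℓ)
    linarith
  have hN : 2 * M / 2 ^ (2 * ⌈(3 : ℕ) * ℓ⌉₊) ≤ ε₄ P A ε := by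
    have h1 := pow_mul_le_pow_of_log (q := 1 / 2) (p := 2) 3 (by norm_num)
      (le_trans (by norm_num) one_third_le_exp_neg_one) hε hε1
      (Nat.le_ceil ((3 : ℕ) * ℓ))
    have h2 := ((lt_div_iff₀ (by positivity)).1 e8.2).le
    refine le_trans ?_ (show ε ^ 2 / CD ≤ ε₄ P A ε from R.le_ε₁)
    rw [one_div, inv_pow] at h1
    rw [div_eq_mul_inv, le_div_iff₀ hCD]
    calc 2 * M * (2 ^ (2 * ⌈(3 : ℕ) * ℓ⌉₊))⁻¹ * CD ≤ 2 * M * ε ^ 3 * CD := by gcongr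
      _ = ε ^ 2 * (ε * (2 * M * CD)) := by ring
      _ ≤ ε ^ 2 * 1 := by gcongr
      _ = ε ^ 2 := mul_one _
  have hN' : (5 / 6) ^ (8 * ⌈(2 : ℕ) * ℓ⌉₊) * (U - P.fStar + 1) ≤ 3 * ε := by
    have h1 := pow_mul_le_pow_of_log (q := 5 / 6) (p := 8) 2 (by norm_num)
      (le_trans (by norm_num) one_third_le_exp_neg_one) hε hε1
      (Nat.le_ceil ((2 : ℕ) * ℓ))
    have h2 := ((lt_div_iff₀ (by positivity)).1 e9.2).le
    calc (5 / 6) ^ (8 * ⌈(2 : ℕ) * ℓ⌉₊) * (U - P.fStar + 1)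
        ≤ (5 / 6) ^ (8 * ⌈(2 : ℕ) * ℓ⌉₊) * |W| := by
          gcongr
          exact le_abs_self _
      _ ≤ ε ^ 2 * |W| := by gcongr
      _ = ε * (ε * |W|) := by ring
      _ ≤ ε * 3 := by
          gcongr
          linarith
      _ = 3 * ε := mul_comm _ _
  have hrej : ∀ c r, c ≤ max P.pStar U → DualSolution P A ε c r →
      P.g (xg P A ε) + ε < P.g r → c ≤ P.pStar := fun c r hc hr hlt =>
    R.le_pStar_of_reject hP hA.γ₁_gt hθ ha e3 (by
      have h2 := ((lt_div_iff₀ (by positivity)).1 e6.2).le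
      have h3 : ε * G ≤ ε * |G| := by
        gcongr
        exact le_abs_self _
      linarith) e7.2.le hc hr hlt
  obtain ⟨hopt, hcost⟩ := R.bivfa_spec hP hA hsm hT hm hN hN' hrej hR hTF hTG
  refine ⟨hopt, ?_⟩
  have hcost' : (bivfa P A ε).cost ≤ ((TF + TG + 2 + (m + 2) * T + 8 * ⌈(2 : ℕ) * ℓ⌉₊ *
      (2 * ⌈(3 : ℕ) * ℓ⌉₊ * T + 1 + (m + 2) * T) : ℕ) : ℕ∞) := by
    refine hcost.trans (le_of_eq ?_)
    push_cast
    ring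
  obtain ⟨T', hT', hle⟩ := ENat.le_natCast_iff.1 hcost'
  refine ⟨T', hT', le_trans (Nat.cast_le.2 hle) ?_⟩
  have hLφ := one_le_Lφ hz1
  have hQ : 1 / √ε ≤ √(Lφ P A ε / ε) := by
    rw [← Real.sqrt_one, ← Real.sqrt_div zero_le_one]
    gcongr
  have hQ1 : 1 ≤ √(Lφ P A ε / ε) := by
    rw [Real.one_le_sqrt, one_le_div hε]
    linarith
  change _ ≤ _ * √(Lφ P A ε / ε) * _
  refine total_cost_le hC hCF hCG hQ1 hℓ hT1 ?_ ?_ ?_ ?_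
  · rw [div_eq_mul_one_div] at hTF'
    exact hTF'.trans (by gcongr)
  · rw [div_eq_mul_one_div] at hTG'
    exact hTG'.trans (by gcongr)
  · have := hceil 3
    push_cast at this ⊢
    linarith
  · have := hceil 2
    push_cast at this ⊢
    linarith

end Complexity

end SimpleBilevel

theorem theorem1 {n : ℕ} (P : SimpleBilevel.Problem n) (A : SimpleBilevel.Params n)
    (hP : P.Basic A.Lf A.Lg A.lf₂) (hA : A.Admissible P) (M : ℝ) :
    ∃ C : ℝ, 0 < C ∧ ∃ ε₀ : ℝ, 0 < ε₀ ∧ ∀ ε : ℝ, 0 < ε → ε < ε₀ →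
      SimpleBilevel.RegularCondition P A ε → SimpleBilevel.BoundedLevelSets P A ε →
      1 ≤ 2 * SimpleBilevel.Dz P A ε → SimpleBilevel.Dz P A ε ≤ M →
      SimpleBilevel.Dg P A ε ≤ M →
      P.IsOptimal (4 * ε) (3 * ε) (SimpleBilevel.bivfa P A ε).val ∧
      ∃ T : ℕ, (SimpleBilevel.bivfa P A ε).cost = (T : ℕ∞) ∧
        (T : ℝ) ≤ C * √((A.Lg + 2 * SimpleBilevel.Dz P A ε * A.Lf + 1) / ε) *
          |Real.log ε| ^ 3 := by
  rcases le_or_gt M 0 with hM | hM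
  -- For `M ≤ 0` the claim is vacuous, since `1 ≤ 2 D_z ≤ 2M` is impossible.
  · exact ⟨1, one_pos, 1, one_pos, fun ε _ _ _ _ h1 h2 _ => by linarith⟩
  · obtain ⟨C, hC, hev⟩ := SimpleBilevel.exists_complexity_bound P A hP hA hM
    obtain ⟨ε₀, hε₀, hsub⟩ := mem_nhdsGT_iff_exists_Ioo_subset.1 hev
    exact ⟨C, hC, ε₀, hε₀, fun ε h1 h2 => hsub ⟨h1, h2⟩⟩
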